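/- For integers $0\le F\le M$ let $\mathcal I=\lceil \log_2\binom{M}{F}\rceil$. For $\mathbf b\in\{0,1\}^M$ and $j\in\{1,\dots,M\}$ let $\mathsf{sgn\text{-}rank}(j,\mathbf b)=\prod_{i=1}^{j}(-1)^{b_i}$ and let $\mathsf{bit\text{-}flip}(j,\mathbf b)$ be $\mathbf b$ with its $j$-th bit negated. A fermion data structure on $n$ qubits for length-$M$ bit strings of Hamming weight at most $F$ consists of a linear injective map from the span of the Fock states $|\mathbf b\rangle_f$, where $\mathbf b\in\{0,1\}^M$ has Hamming weight at most $F$, to the space of $n$ qubits, sending each Fock state $|\mathbf b\rangle_f$ to a computational basis state $|\mathbf b\rangle$, together with quantum circuits $F_j,R_j$ ($1\le j\le M$) on these $n$ qubits (so that ancillas are counted in $n$), made of one- and two-qubit unitary gates, such that for every such $\mathbf b$ $$F_j|\mathbf b\rangle=|\mathsf{bit\text{-}flip}(j,\mathbf b)\rangle\ \text{ whenever } \mathsf{bit\text{-}flip}(j,\mathbf b) \text{ has Hamming weight at most } F,\qquad R_j|\mathbf b\rangle=\mathsf{sgn\text{-}rank}(j,\mathbf b)\,|\mathbf b\rangle .$$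 Its gate complexity and its depth are the maximal gate count and the maximal depth of the circuits $F_j,R_j$ over all $j$. Theorem. There is a universal constant $C>0$ such that for all integers $M\ge 3$ and $0\le F<M$ there is a fermion data structure for length-$M$ bit strings of Hamming weight at most $F$ that uses at most $\mathcal I+C\,F$ qubits and has gate complexity at most $C\,\mathcal I$ and depth at most $C\,\log_2 M\,\log_2\log_2 M$. -/

import Mathlib

namespace FermionEncoding

/-- The Hamming weight of a bit string: the number of its ones. -/
def hammingWeight {M : ℕ} (b : Fin M → Bool) : ℕ :=
  (Finset.univ.filter fun i => b i = true).card

/-- The sign rank of index `j`: the parity of the bits up to and including position `j`,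
as `1` (even) or `-1` (odd). The positions `1, …, M` are numbered `0, …, M - 1` here. -/
def sgnRank {M : ℕ} (j : Fin M) (b : Fin M → Bool) : ℤ :=
  ∏ i ∈ Finset.Iic j, (-1) ^ (b i).toNat

/-- The bit string `b` with its `j`-th bit negated. -/
def bitFlip {M : ℕ} (j : Fin M) (b : Fin M → Bool) : Fin M → Bool :=
  Function.update b j (!b j)

/-- Occupation-number strings of `M` modes with at least `lo` and at most `hi` fermions. -/
abbrev Occupation (M lo hi : ℕ) : Type :=
  {b : Fin M → Bool // lo ≤ hammingWeight b ∧ hammingWeight b ≤ hi}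

/-- The Fock space of `M` modes restricted to occupation between `lo` and `hi`: the Hilbert
space whose orthonormal basis is the Fock states with occupation in that range. -/
abbrev FockSpace (M lo hi : ℕ) : Type :=
  EuclideanSpace ℂ (Occupation M lo hi)

/-- The Hilbert space of `n` qubits. -/
abbrev QubitSpace (n : ℕ) : Type :=
  EuclideanSpace ℂ (Fin n → Bool)

/-- The Fock state of the occupation string `b`. -/
noncomputable def fockState {M lo hi : ℕ} (b : Occupation M lo hi) : FockSpace M lo hi :=
  EuclideanSpace.single b 1

/-- The computational basis state of the bit string `x`. -/
noncomputable def basisState {n : ℕ} (x : Fin n → Bool) : QubitSpace n :=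
  EuclideanSpace.single x 1

/-- A gate on an `n`-qubit register: an arbitrary one- or two-qubit unitary, together with the
distinct qubits on which it acts. -/
structure Gate (n : ℕ) where
  arity : ℕ
  one_le_arity : 1 ≤ arity
  arity_le_two : arity ≤ 2
  wires : Fin arity ↪ Fin n
  unitary : Matrix.unitaryGroup (Fin arity → Bool) ℂ

/-- The matrix of a gate on the whole register: the unitary of the gate on its own qubits,
tensored with the identity on all the others. -/
noncomputable def Gate.matrix {n : ℕ} (g : Gate n) :
    Matrix (Fin n → Bool) (Fin n → Bool) ℂ :=
  open Classical in
  Matrix.of fun x y =>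
    if ∀ i, i ∉ Set.range g.wires → x i = y i then
      (g.unitary : Matrix (Fin g.arity → Bool) (Fin g.arity → Bool) ℂ)
        (fun a => x (g.wires a)) (fun a => y (g.wires a))
    else 0

/-- The action of a gate on a state of the register. -/
noncomputable def Gate.apply {n : ℕ} (g : Gate n) (ψ : QubitSpace n) : QubitSpace n :=
  WithLp.toLp 2 (g.matrix.mulVec ψ.ofLp)

/-- The action of a sequence of gates; the head of the list is applied first. -/
noncomputable def runGates {n : ℕ} : List (Gate n) → QubitSpace n → QubitSpace n
  | [], ψ => ψ
  | g :: gs, ψ => runGates gs (g.apply ψ)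

/-- An `n`-qubit quantum circuit: a sequence of layers (time steps), each of which consists of
gates that act on pairwise disjoint sets of qubits. There are no qubits besides the `n` ones. -/
structure Circuit (n : ℕ) where
  layers : List (List (Gate n))
  disjoint_wires : ∀ L ∈ layers,
    L.Pairwise fun g h => Disjoint (Set.range g.wires) (Set.range h.wires)

/-- The number of gates of a circuit. -/
def Circuit.gateCount {n : ℕ} (C : Circuit n) : ℕ :=
  C.layers.flatten.length

/-- The depth of a circuit: its number of layers. -/
def Circuit.depth {n : ℕ} (C : Circuit n) : ℕ :=
  C.layers.length

/-- The action of a circuit; the first layer is applied first. -/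
noncomputable def Circuit.run {n : ℕ} (C : Circuit n) (ψ : QubitSpace n) : QubitSpace n :=
  runGates C.layers.flatten ψ

/-- A fermion data structure on `n` qubits for `M` modes and occupation between `lo` and `hi`:
a linear injective encoding that maps Fock states to computational basis states, with `n`-qubit
circuits that answer bit-flip queries (whenever the flipped string stays within the occupation
range) and sign-rank queries. Ancillas of the circuits are among the `n` qubits. -/
structure FermionDataStructure (M lo hi n : ℕ) where
  encode : FockSpace M lo hi →ₗ[ℂ] QubitSpace n
  encode_injective : Function.Injective encode
  encode_fockState : ∀ b, ∃ x, encode (fockState b) = basisState x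
  flipCircuit : Fin M → Circuit n
  rankCircuit : Fin M → Circuit n
  flip_spec : ∀ (j : Fin M) (b : Occupation M lo hi)
    (h : lo ≤ hammingWeight (bitFlip j b.1) ∧ hammingWeight (bitFlip j b.1) ≤ hi),
    (flipCircuit j).run (encode (fockState b)) = encode (fockState ⟨bitFlip j b.1, h⟩)
  rank_spec : ∀ (j : Fin M) (b : Occupation M lo hi),
    (rankCircuit j).run (encode (fockState b)) =
      (sgnRank j b.1 : ℂ) • encode (fockState b)

/-- The gate complexity: the maximal gate count of a query circuit, over all indices. -/
def FermionDataStructure.gateComplexity {M lo hi n : ℕ}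
    (D : FermionDataStructure M lo hi n) : ℕ :=
  Finset.univ.sup fun j => max (D.flipCircuit j).gateCount (D.rankCircuit j).gateCount

/-- The depth complexity: the maximal depth of a query circuit, over all indices. -/
def FermionDataStructure.depthComplexity {M lo hi n : ℕ}
    (D : FermionDataStructure M lo hi n) : ℕ :=
  Finset.univ.sup fun j => max (D.flipCircuit j).depth (D.rankCircuit j).depth

/-- The information-theoretic number of qubits `⌈log₂ (M choose F)⌉`. -/
noncomputable def infoQubits (M F : ℕ) : ℕ :=
  ⌈Real.logb 2 (M.choose F : ℝ)⌉₊

end FermionEncoding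

/-! ### The action of gates on amplitudes, and circuits run side by side -/

namespace FermionEncoding

open Function

/-! A string of weight at most `F` is stored through the sorted list of the positions of its ones,
compressed as in the Elias–Fano code. The positions are cut into at most `F` blocks of length `2 ^
(2 * h)`. Slot `s` keeps only the `2 * h` low bits of the position of the one number `s`. If `h` is
minimal with `M ≤ F * 2 ^ (2 * h)`, the estimate `pow_le_choose_of_mul_le` bounds the bits in all
slots by `infoQubits M F + 2 * F`. The block numbers are kept in a unary code, in which every block
contributes its ones followed by a delimiter. By `le_delims_iff`, whether the one number `s` lies
beyond the first `K` blocks is a question about the number of delimiters before a single position of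
this code.

The delimiter counts live in a binary tree with `O(F)` nodes. Each node has one bit, the parity of
the quotient of the count before its first position by its width. Since the count is zero at the
root and moves by at most one per position, these parities determine the quotients along every path
(`nodeCnt_half`, `nodeCnt_bounds`). All leaves can compare their counts with a fixed threshold
simultaneously, with three auxiliary bits per node (`compareStep_eq`). A flip shifts the unary code
by one symbol, and the tree is repaired from the leaves upwards by a rule for carries
(`nodeChange_internal`).

A query at `j` compares the offset of `j` with the offsets in all slots at once. Clean work bits for
that would exceed the `O(F)` ancillas available. The comparison is a chain of affine maps over
GF(2), and such a chain can be evaluated with borrowed bits of arbitrary content (`exists_ladder`).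
So each half of the bits of a slot serves as work space for the other half (`exists_slot_chain`).
The query yields for every slot the flag that its one is not before `j`, and the bit at `j`. The
sign rank is then a product of single-bit signs (`exists_rank`). A flip moves the offsets of the
flagged slots by one slot. The registers that recorded the change are erased by a computation from
the new string, which works because a flip is an involution and keeps the number of ones before `j`
(`exists_flip`).

If `M ≤ 2 * F`, the information bound may be as small as about `log₂ M`, so only logarithmically
many gates are available, but `O(M)` qubits are allowed. Then the parities of all dyadic intervals
are stored (`exists_tree_structure`).

All computations are classical reversible operations on a bounded number of bits. Each is an exact
product of boundedly many one- and two-qubit gates without ancillas (`RevCircuit.exists_circuit`).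
The depth obtained is `O(log₂ M)`; the factor `log₂ log₂ M` only has to be bounded below by a
positive constant, as it is for `M ≥ 3`. -/

theorem Gate.apply_apply {n : ℕ} (g : Gate n) (ψ : QubitSpace n) (x : Fin n → Bool) :
    g.apply ψ x = ∑ u : Fin g.arity → Bool,
      (g.unitary : Matrix (Fin g.arity → Bool) (Fin g.arity → Bool) ℂ) (fun a => x (g.wires a)) u
        * ψ (extend g.wires u x) := by
  classical
  have h1 : g.apply ψ x = ∑ y, g.matrix x y * ψ y := rfl
  rw [h1]
  symm
  apply Finset.sum_of_injOn (fun u => extend g.wires u x)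
  · intro u _ v _ h
    funext a
    have := congrFun h (g.wires a)
    simpa [g.wires.injective.extend_apply] using this
  · intro _ _; simp
  · intro y _ hy
    have : ¬ ∀ i, i ∉ Set.range g.wires → x i = y i := by
      intro h
      apply hy
      refine ⟨fun a => y (g.wires a), by simp, ?_⟩
      funext i
      by_cases hi : ∃ a, g.wires a = i
      · obtain ⟨a, rfl⟩ := hi
        simp [g.wires.injective.extend_apply]
      · simp only [extend_apply' _ _ _ hi]
        exact h i hi
    rw [Gate.matrix, Matrix.of_apply, if_neg this, zero_mul]
  · intro u _
    have : ∀ i, i ∉ Set.range g.wires → x i = extend g.wires u x i := by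
      intro i hi
      rw [extend_apply' _ _ _ hi]
    simp only [Gate.matrix, Matrix.of_apply]
    rw [if_pos this]
    simp [g.wires.injective.extend_apply]

theorem extend_comm_of_disjoint {α β ι γ : Type*} (f : α ↪ ι) (g : β ↪ ι)
    (h : Disjoint (Set.range f) (Set.range g)) (u : α → γ) (v : β → γ) (x : ι → γ) :
    extend f u (extend g v x) = extend g v (extend f u x) := by
  funext i
  by_cases hf : ∃ a, f a = i
  · have hg : ¬ ∃ b, g b = i := fun hg => Set.disjoint_left.1 h hf hg
    obtain ⟨a, rfl⟩ := hf
    simp [f.injective.extend_apply, extend_apply' _ _ _ hg]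
  · by_cases hg : ∃ b, g b = i
    · obtain ⟨b, rfl⟩ := hg
      simp [g.injective.extend_apply, extend_apply' _ _ _ hf]
    · simp [extend_apply' _ _ _ hf, extend_apply' _ _ _ hg]

theorem Gate.apply_comm {n : ℕ} (g k : Gate n)
    (h : Disjoint (Set.range g.wires) (Set.range k.wires)) (ψ : QubitSpace n) :
    g.apply (k.apply ψ) = k.apply (g.apply ψ) := by
  ext x
  have hg : ∀ u, (fun a => extend g.wires u x (k.wires a)) = fun a => x (k.wires a) := by
    intro u
    funext a
    exact extend_apply' _ _ _ fun hh => Set.disjoint_left.1 h hh ⟨a, rfl⟩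
  have hk : ∀ u, (fun a => extend k.wires u x (g.wires a)) = fun a => x (g.wires a) := by
    intro u
    funext a
    exact extend_apply' _ _ _ fun hh => Set.disjoint_left.1 h ⟨a, rfl⟩ hh
  simp only [Gate.apply_apply, hg, hk, Finset.mul_sum]
  rw [Finset.sum_comm]
  refine Finset.sum_congr rfl fun v _ => Finset.sum_congr rfl fun u _ => ?_
  rw [extend_comm_of_disjoint _ _ h]
  ring

theorem runGates_append {n : ℕ} (A B : List (Gate n)) (ψ : QubitSpace n) :
    runGates (A ++ B) ψ = runGates B (runGates A ψ) := by
  induction A generalizing ψ with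
  | nil => rfl
  | cons g A ih => simp [runGates, ih]

/-- Two gates act on disjoint sets of qubits. -/
def Gate.Indep {n : ℕ} (g k : Gate n) : Prop :=
  Disjoint (Set.range g.wires) (Set.range k.wires)

theorem runGates_apply_comm {n : ℕ} (A : List (Gate n)) (g : Gate n)
    (h : ∀ k ∈ A, g.Indep k) (ψ : QubitSpace n) :
    runGates A (g.apply ψ) = g.apply (runGates A ψ) := by
  induction A generalizing ψ with
  | nil => rfl
  | cons k A ih =>
    simp only [runGates]
    rw [Gate.apply_comm k g (h k (by simp)).symm, ih fun l hl => h l (by simp [hl])]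

theorem runGates_comm {n : ℕ} (A B : List (Gate n)) (h : ∀ g ∈ A, ∀ k ∈ B, g.Indep k)
    (ψ : QubitSpace n) : runGates A (runGates B ψ) = runGates B (runGates A ψ) := by
  induction A generalizing ψ with
  | nil => rfl
  | cons g A ih =>
    simp only [runGates]
    rw [← runGates_apply_comm B g (h g (by simp)), ih fun l hl => h l (by simp [hl])]

/-- Two layered circuits, run side by side. -/
def parLayers {α : Type*} : List (List α) → List (List α) → List (List α)
  | [], B => B
  | A, [] => A
  | a :: A, b :: B => (a ++ b) :: parLayers A B

theorem mem_flatten_parLayers {α : Type*} (A B : List (List α)) (x : α) :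
    x ∈ (parLayers A B).flatten ↔ x ∈ A.flatten ∨ x ∈ B.flatten := by
  induction A, B using parLayers.induct with
  | case1 B => simp [parLayers]
  | case2 A h => simp [parLayers]
  | case3 a A b B ih => simp only [parLayers, List.flatten_cons, List.mem_append, ih]; tauto

theorem length_parLayers {α : Type*} (A B : List (List α)) :
    (parLayers A B).length = max A.length B.length := by
  induction A, B using parLayers.induct with
  | case1 B => simp [parLayers]
  | case2 A h => simp [parLayers]
  | case3 a A b B ih => simp only [parLayers, List.length_cons, ih]; omega

theorem length_flatten_parLayers {α : Type*} (A B : List (List α)) :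
    (parLayers A B).flatten.length = A.flatten.length + B.flatten.length := by
  induction A, B using parLayers.induct with
  | case1 B => simp [parLayers]
  | case2 A h => simp [parLayers]
  | case3 a A b B ih =>
    simp only [parLayers, List.flatten_cons, List.length_append, ih]; omega

theorem pairwise_parLayers {n : ℕ} (A B : List (List (Gate n)))
    (hA : ∀ L ∈ A, L.Pairwise Gate.Indep) (hB : ∀ L ∈ B, L.Pairwise Gate.Indep)
    (h : ∀ g ∈ A.flatten, ∀ k ∈ B.flatten, g.Indep k) :
    ∀ L ∈ parLayers A B, L.Pairwise Gate.Indep := by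
  induction A, B using parLayers.induct with
  | case1 B => simpa [parLayers] using hB
  | case2 A h => simpa [parLayers] using hA
  | case3 a A b B ih =>
    simp only [List.flatten_cons, List.mem_append, List.mem_cons] at *
    simp only [parLayers, List.mem_cons]
    rintro L (rfl | hL)
    · rw [List.pairwise_append]
      exact ⟨hA _ (Or.inl rfl), hB _ (Or.inl rfl), fun g hg k hk => h g (Or.inl hg) k (Or.inl hk)⟩
    · exact ih (fun L hL => hA L (Or.inr hL)) (fun L hL => hB L (Or.inr hL))
        (fun g hg k hk => h g (Or.inr hg) k (Or.inr hk)) L hL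

theorem runGates_parLayers {n : ℕ} (A B : List (List (Gate n)))
    (h : ∀ g ∈ A.flatten, ∀ k ∈ B.flatten, g.Indep k) (ψ : QubitSpace n) :
    runGates (parLayers A B).flatten ψ = runGates B.flatten (runGates A.flatten ψ) := by
  induction A, B using parLayers.induct generalizing ψ with
  | case1 B => simp [parLayers, runGates]
  | case2 A h => simp [parLayers, runGates]
  | case3 a A b B ih =>
    simp only [List.flatten_cons, List.mem_append] at *
    simp only [parLayers, List.flatten_cons, runGates_append]
    rw [ih fun g hg k hk => h g (Or.inr hg) k (Or.inr hk)]
    rw [runGates_comm A.flatten b fun g hg k hk => h g (Or.inr hg) k (Or.inl hk)]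

/-! ### Exact synthesis of controlled Boolean functions -/

/-- The gate with the unitary `U` on the qubits `w`. -/
noncomputable def mkGate {n k : ℕ} (h1 : 1 ≤ k) (h2 : k ≤ 2) (w : Fin k ↪ Fin n)
    (U : (Fin k → Bool) → (Fin k → Bool) → ℂ)
    (hU : Matrix.of U ∈ Matrix.unitaryGroup (Fin k → Bool) ℂ) : Gate n :=
  ⟨k, h1, h2, w, ⟨Matrix.of U, hU⟩⟩

theorem mkGate_apply {n k : ℕ} (h1 : 1 ≤ k) (h2 : k ≤ 2) (w : Fin k ↪ Fin n)
    (U : (Fin k → Bool) → (Fin k → Bool) → ℂ) (hU) (ψ : QubitSpace n) (x : Fin n → Bool) :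
    (mkGate h1 h2 w U hU).apply ψ x = ∑ u : Fin k → Bool,
      U (fun a => x (w a)) u * ψ (extend w u x) :=
  Gate.apply_apply _ ψ x

theorem extend_self {α ι γ : Type*} (f : α ↪ ι) (x : ι → γ) :
    extend f (fun a => x (f a)) x = x := by
  funext i
  by_cases hf : ∃ a, f a = i
  · obtain ⟨a, rfl⟩ := hf
    simp [f.injective.extend_apply]
  · simp [extend_apply' _ _ _ hf]

/-- A single qubit, as the wires of a gate. -/
def oneWire {n : ℕ} (w : Fin n) : Fin 1 ↪ Fin n :=
  ⟨fun _ => w, fun _ _ _ => Subsingleton.elim _ _⟩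

theorem oneWire_apply {n : ℕ} (w : Fin n) (a : Fin 1) : oneWire w a = w := rfl

/-- Two distinct qubits, as the wires of a gate. -/
def twoWires {n : ℕ} (a b : Fin n) (hab : a ≠ b) : Fin 2 ↪ Fin n :=
  ⟨![a, b], by
    intro i j h
    fin_cases i <;> fin_cases j <;> simp_all⟩

theorem twoWires_zero {n : ℕ} (a b : Fin n) (hab : a ≠ b) : twoWires a b hab 0 = a := rfl

theorem twoWires_one {n : ℕ} (a b : Fin n) (hab : a ≠ b) : twoWires a b hab 1 = b := rfl

/-- The one-qubit gate that multiplies the amplitudes by a phase `d` of the qubit's value. -/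
noncomputable def phaseGate {n : ℕ} (w : Fin n) (d : Bool → ℂ) (hd : ∀ b, ‖d b‖ = 1) : Gate n :=
  mkGate le_rfl (by norm_num) (oneWire w) (fun u v => if u = v then d (u 0) else 0) <| by
    have : (Matrix.of fun u v : Fin 1 → Bool => if u = v then d (u 0) else 0) =
      Matrix.diagonal fun u => d (u 0) := rfl
    rw [this, Matrix.mem_unitaryGroup_iff, Matrix.star_eq_conjTranspose, Matrix.diagonal_conjTranspose,
      Matrix.diagonal_mul_diagonal, ← Matrix.diagonal_one]
    congr 1
    funext u
    simp [Complex.mul_conj, Complex.normSq_eq_norm_sq, hd]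

theorem phaseGate_apply {n : ℕ} (w : Fin n) (d : Bool → ℂ) (hd) (ψ : QubitSpace n)
    (x : Fin n → Bool) : (phaseGate w d hd).apply ψ x = d (x w) * ψ x := by
  rw [phaseGate, mkGate_apply, Finset.sum_eq_single fun a => x (oneWire w a)]
  · rw [extend_self, if_pos rfl]
    rfl
  · intro u _ hu
    rw [if_neg hu.symm, zero_mul]
  · simp

theorem range_phaseGate {n : ℕ} (w : Fin n) (d : Bool → ℂ) (hd) :
    Set.range (phaseGate w d hd).wires = {w} :=
  Set.range_const (ι := Fin 1)

/-- The Hadamard gate. -/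
noncomputable def hadamardGate {n : ℕ} (w : Fin n) : Gate n :=
  mkGate le_rfl (by norm_num) (oneWire w)
    (fun u v => ((√2 : ℝ) : ℂ)⁻¹ * if u 0 && v 0 then -1 else 1) <| by
    have h2 : ((√2 : ℝ) : ℂ)⁻¹ * ((√2 : ℝ) : ℂ)⁻¹ = 1 / 2 := by
      rw [← mul_inv, ← Complex.ofReal_mul, Real.mul_self_sqrt (by norm_num)]
      norm_num
    rw [Matrix.mem_unitaryGroup_iff]
    ext u v
    rw [Matrix.mul_apply, ← (Equiv.funUnique (Fin 1) Bool).symm.sum_comp]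
    have huv : u = v ↔ u 0 = v 0 := by
      constructor
      · rintro rfl; rfl
      · intro h; funext i; rwa [Subsingleton.elim i 0]
    simp only [Matrix.star_apply, Matrix.of_apply, Fintype.sum_bool, Matrix.one_apply, huv]
    rcases u 0 <;> rcases v 0 <;> simp [h2] <;> norm_num

theorem extend_oneWire {n : ℕ} {γ : Type*} (w : Fin n)
    (u : Fin 1 → γ) (x : Fin n → γ) : extend (oneWire w) u x = update x w (u 0) := by
  funext i
  by_cases hi : i = w
  · subst hi
    rw [update_self]
    exact (oneWire i).injective.extend_apply u x 0
  · rw [update_of_ne hi, extend_apply']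
    rintro ⟨a, ha⟩
    exact hi ha.symm

theorem extend_twoWires {n : ℕ} {γ : Type*} (a b : Fin n) (hab : a ≠ b)
    (u : Fin 2 → γ) (x : Fin n → γ) :
    extend (twoWires a b hab) u x = update (update x a (u 0)) b (u 1) := by
  funext i
  by_cases hi : i = b
  · subst hi
    rw [update_self]
    exact (twoWires a i hab).injective.extend_apply u x 1
  · rw [update_of_ne hi]
    by_cases hia : i = a
    · subst hia
      rw [update_self]
      exact (twoWires i b hab).injective.extend_apply u x 0
    · rw [update_of_ne hia, extend_apply']
      rintro ⟨c, hc⟩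
      fin_cases c
      · exact hia hc.symm
      · exact hi hc.symm

theorem hadamardGate_apply {n : ℕ} (w : Fin n) (ψ : QubitSpace n) (x : Fin n → Bool) :
    (hadamardGate w).apply ψ x = ((√2 : ℝ) : ℂ)⁻¹ *
      (ψ (update x w false) + (if x w then -1 else 1) * ψ (update x w true)) := by
  rw [hadamardGate, mkGate_apply, ← (Equiv.funUnique (Fin 1) Bool).symm.sum_comp]
  simp only [extend_oneWire, oneWire_apply, Fintype.sum_bool]
  rcases Bool.eq_false_or_eq_true (x w) with h | h <;> simp [h] <;> ring

theorem range_hadamardGate {n : ℕ} (w : Fin n) : Set.range (hadamardGate w).wires = {w} :=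
  Set.range_const (ι := Fin 1)

/-- The permutation of the values of two qubits that the controlled-not gate performs. -/
def cnotVal (u : Fin 2 → Bool) : Fin 2 → Bool := ![u 0, u 1 ^^ u 0]

theorem cnotVal_cnotVal (u : Fin 2 → Bool) : cnotVal (cnotVal u) = u := by
  funext i
  fin_cases i <;> simp [cnotVal]

/-- The controlled-not gate. -/
noncomputable def cnotGate {n : ℕ} (a b : Fin n) (hab : a ≠ b) : Gate n :=
  mkGate (by norm_num) le_rfl (twoWires a b hab)
    (fun u v => if v = cnotVal u then 1 else 0) <| by
    rw [Matrix.mem_unitaryGroup_iff]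
    ext u v
    rw [Matrix.mul_apply]
    simp only [Matrix.star_apply, Matrix.of_apply, Matrix.one_apply]
    rw [Finset.sum_eq_single (cnotVal u)]
    · have : cnotVal u = cnotVal v ↔ u = v :=
        ⟨fun h => by rw [← cnotVal_cnotVal u, h, cnotVal_cnotVal], fun h => h ▸ rfl⟩
      by_cases h : u = v <;> simp [this, h]
    · intro w _ hw
      simp [hw]
    · simp

theorem cnotGate_apply {n : ℕ} (a b : Fin n) (hab : a ≠ b) (ψ : QubitSpace n) (x : Fin n → Bool) :
    (cnotGate a b hab).apply ψ x = ψ (update x b (x b ^^ x a)) := by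
  rw [cnotGate, mkGate_apply, Finset.sum_eq_single (cnotVal fun i => x (twoWires a b hab i))]
  · rw [if_pos rfl, one_mul, extend_twoWires]
    simp [cnotVal, twoWires_zero, twoWires_one]
  · intro u _ hu
    rw [if_neg hu, zero_mul]
  · simp

theorem range_cnotGate {n : ℕ} (a b : Fin n) (hab : a ≠ b) :
    Set.range (cnotGate a b hab).wires = {a, b} := by
  ext i
  change i ∈ Set.range ![a, b] ↔ _
  simp [or_comm, eq_comm]

/-- Gates that multiply the amplitude of `x` by `exp (θ i)` if all the bits of `x` on the wires
`l` are ones. -/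
noncomputable def phaseList {n : ℕ} (θ : ℝ) : List (Fin n) → List (Gate n)
  | [] => []
  | [a] => [phaseGate a (fun b => if b then Complex.exp (θ * Complex.I) else 1)
      (by intro b; cases b <;> simp [Complex.norm_exp_ofReal_mul_I])]
  | a :: b :: l =>
    if h : a = b then [] else
      phaseList (θ / 2) (a :: l) ++ (phaseList (θ / 2) (b :: l) ++ (cnotGate a b h ::
        (phaseList (-(θ / 2)) (b :: l) ++ [cnotGate a b h])))
termination_by l => l.length

/-- For bits, `a * b = (a + b - (a xor b)) / 2`. A phase `θ` controlled by `a`, `b` and `l` is thus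
the product of phases `θ / 2` controlled by `a`, `l` and by `b`, `l`, and of a phase `-θ / 2`
controlled by `a xor b`, `l`. The controlled-not gates place the xor on `b` for the last of these.
Each factor has one control fewer, and no ancilla is needed. -/
theorem runGates_phaseList {n : ℕ} (θ : ℝ) (l : List (Fin n)) (hl : l.Nodup) (h0 : l ≠ [])
    (ψ : QubitSpace n) (x : Fin n → Bool) :
    runGates (phaseList θ l) ψ x =
      (if ∀ w ∈ l, x w then Complex.exp (θ * Complex.I) else 1) * ψ x := by
  induction θ, l using phaseList.induct (n := n) generalizing ψ x with
  | case1 => exact absurd rfl h0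
  | case2 θ a =>
    rw [phaseList, runGates, runGates, phaseGate_apply]
    simp
  | case3 θ b l =>
    simp at hl
  | case4 θ a b l hab ih1 ih2 ih3 =>
    have hb : b ∉ l := by simp_all
    have hla : (a :: l).Nodup := by simp_all
    have hlb : (b :: l).Nodup := by simp_all
    have hu : ∀ c, (∀ w ∈ l, update x b c w = true) ↔ ∀ w ∈ l, x w = true := by
      intro c
      refine forall₂_congr fun w hw => ?_
      rw [update_of_ne]
      rintro rfl
      exact hb hw
    rw [phaseList, dif_neg hab]
    simp only [runGates_append, runGates]
    rw [cnotGate_apply, ih3 hlb (by simp), cnotGate_apply, ih2 hlb (by simp), ih1 hla (by simp)]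
    simp only [List.forall_mem_cons, update_self, update_idem, update_of_ne hab, hu]
    have hx : update x b ((x b ^^ x a) ^^ x a) = x := by simp
    rw [hx]
    have e1 : Complex.exp (θ * Complex.I) =
        Complex.exp ((θ / 2 : ℝ) * Complex.I) * Complex.exp ((θ / 2 : ℝ) * Complex.I) := by
      rw [← Complex.exp_add]
      congr 1
      push_cast
      ring
    have e2 : Complex.exp ((-(θ / 2) : ℝ) * Complex.I) * Complex.exp ((θ / 2 : ℝ) * Complex.I)
        = 1 := by
      rw [← Complex.exp_add]
      simp
    rw [e1]
    by_cases hl' : ∀ w ∈ l, x w = true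
    · simp only [eq_true hl']
      cases ha : x a <;> cases hb : x b <;> simp
      · rw [← mul_assoc]
        simpa using congrArg (· * ψ x) e2
      · rw [← mul_assoc]
        simpa using congrArg (· * ψ x) e2
      · ring
    · simp [eq_false hl']

theorem length_phaseList {n : ℕ} (θ : ℝ) (l : List (Fin n)) :
    (phaseList θ l).length ≤ 5 ^ l.length := by
  induction θ, l using phaseList.induct (n := n) with
  | case1 => simp [phaseList]
  | case2 θ a => simp [phaseList]
  | case3 θ b l => simp [phaseList]
  | case4 θ a b l hab ih1 ih2 ih3 =>
    rw [phaseList, dif_neg hab]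
    simp only [List.length_append, List.length_cons, List.length_nil, pow_succ] at *
    have : 1 ≤ 5 ^ l.length := Nat.one_le_pow _ _ (by norm_num)
    omega

theorem wires_phaseList {n : ℕ} (θ : ℝ) (l : List (Fin n)) :
    ∀ g ∈ phaseList θ l, Set.range g.wires ⊆ {w | w ∈ l} := by
  induction θ, l using phaseList.induct (n := n) with
  | case1 => simp [phaseList]
  | case2 θ a =>
    simp only [phaseList, List.mem_singleton]
    rintro g rfl
    rw [range_phaseGate]
    rfl
  | case3 θ b l => simp [phaseList]
  | case4 θ a b l hab ih1 ih2 ih3 =>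
    rw [phaseList, dif_neg hab]
    intro g hg
    simp only [List.mem_append, List.mem_cons, List.not_mem_nil, or_false] at hg
    have hc : Set.range (cnotGate a b hab).wires ⊆ {w | w ∈ a :: b :: l} := by
      rw [range_cnotGate]
      rintro w (rfl | rfl) <;> simp
    rcases hg with hg | hg | rfl | hg | rfl
    · refine (ih1 g hg).trans fun w hw => ?_
      simp only [Set.mem_ofPred_eq, List.mem_cons] at hw ⊢
      tauto
    · exact (ih2 g hg).trans fun w hw => List.mem_cons_of_mem _ hw
    · exact hc
    · exact (ih3 g hg).trans fun w hw => List.mem_cons_of_mem _ hw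
    · exact hc

/-- Gates that negate the amplitude of `x` if the bits of `x` on the wires `c` are ones and
`f x = true`, for a function `f` of the bits on the wires `l`. -/
noncomputable def signList {n : ℕ} (c : List (Fin n)) :
    List (Fin n) → ((Fin n → Bool) → Bool) → List (Gate n)
  | [], f => if f fun _ => false then phaseList Real.pi c else []
  | a :: l, f => signList c l (fun x => f (update x a false)) ++
      signList (a :: c) l (fun x => f (update x a false) ^^ f (update x a true))

/-- This is the algebraic normal form of `f`. If `f₀`, `f₁` are the restrictions to the two values
of the bit `a`, then `f = f₀ xor (a and (f₀ xor f₁))`. Each monomial becomes a controlled sign, and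
`c` collects its variables. -/
theorem runGates_signList {n : ℕ} (c l : List (Fin n)) (f : (Fin n → Bool) → Bool)
    (hc : c ≠ []) (hn : (l ++ c).Nodup)
    (hf : ∀ x y, (∀ w ∈ l, x w = y w) → f x = f y) (ψ : QubitSpace n) (x : Fin n → Bool) :
    runGates (signList c l f) ψ x = (if (∀ w ∈ c, x w) ∧ f x then -1 else 1) * ψ x := by
  induction l generalizing c f ψ with
  | nil =>
    have : f x = f fun _ => false := hf _ _ (by simp)
    simp only [signList, this]
    cases f fun _ => false
    · simp [runGates]
    · simp [runGates_phaseList _ c (by simpa using hn) hc, Complex.exp_pi_mul_I]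
  | cons a l ih =>
    have hdep : ∀ (b : Bool) (x y : Fin n → Bool), (∀ w ∈ l, x w = y w) →
        f (update x a b) = f (update y a b) := by
      intro b x y h
      apply hf
      intro w hw
      by_cases hwa : w = a
      · subst hwa; simp
      · rw [update_of_ne hwa, update_of_ne hwa]
        exact h w (by simpa [hwa] using hw)
    rw [signList, runGates_append, ih (a :: c) _ (by simp) (by simp_all [List.nodup_middle]),
      ih c _ hc (by simp_all)]
    · have hx : x = update x a (x a) := by simp
      have hfx : f x = f (update x a (x a)) := by simp
      rw [hfx]
      by_cases hcx : ∀ w ∈ c, x w = true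
      · simp only [List.forall_mem_cons, eq_true hcx]
        cases ha : x a <;> cases h0 : f (update x a false) <;> cases h1 : f (update x a true) <;>
          simp
      · simp [eq_false hcx]
    · intro x y h; exact hdep _ _ _ h
    · intro x y h; simp only [hdep _ _ _ h]

theorem length_signList {n : ℕ} (c l : List (Fin n)) (f : (Fin n → Bool) → Bool) :
    (signList c l f).length ≤ 2 ^ l.length * 5 ^ (c.length + l.length) := by
  induction l generalizing c f with
  | nil =>
    simp only [signList]
    split_ifs
    · simpa using length_phaseList _ c
    · simp
  | cons a l ih =>
    simp only [signList, List.length_append, List.length_cons]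
    have h1 := ih c fun x => f (update x a false)
    have h2 := ih (a :: c) fun x => f (update x a false) ^^ f (update x a true)
    rw [List.length_cons] at h2
    have e1 : c.length + 1 + l.length = c.length + l.length + 1 := by ring
    have e2 : c.length + (l.length + 1) = c.length + l.length + 1 := by ring
    rw [e1] at h2
    rw [e2, pow_succ 2]
    have h3 : 2 ^ l.length * 5 ^ (c.length + l.length) ≤
        2 ^ l.length * 5 ^ (c.length + l.length + 1) := by
      exact Nat.mul_le_mul_left _ (Nat.pow_le_pow_right (by norm_num) (Nat.le_succ _))
    have e3 : ∀ u v : ℕ, u * 2 * v = u * v + u * v := by intros; ring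
    rw [e3]
    omega

theorem wires_signList {n : ℕ} (c l : List (Fin n)) (f : (Fin n → Bool) → Bool) :
    ∀ g ∈ signList c l f, Set.range g.wires ⊆ {w | w ∈ c ∨ w ∈ l} := by
  induction l generalizing c f with
  | nil =>
    simp only [signList]
    split_ifs
    · intro g hg
      refine (wires_phaseList _ c g hg).trans fun w hw => Or.inl hw
    · simp
  | cons a l ih =>
    intro g hg
    simp only [signList, List.mem_append] at hg
    rcases hg with hg | hg
    · refine (ih _ _ g hg).trans fun w hw => ?_
      simp only [Set.mem_ofPred_eq, List.mem_cons] at hw ⊢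
      tauto
    · refine (ih _ _ g hg).trans fun w hw => ?_
      simp only [Set.mem_ofPred_eq, List.mem_cons] at hw ⊢
      tauto

/-- Gates that add to the qubit `t` a Boolean function `f` of the qubits `l`. -/
noncomputable def xorGates {n : ℕ} (t : Fin n) (l : List (Fin n)) (f : (Fin n → Bool) → Bool) :
    List (Gate n) :=
  hadamardGate t :: (signList [t] l f ++ [hadamardGate t])

theorem length_xorGates {n : ℕ} (t : Fin n) (l : List (Fin n)) (f : (Fin n → Bool) → Bool) :
    (xorGates t l f).length ≤ 2 ^ l.length * 5 ^ (1 + l.length) + 2 := by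
  have := length_signList [t] l f
  simp only [xorGates, List.length_cons, List.length_append, List.length_nil, zero_add] at *
  omega

theorem wires_xorGates {n : ℕ} (t : Fin n) (l : List (Fin n)) (f : (Fin n → Bool) → Bool) :
    ∀ g ∈ xorGates t l f, Set.range g.wires ⊆ {w | w = t ∨ w ∈ l} := by
  intro g hg
  simp only [xorGates, List.mem_cons, List.mem_append, List.not_mem_nil, or_false] at hg
  rcases hg with rfl | hg | rfl
  · rw [range_hadamardGate]
    rintro w rfl
    exact Or.inl rfl
  · refine (wires_signList _ _ _ g hg).trans fun w hw => ?_
    simpa using hw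
  · rw [range_hadamardGate]
    rintro w rfl
    exact Or.inl rfl

/-- Hadamard gates on `t` conjugate the sign `(-1) ^ (x t * f x)` into the addition of `f x` to the
bit `t`. -/
theorem runGates_xorGates_apply {n : ℕ} (t : Fin n) (l : List (Fin n)) (f : (Fin n → Bool) → Bool)
    (ht : t ∉ l) (hl : l.Nodup) (hf : ∀ x y, (∀ w ∈ l, x w = y w) → f x = f y)
    (ψ : QubitSpace n) (x : Fin n → Bool) :
    runGates (xorGates t l f) ψ x = ψ (update x t (x t ^^ f x)) := by
  have hft : ∀ b, f (update x t b) = f x := by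
    intro b
    refine hf _ _ fun w hw => update_of_ne ?_ _ _
    rintro rfl
    exact ht hw
  have h2 : ((√2 : ℝ) : ℂ)⁻¹ * ((√2 : ℝ) : ℂ)⁻¹ = 1 / 2 := by
    rw [← mul_inv, ← Complex.ofReal_mul, Real.mul_self_sqrt (by norm_num)]
    norm_num
  have hn : (l ++ [t]).Nodup := by
    rw [List.nodup_append]
    refine ⟨hl, by simp, ?_⟩
    rintro a ha b hb rfl
    rw [List.mem_singleton] at hb
    exact ht (hb ▸ ha)
  have hs := fun φ b => runGates_signList [t] l f (by simp) hn hf φ (update x t b)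
  simp only [xorGates, runGates, runGates_append]
  rw [hadamardGate_apply, hs, hs, hadamardGate_apply, hadamardGate_apply]
  simp only [List.mem_singleton, forall_eq, update_self, update_idem, hft]
  have e : ∀ p q : ℂ, ((√2 : ℝ) : ℂ)⁻¹ * (((√2 : ℝ) : ℂ)⁻¹ * (p + q) +
      ((√2 : ℝ) : ℂ)⁻¹ * (p - q)) = p := by
    intro p q
    linear_combination 2 * p * h2
  have e' : ∀ p q : ℂ, ((√2 : ℝ) : ℂ)⁻¹ * (((√2 : ℝ) : ℂ)⁻¹ * (p + q) -
      ((√2 : ℝ) : ℂ)⁻¹ * (p - q)) = q := by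
    intro p q
    linear_combination 2 * q * h2
  cases hx : x t <;> cases hfx : f x <;> simp [e, e', ← sub_eq_add_neg]

theorem basisState_apply {n : ℕ} (y x : Fin n → Bool) :
    (basisState y : QubitSpace n) x = if x = y then 1 else 0 := by
  rw [basisState]
  simp

theorem runGates_xorGates {n : ℕ} (t : Fin n) (l : List (Fin n)) (f : (Fin n → Bool) → Bool)
    (ht : t ∉ l) (hl : l.Nodup) (hf : ∀ x y, (∀ w ∈ l, x w = y w) → f x = f y)
    (y : Fin n → Bool) :
    runGates (xorGates t l f) (basisState y) = basisState (update y t (y t ^^ f y)) := by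
  have hft : ∀ x b, f (update x t b) = f x := by
    intro x b
    refine hf _ _ fun w hw => update_of_ne ?_ _ _
    rintro rfl
    exact ht hw
  ext x
  rw [runGates_xorGates_apply t l f ht hl hf, basisState_apply, basisState_apply]
  congr 1
  rw [eq_iff_iff]
  constructor
  · rintro rfl
    simp [hft]
  · rintro rfl
    simp [hft]

end FermionEncoding
-- Classical reversible circuits and their compilation into gates
namespace FermionEncoding

/-- A classical reversible operation: a Boolean function of the bits on at most six wires is added
to the bit on another wire. -/
structure XorOp (W : Type*) where
  target : W
  inputs : List W
  fn : (W → Bool) → Bool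
  target_notMem : target ∉ inputs
  length_le : inputs.length ≤ 6
  fn_congr : ∀ x y, (∀ w ∈ inputs, x w = y w) → fn x = fn y

namespace XorOp

variable {W : Type*}

/-- The wires that an operation reads or changes. -/
def support (o : XorOp W) : Set W := {w | w = o.target ∨ w ∈ o.inputs}

/-- The effect of an operation on the bits. -/
noncomputable def act (o : XorOp W) (x : W → Bool) : W → Bool :=
  open Classical in Function.update x o.target (x o.target ^^ o.fn x)

theorem act_target (o : XorOp W) (x : W → Bool) :
    o.act x o.target = (x o.target ^^ o.fn x) := by
  simp [act]

theorem act_of_ne (o : XorOp W) (x : W → Bool) {w : W} (h : w ≠ o.target) : o.act x w = x w := by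
  simp [act, h]

theorem fn_act (o : XorOp W) (x : W → Bool) : o.fn (o.act x) = o.fn x := by
  refine o.fn_congr _ _ fun w hw => o.act_of_ne x ?_
  rintro rfl
  exact o.target_notMem hw

theorem act_act (o : XorOp W) (x : W → Bool) : o.act (o.act x) = x := by
  funext w
  by_cases h : w = o.target
  · subst h
    rw [act_target, act_target, fn_act]
    simp
  · rw [act_of_ne _ _ h, act_of_ne _ _ h]

end XorOp

/-- The number of gates that always suffices for an operation `XorOp`. -/
def opCost : ℕ := 2 ^ 6 * 5 ^ 7 + 2

/-- The bits of `x` on the wires `A`, numbered by `e`. -/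
def restrictBits {W : Type*} {A : Finset W} {n : ℕ} (e : A ≃ Fin n) (x : W → Bool) : Fin n → Bool :=
  fun i => x (e.symm i)

theorem exists_gates_of_op {W : Type*} {A : Finset W} {n : ℕ} (e : A ≃ Fin n) (o : XorOp W)
    (ho : ∀ w ∈ o.support, w ∈ A) :
    ∃ gs : List (Gate n), gs.length ≤ opCost ∧
      (∀ g ∈ gs, ∀ i ∈ Set.range g.wires, (e.symm i : W) ∈ o.support) ∧
      ∀ x, runGates gs (basisState (restrictBits e x)) =
        basisState (restrictBits e (o.act x)) := by
  classical
  have hA : ∀ w ∈ o.inputs, w ∈ A := fun w hw => ho w (Or.inr hw)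
  have htA : o.target ∈ A := ho _ (Or.inl rfl)
  -- `inputs` may repeat a wire, while the synthesis needs distinct qubits.
  set l : List (Fin n) := (o.inputs.attach.map fun w => e ⟨w.1, hA w.1 w.2⟩).dedup with hl
  set t : Fin n := e ⟨o.target, htA⟩ with ht
  set f : (Fin n → Bool) → Bool := fun y => o.fn fun w => if h : w ∈ A then y (e ⟨w, h⟩) else false
    with hf
  have hmem : ∀ i, i ∈ l ↔ (e.symm i : W) ∈ o.inputs := by
    intro i
    simp only [hl, List.mem_dedup, List.mem_map, List.mem_attach, true_and, Subtype.exists]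
    constructor
    · rintro ⟨w, hw, rfl⟩
      simpa using hw
    · intro h
      exact ⟨_, h, by simp⟩
  have htl : t ∉ l := by
    rw [hmem, ht]
    simpa using o.target_notMem
  have hlen : l.length ≤ 6 := by
    refine le_trans ?_ o.length_le
    refine (List.dedup_sublist _).length_le.trans ?_
    simp
  refine ⟨xorGates t l f, ?_, ?_, ?_⟩
  · refine (length_xorGates t l f).trans ?_
    unfold opCost
    have h1 : 2 ^ l.length ≤ 2 ^ 6 := Nat.pow_le_pow_right (by norm_num) hlen
    have h2 : 5 ^ (1 + l.length) ≤ 5 ^ 7 := Nat.pow_le_pow_right (by norm_num) (by omega)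
    have := Nat.mul_le_mul h1 h2
    omega
  · intro g hg i hi
    rcases wires_xorGates t l f g hg hi with h | h
    · left
      rw [h, ht]
      simp
    · right
      exact (hmem i).1 h
  · intro x
    rw [runGates_xorGates t l f htl (List.nodup_dedup _)]
    · congr 1
      funext i
      have hfx : f (restrictBits e x) = o.fn x := by
        refine o.fn_congr _ _ fun w hw => ?_
        simp [hA w hw, restrictBits]
      rw [hfx]
      by_cases hi : i = t
      · subst hi
        simp [restrictBits, ht, XorOp.act_target]
      · rw [Function.update_of_ne hi]
        refine (o.act_of_ne x ?_).symm
        rintro h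
        apply hi
        rw [ht]
        simp [← h]
    · intro x y h
      refine o.fn_congr _ _ fun w hw => ?_
      simp only [hA w hw, dite_true]
      apply h
      rw [hmem]
      simpa using hw

/-- The effect of a sequence of operations; the head of the list acts first. -/
noncomputable def runOps {W : Type*} (l : List (XorOp W)) (x : W → Bool) : W → Bool :=
  l.foldl (fun x o => o.act x) x

theorem runOps_append {W : Type*} (l l' : List (XorOp W)) (x : W → Bool) :
    runOps (l ++ l') x = runOps l' (runOps l x) :=
  List.foldl_append

/-- Two operations concern disjoint sets of wires. -/
def XorOp.Indep {W : Type*} (o p : XorOp W) : Prop := Disjoint o.support p.support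

theorem flatten_map_singleton {α : Type*} (l : List α) : (l.map fun a => [a]).flatten = l := by
  induction l with
  | nil => rfl
  | cons a l ih => simp [ih]

/-- Each operation becomes a column of one-gate layers. The columns concern disjoint wires and run
side by side, so the depth is that of the longest column and not the sum. -/
theorem exists_layers_of_ops {W : Type*} {A : Finset W} {n : ℕ} (e : A ≃ Fin n)
    (L : List (XorOp W)) (hL : L.Pairwise XorOp.Indep) (hA : ∀ o ∈ L, ∀ w ∈ o.support, w ∈ A) :
    ∃ G : List (List (Gate n)), G.length ≤ opCost ∧ G.flatten.length ≤ opCost * L.length ∧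
      (∀ B ∈ G, B.Pairwise Gate.Indep) ∧
      (∀ g ∈ G.flatten, ∀ i ∈ Set.range g.wires, ∃ o ∈ L, (e.symm i : W) ∈ o.support) ∧
      ∀ x, runGates G.flatten (basisState (restrictBits e x)) =
        basisState (restrictBits e (runOps L x)) := by
  induction L with
  | nil => exact ⟨[], by simp, by simp, by simp, by simp, fun x => rfl⟩
  | cons o L ih =>
    obtain ⟨G, h1, h2, h3, h4, h5⟩ := ih hL.of_cons fun o ho => hA o (by simp [ho])
    obtain ⟨gs, k1, k2, k3⟩ := exists_gates_of_op e o (hA o (by simp))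
    have hind : ∀ g ∈ (gs.map fun a => [a]).flatten, ∀ k ∈ G.flatten, g.Indep k := by
      rw [flatten_map_singleton]
      intro g hg k hk
      refine Set.disjoint_left.2 fun i hi hi' => ?_
      obtain ⟨p, hp, hpi⟩ := h4 k hk i hi'
      exact Set.disjoint_left.1 (List.rel_of_pairwise_cons hL hp) (k2 g hg i hi) hpi
    refine ⟨parLayers (gs.map fun a => [a]) G, ?_, ?_, ?_, ?_, ?_⟩
    · rw [length_parLayers]
      simp [h1, k1]
    · rw [length_flatten_parLayers, flatten_map_singleton, List.length_cons, mul_add]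
      omega
    · refine pairwise_parLayers _ _ ?_ h3 hind
      simp only [List.mem_map]
      rintro _ ⟨g, _, rfl⟩
      simp
    · intro g hg i hi
      rw [mem_flatten_parLayers, flatten_map_singleton] at hg
      rcases hg with hg | hg
      · exact ⟨o, by simp, k2 g hg i hi⟩
      · obtain ⟨p, hp, hpi⟩ := h4 g hg i hi
        exact ⟨p, by simp [hp], hpi⟩
    · intro x
      rw [runGates_parLayers _ _ hind, flatten_map_singleton, k3, h5]
      rfl

/-- A circuit of classical reversible operations, in layers of operations on disjoint wires. -/
structure RevCircuit (W : Type*) where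
  layers : List (List (XorOp W))
  indep : ∀ L ∈ layers, L.Pairwise XorOp.Indep

namespace RevCircuit

variable {W : Type*}

/-- The effect of a circuit on the bits. -/
noncomputable def act (C : RevCircuit W) (x : W → Bool) : W → Bool := runOps C.layers.flatten x

/-- The circuit uses only the wires `A` and has bounded size and depth. -/
structure Bounded (C : RevCircuit W) (A : Set W) (s d : ℕ) : Prop where
  within : ∀ o ∈ C.layers.flatten, ∀ w ∈ o.support, w ∈ A
  size_le : C.layers.flatten.length ≤ s
  depth_le : C.layers.length ≤ d

/-- One circuit after another. -/
def seq (C D : RevCircuit W) : RevCircuit W :=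
  ⟨C.layers ++ D.layers, by
    intro L hL
    rcases List.mem_append.1 hL with h | h
    · exact C.indep L h
    · exact D.indep L h⟩

/-- The empty circuit. -/
def idle (W : Type*) : RevCircuit W := ⟨[], by simp⟩

/-- The reverse of a circuit. -/
def inv (C : RevCircuit W) : RevCircuit W :=
  ⟨(C.layers.map List.reverse).reverse, by
    simp only [List.mem_reverse, List.mem_map]
    rintro _ ⟨L, hL, rfl⟩
    rw [List.pairwise_reverse]
    exact (C.indep L hL).imp fun h => Disjoint.symm h⟩

theorem act_seq (C D : RevCircuit W) (x : W → Bool) : (C.seq D).act x = D.act (C.act x) := by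
  simp [act, seq, runOps_append]

theorem act_idle (x : W → Bool) : (idle W).act x = x := rfl

theorem flatten_inv (C : RevCircuit W) : C.inv.layers.flatten = C.layers.flatten.reverse := by
  rw [inv, List.reverse_flatten]

theorem runOps_reverse (l : List (XorOp W)) (x : W → Bool) :
    runOps l.reverse (runOps l x) = x := by
  induction l generalizing x with
  | nil => rfl
  | cons o l ih =>
    rw [List.reverse_cons, runOps_append]
    change runOps [o] (runOps l.reverse (runOps l (o.act x))) = x
    rw [ih]
    exact o.act_act x

theorem act_inv_act (C : RevCircuit W) (x : W → Bool) : C.inv.act (C.act x) = x := by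
  rw [act, act, flatten_inv, runOps_reverse]

theorem act_inv_of_eq (C : RevCircuit W) {x y : W → Bool} (h : C.act x = y) : C.inv.act y = x := by
  rw [← h, act_inv_act]

theorem Bounded.seq {C D : RevCircuit W} {A : Set W} {s d s' d' : ℕ} (hC : C.Bounded A s d)
    (hD : D.Bounded A s' d') : (C.seq D).Bounded A (s + s') (d + d') := by
  refine ⟨?_, ?_, ?_⟩
  · intro o ho
    simp only [RevCircuit.seq, List.flatten_append, List.mem_append] at ho
    exact ho.elim (hC.within o) (hD.within o)
  · simpa [RevCircuit.seq] using Nat.add_le_add hC.size_le hD.size_le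
  · simpa [RevCircuit.seq] using Nat.add_le_add hC.depth_le hD.depth_le

theorem Bounded.inv {C : RevCircuit W} {A : Set W} {s d : ℕ} (hC : C.Bounded A s d) :
    C.inv.Bounded A s d := by
  refine ⟨?_, ?_, ?_⟩
  · intro o ho
    rw [flatten_inv, List.mem_reverse] at ho
    exact hC.within o ho
  · rw [flatten_inv, List.length_reverse]
    exact hC.size_le
  · simpa [RevCircuit.inv] using hC.depth_le

theorem Bounded.mono {C : RevCircuit W} {A : Set W} {s d s' d' : ℕ} (hC : C.Bounded A s d)
    (hs : s ≤ s') (hd : d ≤ d') : C.Bounded A s' d' :=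
  ⟨hC.within, hC.size_le.trans hs, hC.depth_le.trans hd⟩

theorem bounded_idle (A : Set W) : (idle W).Bounded A 0 0 := ⟨by simp [idle], by simp [idle], by simp [idle]⟩

theorem exists_layers {A : Finset W} {n : ℕ} (e : A ≃ Fin n) (Ls : List (List (XorOp W)))
    (hi : ∀ L ∈ Ls, L.Pairwise XorOp.Indep)
    (hA : ∀ o ∈ Ls.flatten, ∀ w ∈ o.support, w ∈ A) :
    ∃ G : List (List (Gate n)), G.length ≤ opCost * Ls.length ∧
      G.flatten.length ≤ opCost * Ls.flatten.length ∧ (∀ B ∈ G, B.Pairwise Gate.Indep) ∧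
      ∀ x, runGates G.flatten (basisState (restrictBits e x)) =
        basisState (restrictBits e (runOps Ls.flatten x)) := by
  induction Ls with
  | nil => exact ⟨[], by simp, by simp, by simp, fun x => rfl⟩
  | cons L Ls ih =>
    simp only [List.flatten_cons, List.mem_append, List.mem_cons] at hi hA
    obtain ⟨G, h1, h2, h3, h4⟩ := ih (fun L hL => hi L (Or.inr hL)) fun o ho => hA o (Or.inr ho)
    obtain ⟨K, k1, k2, k3, -, k5⟩ :=
      exists_layers_of_ops e L (hi L (Or.inl rfl)) fun o ho => hA o (Or.inl ho)
    refine ⟨K ++ G, ?_, ?_, ?_, ?_⟩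
    · rw [List.length_append, List.length_cons, mul_add]
      omega
    · rw [List.flatten_append, List.length_append, List.flatten_cons, List.length_append, mul_add]
      omega
    · intro B hB
      exact (List.mem_append.1 hB).elim (k3 B) (h3 B)
    · intro x
      rw [List.flatten_append, runGates_append, k5, h4, List.flatten_cons, runOps_append]

/-- Every reversible circuit can be carried out by a quantum circuit of one- and two-qubit gates
without further ancillas, with constant overhead. -/
theorem exists_circuit (C : RevCircuit W) {A : Finset W} {n s d : ℕ} (e : A ≃ Fin n)
    (hC : C.Bounded A s d) :
    ∃ Q : Circuit n, Q.gateCount ≤ opCost * s ∧ Q.depth ≤ opCost * d ∧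
      ∀ x, Q.run (basisState (restrictBits e x)) = basisState (restrictBits e (C.act x)) := by
  obtain ⟨G, h1, h2, h3, h4⟩ := exists_layers e C.layers C.indep hC.within
  exact ⟨⟨G, h3⟩, h2.trans (Nat.mul_le_mul_left _ hC.size_le),
    h1.trans (Nat.mul_le_mul_left _ hC.depth_le), h4⟩

theorem length_flatten_map_range {α : Type*} (f : ℕ → List α) (T : ℕ) :
    ((List.range T).map f).flatten.length = ∑ t ∈ Finset.range T, (f t).length := by
  induction T with
  | zero => simp
  | succ T ih =>
    rw [List.range_succ, List.map_append, List.flatten_append, List.length_append, ih,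
      Finset.sum_range_succ]
    simp

/-- A Boolean network: operations `op i` with times `τ i` such that every wire is read only after
it was written, and operations at the same time read different wires. It leads from `x` to the
state `y` that solves all the equations of the operations. -/
theorem exists_network {ι : Type*} (A : Set W) (I : Finset ι) (op : ι → XorOp W) (τ : ι → ℕ)
    (T : ℕ) (hT : ∀ i ∈ I, τ i < T)
    (hinj : ∀ i ∈ I, ∀ j ∈ I, (op i).target = (op j).target → i = j)
    (hread : ∀ i ∈ I, ∀ j ∈ I, (op j).target ∈ (op i).inputs → τ j < τ i)
    (hdisj : ∀ i ∈ I, ∀ j ∈ I, τ i = τ j → ∀ w ∈ (op i).inputs, w ∈ (op j).inputs → i = j)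
    (hA : ∀ i ∈ I, (op i).target ∈ A ∧ ∀ w ∈ (op i).inputs, w ∈ A) :
    ∃ C : RevCircuit W, C.Bounded A I.card T ∧ ∀ x y : W → Bool,
      (∀ w, (∀ i ∈ I, w ≠ (op i).target) → y w = x w) →
      (∀ i ∈ I, y (op i).target = (x (op i).target ^^ (op i).fn y)) → C.act x = y := by
  classical
  let lay : ℕ → List ι := fun t => (I.filter fun i => τ i = t).toList
  have hlay : ∀ t i, i ∈ lay t ↔ i ∈ I ∧ τ i = t := by simp [lay]
  let layers : List (List (XorOp W)) := (List.range T).map fun t => (lay t).map op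
  have hmem : ∀ o ∈ layers.flatten, ∃ i ∈ I, o = op i := by
    intro o ho
    simp only [layers, List.mem_flatten, List.mem_map] at ho
    obtain ⟨_, ⟨t, _, rfl⟩, ho⟩ := ho
    obtain ⟨i, hi, rfl⟩ := List.mem_map.1 ho
    exact ⟨i, ((hlay t i).1 hi).1, rfl⟩
  have hind : ∀ L ∈ layers, L.Pairwise XorOp.Indep := by
    simp only [layers, List.mem_map]
    rintro _ ⟨t, _, rfl⟩
    rw [List.pairwise_map]
    have hnd : (lay t).Nodup := Finset.nodup_toList _
    refine List.Nodup.pairwise_of_forall_ne hnd ?_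
    intro i hi j hj hij
    replace hi := (hlay t i).1 hi
    obtain ⟨hj, hji⟩ := (hlay t j).1 hj
    obtain ⟨hi, hit⟩ := hi
    refine Set.disjoint_left.2 ?_
    rintro w (rfl | hw) (hw' | hw')
    · exact hij (hinj i hi j hj hw')
    · have := hread j hj i hi hw'
      omega
    · subst hw'
      have := hread i hi j hj hw
      omega
    · exact hij (hdisj i hi j hj (hit.trans hji.symm) w hw hw')
  refine ⟨⟨layers, hind⟩, ⟨?_, ?_, ?_⟩, ?_⟩
  · intro o ho w hw
    obtain ⟨i, hi, rfl⟩ := hmem o ho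
    rcases hw with rfl | hw
    · exact (hA i hi).1
    · exact (hA i hi).2 w hw
  · have : layers.flatten.length = ∑ t ∈ Finset.range T, (I.filter fun i => τ i = t).card := by
      rw [length_flatten_map_range]
      simp [lay]
    rw [this, ← Finset.card_eq_sum_card_fiberwise (f := τ)]
    intro i hi
    simpa using hT i hi
  · simp [layers]
  · intro x y hy hyt
    -- In `z S` the targets of the operations in `S` already have their final values. An operation
    -- whose inputs are settled leads from `z S` to `z (insert i S)`, so running through the times
    -- in order ends at the solution `y`.
    let z : Set ι → W → Bool := fun S w => if ∃ i ∈ S, (op i).target = w then y w else x w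
    have step : ∀ (S : Set ι) (i : ι), i ∈ I → S ⊆ I → i ∉ S →
        (∀ j ∈ I, (op j).target ∈ (op i).inputs → j ∈ S) →
        (op i).act (z S) = z (insert i S) := by
      intro S i hi hS hiS hin
      have hfn : (op i).fn (z S) = (op i).fn y := by
        refine (op i).fn_congr _ _ fun w hw => ?_
        by_cases h : ∃ j ∈ I, (op j).target = w
        · obtain ⟨j, hj, rfl⟩ := h
          have : ∃ k ∈ S, (op k).target = (op j).target := ⟨j, hin j hj hw, rfl⟩
          simp only [z, this, if_true]
        · have h' : ¬ ∃ j ∈ S, (op j).target = w := fun ⟨j, hj, e⟩ => h ⟨j, hS hj, e⟩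
          simp only [z, h', if_false]
          refine (hy w fun j hj e => h ⟨j, hj, e.symm⟩).symm
      funext w
      by_cases hw : w = (op i).target
      · subst hw
        rw [XorOp.act_target, hfn]
        have h1 : ¬ ∃ j ∈ S, (op j).target = (op i).target := by
          rintro ⟨j, hj, e⟩
          exact hiS (hinj j (hS hj) i hi e ▸ hj)
        have h2 : ∃ j ∈ insert i S, (op j).target = (op i).target := ⟨i, by simp, rfl⟩
        simp only [z, h1, h2, if_true, if_false]
        exact (hyt i hi).symm
      · rw [XorOp.act_of_ne _ _ hw]
        have : (∃ j ∈ insert i S, (op j).target = w) ↔ ∃ j ∈ S, (op j).target = w := by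
          constructor
          · rintro ⟨j, rfl | hj, e⟩
            · exact absurd e.symm hw
            · exact ⟨j, hj, e⟩
          · rintro ⟨j, hj, e⟩
            exact ⟨j, Or.inr hj, e⟩
        simp only [z, this]
    have steps : ∀ (l : List ι) (S : Set ι), l.Nodup → (∀ i ∈ l, i ∈ I) → S ⊆ I →
        (∀ i ∈ l, i ∉ S) → (∀ i ∈ l, ∀ j ∈ I, (op j).target ∈ (op i).inputs → j ∈ S) →
        runOps (l.map op) (z S) = z (S ∪ {i | i ∈ l}) := by
      intro l
      induction l with
      | nil => intro S _ _ _ _ _; simp [runOps]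
      | cons i l ih =>
        intro S hnd hI hS hlS hr
        have e : runOps ((i :: l).map op) (z S) = runOps (l.map op) ((op i).act (z S)) := rfl
        rw [e, step S i (hI i (by simp)) hS (hlS i (by simp)) (hr i (by simp)), ih]
        · congr 1
          ext j
          simp only [Set.mem_union, Set.mem_insert_iff, Set.mem_ofPred_eq, List.mem_cons]
          tauto
        · exact (List.nodup_cons.1 hnd).2
        · exact fun j hj => hI j (by simp [hj])
        · exact Set.insert_subset (hI i (by simp)) hS
        · rintro j hj (rfl | h)
          · exact (List.nodup_cons.1 hnd).1 hj
          · exact hlS j (by simp [hj]) h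
        · exact fun j hj k hk h => Or.inr (hr j (by simp [hj]) k hk h)
    have all : ∀ t, runOps (((List.range t).map fun t => (lay t).map op).flatten) x =
        z {i | i ∈ I ∧ τ i < t} := by
      intro t
      induction t with
      | zero => simp [runOps, z]
      | succ t ih =>
        rw [List.range_succ, List.map_append, List.flatten_append, runOps_append, ih]
        simp only [List.map_cons, List.map_nil, List.flatten_cons, List.flatten_nil,
          List.append_nil]
        rw [steps]
        · congr 1
          ext i
          simp only [Set.mem_union, Set.mem_ofPred_eq, hlay, ← and_or_left]
          refine and_congr_right fun _ => ?_
          omega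
        · exact Finset.nodup_toList _
        · exact fun i hi => ((hlay t i).1 hi).1
        · exact fun i hi => hi.1
        · rintro i hi ⟨_, h⟩
          have := ((hlay t i).1 hi).2
          omega
        · intro i hi j hj h
          refine ⟨hj, ?_⟩
          have h1 := ((hlay t i).1 hi)
          have := hread i h1.1 j hj h
          omega
    have h := all T
    change runOps layers.flatten x = y
    rw [h]
    funext w
    by_cases hw : ∃ i ∈ {i | i ∈ I ∧ τ i < T}, (op i).target = w
    · simp only [z, hw, if_true]
    · simp only [z, hw, if_false]
      refine (hy w fun i hi e => hw ⟨i, ⟨hi, hT i hi⟩, e.symm⟩).symm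

end RevCircuit

end FermionEncoding
-- From query circuits on basis states to a data structure
namespace FermionEncoding

theorem eq_of_sgnRank_eq {M : ℕ} {b b' : Fin M → Bool} (h : ∀ j, sgnRank j b = sgnRank j b') :
    b = b' := by
  have key : ∀ (m : ℕ) (j : Fin M), j.1 = m → b j = b' j := by
    intro m
    induction m using Nat.strong_induction_on with
    | _ m ih =>
      rintro j rfl
      have e : ∀ c : Fin M → Bool,
          sgnRank j c = (-1) ^ (c j).toNat * ∏ i ∈ Finset.Iio j, (-1 : ℤ) ^ (c i).toNat := by
        intro c
        rw [sgnRank, ← Finset.Iio_insert, Finset.prod_insert (by simp)]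
      have hp : ∏ i ∈ Finset.Iio j, (-1 : ℤ) ^ (b i).toNat =
          ∏ i ∈ Finset.Iio j, (-1 : ℤ) ^ (b' i).toNat := by
        refine Finset.prod_congr rfl fun i hi => ?_
        rw [ih i.1 (by simpa using hi) i rfl]
      have hne : ∏ i ∈ Finset.Iio j, (-1 : ℤ) ^ (b' i).toNat ≠ 0 :=
        Finset.prod_ne_zero_iff.2 fun i _ => pow_ne_zero _ (by norm_num)
      have hj := h j
      rw [e, e, hp] at hj
      have := mul_right_cancel₀ hne hj
      cases h1 : b j <;> cases h2 : b' j <;> simp [h1, h2] at this ⊢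
  exact funext fun j => key j.1 j rfl

theorem Gate.apply_smul {n : ℕ} (g : Gate n) (c : ℂ) (ψ : QubitSpace n) :
    g.apply (c • ψ) = c • g.apply ψ := by
  ext x
  simp [Gate.apply, Matrix.mulVec_smul]

theorem runGates_smul {n : ℕ} (l : List (Gate n)) (c : ℂ) (ψ : QubitSpace n) :
    runGates l (c • ψ) = c • runGates l ψ := by
  induction l generalizing ψ with
  | nil => rfl
  | cons g l ih => rw [runGates, Gate.apply_smul, ih, runGates]

theorem basisState_ne_zero {n : ℕ} (x : Fin n → Bool) : basisState x ≠ 0 := by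
  intro h
  have := congrArg (fun ψ : QubitSpace n => ψ x) h
  simp [basisState_apply] at this

/-- The linear map that sends the Fock state of `b` to the computational basis state of
`enc b`. -/
noncomputable def encodeMap {M lo hi n : ℕ} (enc : Occupation M lo hi → Fin n → Bool) :
    FockSpace M lo hi →ₗ[ℂ] QubitSpace n where
  toFun ψ := ∑ b, ψ b • basisState (enc b)
  map_add' ψ φ := by simp [add_smul, Finset.sum_add_distrib]
  map_smul' c ψ := by simp [mul_smul, Finset.smul_sum]

theorem encodeMap_fockState {M lo hi n : ℕ} (enc : Occupation M lo hi → Fin n → Bool)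
    (b : Occupation M lo hi) : encodeMap enc (fockState b) = basisState (enc b) := by
  change ∑ c, (fockState b : FockSpace M lo hi) c • basisState (enc c) = _
  rw [Finset.sum_eq_single b]
  · simp [fockState]
  · intro c _ hc
    simp [fockState, hc]
  · simp

theorem encodeMap_injective {M lo hi n : ℕ} (enc : Occupation M lo hi → Fin n → Bool)
    (h : Function.Injective enc) : Function.Injective (encodeMap enc) := by
  rw [← LinearMap.ker_eq_bot, LinearMap.ker_eq_bot']
  intro ψ hψ
  ext b
  have := congrArg (fun φ : QubitSpace n => φ (enc b)) hψ
  change (∑ c, ψ c • basisState (enc c) : QubitSpace n) (enc b) = 0 at this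
  simpa [basisState_apply, h.eq_iff] using this

/-- A data structure from circuits for the queries on the encoded states. -/
theorem exists_fermionDataStructure {M lo hi n g d : ℕ} (enc : Occupation M lo hi → Fin n → Bool)
    (hflip : ∀ j, ∃ Q : Circuit n, Q.gateCount ≤ g ∧ Q.depth ≤ d ∧
      ∀ (b : Occupation M lo hi) (h : lo ≤ hammingWeight (bitFlip j b.1) ∧
        hammingWeight (bitFlip j b.1) ≤ hi),
        Q.run (basisState (enc b)) = basisState (enc ⟨bitFlip j b.1, h⟩))
    (hrank : ∀ j, ∃ Q : Circuit n, Q.gateCount ≤ g ∧ Q.depth ≤ d ∧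
      ∀ b : Occupation M lo hi,
        Q.run (basisState (enc b)) = (sgnRank j b.1 : ℂ) • basisState (enc b)) :
    ∃ D : FermionDataStructure M lo hi n, D.gateComplexity ≤ g ∧ D.depthComplexity ≤ d := by
  choose flip f1 f2 f3 using hflip
  choose rank r1 r2 r3 using hrank
  -- Injectivity comes for free: equal code words would receive the same signs from the rank
  -- circuits, and the signs of all prefixes determine a string.
  have hinj : Function.Injective enc := by
    intro b b' h
    refine Subtype.ext (eq_of_sgnRank_eq fun j => ?_)
    have h1 := r3 j b
    rw [h, r3 j b'] at h1
    have := smul_left_injective ℂ (basisState_ne_zero (enc b')) h1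
    exact_mod_cast this.symm
  refine ⟨⟨encodeMap enc, encodeMap_injective enc hinj,
    fun b => ⟨_, encodeMap_fockState enc b⟩, flip, rank, ?_, ?_⟩, ?_, ?_⟩
  · intro j b h
    rw [encodeMap_fockState, encodeMap_fockState, f3 j b h]
  · intro j b
    rw [encodeMap_fockState, r3]
  · exact Finset.sup_le fun j _ => max_le (f1 j) (r1 j)
  · exact Finset.sup_le fun j _ => max_le (f2 j) (r2 j)

/-- Diagonal one-qubit gates on distinct wires form a single layer, so a product of arbitrarily many
one-bit signs costs depth one. -/
theorem exists_phase_layer {W : Type*} {A : Finset W} {n : ℕ} (e : A ≃ Fin n) (S : Finset W)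
    (hS : S ⊆ A) (σ : W → Bool → ℤ) (hσ : ∀ w b, |σ w b| = 1) :
    ∃ L : List (Gate n), L.length = S.card ∧ L.Pairwise Gate.Indep ∧
      (∀ g ∈ L, ∀ i ∈ Set.range g.wires, (e.symm i : W) ∈ S) ∧
      ∀ x : W → Bool, runGates L (basisState (restrictBits e x)) =
        ((∏ w ∈ S, σ w (x w) : ℤ) : ℂ) • basisState (restrictBits e x) := by
  classical
  induction S using Finset.induction_on with
  | empty => exact ⟨[], by simp, by simp, by simp, by simp [runGates]⟩
  | insert w S hw ih =>
    rw [Finset.insert_subset_iff] at hS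
    obtain ⟨L, h1, h2, h3, h4⟩ := ih hS.2
    have hn : ∀ b, ‖((σ w b : ℤ) : ℂ)‖ = 1 := by
      intro b
      rw [Complex.norm_intCast]
      exact_mod_cast hσ w b
    refine ⟨phaseGate (e ⟨w, hS.1⟩) (fun b => σ w b) hn :: L, ?_, ?_, ?_, ?_⟩
    · rw [List.length_cons, h1, Finset.card_insert_of_notMem hw]
    · rw [List.pairwise_cons]
      refine ⟨fun g hg => Set.disjoint_left.2 ?_, h2⟩
      rw [range_phaseGate]
      rintro i rfl hi
      have := h3 g hg _ hi
      simp only [Equiv.symm_apply_apply] at this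
      exact hw this
    · intro g hg i hi
      rcases List.mem_cons.1 hg with rfl | hg
      · rw [range_phaseGate] at hi
        rw [hi]
        simp
      · exact Finset.mem_insert_of_mem (h3 g hg i hi)
    · intro x
      have : (phaseGate (e ⟨w, hS.1⟩) (fun b => σ w b) hn).apply (basisState (restrictBits e x)) =
          (σ w (x w) : ℂ) • basisState (restrictBits e x) := by
        ext y
        rw [phaseGate_apply]
        simp only [PiLp.smul_apply, basisState_apply, smul_eq_mul]
        by_cases hy : y = restrictBits e x
        · rw [hy]
          simp [restrictBits]
        · simp [hy]
      rw [runGates, this, runGates_smul, h4, smul_smul, Finset.prod_insert hw]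
      push_cast
      rfl

/-- Two reversible circuits with a layer of phase gates between them. -/
theorem exists_circuit_phase {W : Type*} {A : Finset W} {n s d s' d' : ℕ} (e : A ≃ Fin n)
    (C C' : RevCircuit W) (hC : C.Bounded A s d) (hC' : C'.Bounded A s' d') (S : Finset W)
    (hS : S ⊆ A) (σ : W → Bool → ℤ) (hσ : ∀ w b, |σ w b| = 1) :
    ∃ Q : Circuit n, Q.gateCount ≤ opCost * (s + s') + S.card ∧
      Q.depth ≤ opCost * (d + d') + 1 ∧
      ∀ x, Q.run (basisState (restrictBits e x)) = ((∏ w ∈ S, σ w (C.act x w) : ℤ) : ℂ) •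
        basisState (restrictBits e (C'.act (C.act x))) := by
  obtain ⟨Q, q1, q2, q3⟩ := RevCircuit.exists_circuit C e hC
  obtain ⟨Q', p1, p2, p3⟩ := RevCircuit.exists_circuit C' e hC'
  obtain ⟨L, l1, l2, -, l4⟩ := exists_phase_layer e S hS σ hσ
  refine ⟨⟨Q.layers ++ L :: Q'.layers, ?_⟩, ?_, ?_, ?_⟩
  · intro B hB
    simp only [List.mem_append, List.mem_cons] at hB
    rcases hB with hB | rfl | hB
    · exact Q.disjoint_wires B hB
    · exact l2
    · exact Q'.disjoint_wires B hB
  · simp only [Circuit.gateCount, List.flatten_append, List.flatten_cons, List.length_append] at *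
    rw [mul_add]
    omega
  · simp only [Circuit.depth, List.length_append, List.length_cons] at *
    rw [mul_add]
    omega
  · intro x
    simp only [Circuit.run, List.flatten_append, List.flatten_cons, runGates_append] at *
    rw [q3, l4, runGates_smul, p3]

end FermionEncoding
-- Prefix counts, and the dyadic parity tree for large `F`
namespace FermionEncoding

/-- The bits of a string, continued by zeros. -/
def occ {M : ℕ} (b : Fin M → Bool) (i : ℕ) : Bool := if h : i < M then b ⟨i, h⟩ else false

/-- The number of ones of a string before a position. -/
def numOnes {M : ℕ} (b : Fin M → Bool) (n : ℕ) : ℕ := Nat.count (fun i => occ b i = true) n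

theorem occ_fin {M : ℕ} (b : Fin M → Bool) (j : Fin M) : occ b j = b j := by simp [occ]

theorem numOnes_succ {M : ℕ} (b : Fin M → Bool) (n : ℕ) :
    numOnes b (n + 1) = numOnes b n + (occ b n).toNat := by
  rw [numOnes, numOnes, Nat.count_succ]
  cases occ b n <;> simp

theorem numOnes_zero {M : ℕ} (b : Fin M → Bool) : numOnes b 0 = 0 := Nat.count_zero _

theorem numOnes_mono {M : ℕ} (b : Fin M → Bool) : Monotone (numOnes b) := Nat.count_monotone _

theorem bitFlip_bitFlip {M : ℕ} (j : Fin M) (b : Fin M → Bool) :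
    bitFlip j (bitFlip j b) = b := by
  simp [bitFlip]

theorem bitFlip_self {M : ℕ} (j : Fin M) (b : Fin M → Bool) : bitFlip j b j = !b j := by
  simp [bitFlip]

theorem occ_bitFlip {M : ℕ} (j : Fin M) (b : Fin M → Bool) (i : ℕ) :
    occ (bitFlip j b) i = if i = j then !b j else occ b i := by
  unfold occ bitFlip
  by_cases h : i < M
  · simp only [h, dite_true, Function.update_apply, Fin.ext_iff]
  · have : i ≠ j := fun e => h (e ▸ j.2)
    simp [h, this]

theorem numOnes_bitFlip {M : ℕ} (j : Fin M) (b : Fin M → Bool) (hb : b j = false) (n : ℕ) :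
    numOnes (bitFlip j b) n = numOnes b n + if j.1 < n then 1 else 0 := by
  induction n with
  | zero => simp [numOnes_zero]
  | succ n ih =>
    rw [numOnes_succ, numOnes_succ, ih, occ_bitFlip]
    by_cases hn : n = j.1
    · subst hn
      simp [hb, occ_fin]
    · have : j.1 < n + 1 ↔ j.1 < n := by omega
      simp only [hn, if_false, this]
      ring

theorem numOnes_bitFlip' {M : ℕ} (j : Fin M) (b : Fin M → Bool) (hb : b j = true) (n : ℕ) :
    numOnes b n = numOnes (bitFlip j b) n + if j.1 < n then 1 else 0 := by
  have := numOnes_bitFlip j (bitFlip j b) (by rw [bitFlip_self, hb]; rfl) n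
  rwa [bitFlip_bitFlip] at this

theorem numOnes_length {M : ℕ} (b : Fin M → Bool) : numOnes b M = hammingWeight b := by
  rw [numOnes, Nat.count_eq_card_filter_range, hammingWeight]
  symm
  refine Finset.card_bij (fun i _ => i.1) ?_ ?_ ?_
  · intro i hi
    simpa [occ_fin] using hi
  · intro i _ k _ h
    exact Fin.ext h
  · intro i hi
    simp only [Finset.mem_filter, Finset.mem_range] at hi
    exact ⟨⟨i, hi.1⟩, by simpa [← occ_fin] using hi.2, rfl⟩

theorem numOnes_le {M : ℕ} (b : Fin M → Bool) (n : ℕ) : numOnes b n ≤ hammingWeight b := by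
  rw [← numOnes_length]
  by_cases h : n ≤ M
  · exact numOnes_mono b h
  · have : ∀ k, numOnes b (M + k) = numOnes b M := by
      intro k
      induction k with
      | zero => rfl
      | succ k ih =>
        rw [← Nat.add_assoc, numOnes_succ, ih]
        simp [occ]
    have := this (n - M)
    rw [Nat.add_sub_cancel' (by omega)] at this
    exact this.le

theorem sgnRank_eq {M : ℕ} (j : Fin M) (b : Fin M → Bool) :
    sgnRank j b = (-1) ^ numOnes b (j.1 + 1) := by
  have h : ∀ n, n ≤ M → (-1 : ℤ) ^ numOnes b n =
      ∏ i ∈ Finset.univ.filter (fun i : Fin M => i.1 < n), (-1 : ℤ) ^ (b i).toNat := by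
    intro n
    induction n with
    | zero => intro _; simp [numOnes_zero]
    | succ n ih =>
      intro hn
      have e : Finset.univ.filter (fun i : Fin M => i.1 < n + 1) =
          insert ⟨n, hn⟩ (Finset.univ.filter fun i : Fin M => i.1 < n) := by
        ext i
        simp only [Finset.mem_filter, Finset.mem_univ, true_and, Finset.mem_insert, Fin.ext_iff]
        omega
      rw [e, Finset.prod_insert (by simp), ← ih (by omega), numOnes_succ, pow_add, mul_comm]
      congr 2
      simp [occ, show n < M from hn]
  rw [h _ (by omega), sgnRank]
  refine Finset.prod_congr ?_ fun _ _ => rfl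
  ext i
  simp only [Finset.mem_Iic, Finset.mem_filter, Finset.mem_univ, true_and, Fin.le_def]
  omega

theorem decide_odd_add_ite (n : ℕ) (p : Prop) [Decidable p] :
    decide ((n + if p then 1 else 0) % 2 = 1) = (decide (n % 2 = 1) ^^ decide p) := by
  by_cases hp : p <;> simp only [hp, if_true, if_false, decide_true, decide_false]
  · rcases Nat.mod_two_eq_zero_or_one n with h | h <;> simp [h, Nat.add_mod]
  · simp

/-- The parity of the ones of a string before a position. -/
def parityBefore {M : ℕ} (b : Fin M → Bool) (n : ℕ) : Bool := decide (numOnes b n % 2 = 1)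

theorem parityBefore_bitFlip {M : ℕ} (j : Fin M) (b : Fin M → Bool) (n : ℕ) :
    parityBefore (bitFlip j b) n = (parityBefore b n ^^ decide (j.1 < n)) := by
  unfold parityBefore
  cases hb : b j
  · rw [numOnes_bitFlip j b hb, decide_odd_add_ite]
  · rw [numOnes_bitFlip' j b hb, decide_odd_add_ite]
    cases decide (numOnes (bitFlip j b) n % 2 = 1) <;> cases decide (j.1 < n) <;> rfl

/-- The parities of a string on the dyadic intervals, `(t, q)` standing for the interval from
`q * 2 ^ t` to `(q + 1) * 2 ^ t`. -/
def dyadicParity {M : ℕ} (b : Fin M → Bool) (w : ℕ × ℕ) : Bool :=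
  parityBefore b (w.2 * 2 ^ w.1) ^^ parityBefore b ((w.2 + 1) * 2 ^ w.1)

theorem dyadicParity_bitFlip {M : ℕ} (j : Fin M) (b : Fin M → Bool) (w : ℕ × ℕ) :
    dyadicParity (bitFlip j b) w = (dyadicParity b w ^^ decide (j.1 / 2 ^ w.1 = w.2)) := by
  have hpos : 0 < 2 ^ w.1 := by positivity
  have h1 : j.1 / 2 ^ w.1 = w.2 ↔ ¬ j.1 < w.2 * 2 ^ w.1 ∧ j.1 < (w.2 + 1) * 2 ^ w.1 := by
    rw [Nat.div_eq_iff hpos]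
    have : (w.2 + 1) * 2 ^ w.1 = w.2 * 2 ^ w.1 + 2 ^ w.1 := by ring
    omega
  have h2 : j.1 < w.2 * 2 ^ w.1 → j.1 < (w.2 + 1) * 2 ^ w.1 := by
    have : (w.2 + 1) * 2 ^ w.1 = w.2 * 2 ^ w.1 + 2 ^ w.1 := by ring
    omega
  simp only [dyadicParity, parityBefore_bitFlip, h1]
  by_cases a1 : j.1 < w.2 * 2 ^ w.1
  · simp [a1, h2 a1]
  · by_cases a2 : j.1 < (w.2 + 1) * 2 ^ w.1 <;>
    cases parityBefore b (w.2 * 2 ^ w.1) <;> cases parityBefore b ((w.2 + 1) * 2 ^ w.1) <;>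
      simp [a1, a2]

/-- The sign of a bit. -/
def bitSign (c : Bool) : ℤ := if c then -1 else 1

theorem bitSign_xor (c d : Bool) : bitSign (c ^^ d) = bitSign c * bitSign d := by
  cases c <;> cases d <;> rfl

theorem abs_bitSign (c : Bool) : |bitSign c| = 1 := by cases c <;> rfl

theorem bitSign_parityBefore {M : ℕ} (b : Fin M → Bool) (n : ℕ) :
    bitSign (parityBefore b n) = (-1) ^ numOnes b n := by
  rw [neg_one_pow_eq_pow_mod_two, parityBefore]
  rcases Nat.mod_two_eq_zero_or_one (numOnes b n) with h | h <;> simp [h, bitSign]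

/-- The prefix of length `m` is cut at the numbers `m / 2 ^ t * 2 ^ t`. From `t` to `t + 1` this
number drops by one dyadic interval exactly if the binary digit `t` of `m` is one, so the product
telescopes. -/
theorem prod_dyadicParity {M : ℕ} (b : Fin M → Bool) (m T : ℕ) :
    ∏ t ∈ (Finset.range T).filter (fun t => m / 2 ^ t % 2 = 1),
      bitSign (dyadicParity b (t, m / 2 ^ t - 1)) =
      bitSign (parityBefore b m) * bitSign (parityBefore b (m / 2 ^ T * 2 ^ T)) := by
  induction T with
  | zero =>
    simp only [Finset.range_zero, Finset.filter_empty, Finset.prod_empty, pow_zero, Nat.div_one,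
      mul_one]
    cases parityBefore b m <;> rfl
  | succ T ih =>
    have hdiv : m / 2 ^ (T + 1) = m / 2 ^ T / 2 := by
      rw [pow_succ, Nat.div_div_eq_div_mul]
    rw [Finset.range_add_one, Finset.filter_insert]
    by_cases h : m / 2 ^ T % 2 = 1
    · rw [if_pos h, Finset.prod_insert (by simp), ih]
      have e1 : (m / 2 ^ T - 1) * 2 ^ T = m / 2 ^ (T + 1) * 2 ^ (T + 1) := by
        rw [hdiv, pow_succ, ← mul_assoc, mul_right_comm]
        congr 1
        generalize m / 2 ^ T = u at h ⊢
        omega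
      have e2 : (m / 2 ^ T - 1 + 1) * 2 ^ T = m / 2 ^ T * 2 ^ T := by
        congr 1
        generalize m / 2 ^ T = u at h ⊢
        omega
      simp only [dyadicParity, e1, e2, bitSign_xor]
      cases parityBefore b (m / 2 ^ T * 2 ^ T) <;>
        cases parityBefore b (m / 2 ^ (T + 1) * 2 ^ (T + 1)) <;>
        cases parityBefore b m <;> rfl
    · rw [if_neg h, ih]
      have e1 : m / 2 ^ T * 2 ^ T = m / 2 ^ (T + 1) * 2 ^ (T + 1) := by
        rw [hdiv, pow_succ, ← mul_assoc, mul_right_comm]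
        congr 1
        generalize m / 2 ^ T = u at h ⊢
        omega
      rw [e1]

/-- The operation that negates a bit. -/
def notOp {W : Type*} (w : W) : XorOp W where
  target := w
  inputs := []
  fn := fun _ => true
  target_notMem := by simp
  length_le := by simp
  fn_congr := by simp

/-- The parities of all dyadic intervals are stored. A flip negates the `H + 1` intervals that
contain `j`. A prefix is a disjoint union of at most `H + 1` intervals, and a rank query is one
layer of signs on these. -/
theorem exists_tree_structure (M F H : ℕ) (hM : M ≤ 2 ^ H) :
    ∃ n ≤ 2 ^ (H + 1), ∃ D : FermionDataStructure M 0 F n,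
      D.gateComplexity ≤ opCost * (H + 1) + 1 + H ∧
      D.depthComplexity ≤ opCost * (H + 1) + 1 + H := by
  classical
  set A : Finset (ℕ × ℕ) :=
    (Finset.range (H + 1)).biUnion fun t => (Finset.range (2 ^ (H - t))).image fun q => (t, q)
    with hAdef
  have memA : ∀ t q, (t, q) ∈ A ↔ t < H + 1 ∧ q < 2 ^ (H - t) := by
    intro t q
    simp only [hAdef, Finset.mem_biUnion, Finset.mem_range, Finset.mem_image, Prod.mk.injEq]
    constructor
    · rintro ⟨t, h1, q, h2, rfl, rfl⟩
      exact ⟨h1, h2⟩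
    · rintro ⟨h1, h2⟩
      exact ⟨t, h1, q, h2, rfl, rfl⟩
  have hcard : A.card ≤ 2 ^ (H + 1) := by
    refine Finset.card_biUnion_le.trans ?_
    calc ∑ t ∈ Finset.range (H + 1), ((Finset.range (2 ^ (H - t))).image fun q => (t, q)).card
        ≤ ∑ t ∈ Finset.range (H + 1), 2 ^ (H - t) :=
          Finset.sum_le_sum fun t _ => Finset.card_image_le.trans (by simp)
      _ = ∑ t ∈ Finset.range (H + 1), 2 ^ t := by
          rw [← Finset.sum_range_reflect]
          refine Finset.sum_congr rfl fun t ht => ?_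
          congr 1
          rw [Finset.mem_range] at ht
          omega
      _ ≤ 2 ^ (H + 1) := by
          have := Nat.geomSum_eq (m := 2) le_rfl (H + 1)
          rw [this]
          simp
  set e : A ≃ Fin A.card := A.equivFin
  have hlt : ∀ (j : Fin M) t, t < H + 1 → j.1 / 2 ^ t < 2 ^ (H - t) := by
    intro j t ht
    rw [Nat.div_lt_iff_lt_mul (by positivity), ← pow_add]
    have : H - t + t = H := by omega
    rw [this]
    exact j.2.trans_le hM
  refine ⟨A.card, hcard, exists_fermionDataStructure
    (fun b => restrictBits e (dyadicParity b.1)) ?_ ?_⟩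
  · intro j
    obtain ⟨C, hC, hact⟩ := RevCircuit.exists_network (A : Set (ℕ × ℕ)) (Finset.range (H + 1))
      (fun t => notOp (t, j.1 / 2 ^ t)) (fun _ => 0) 1 (by simp)
      (fun s _ t _ h => congrArg Prod.fst h) (by simp [notOp]) (by simp [notOp])
      (by
        intro t ht
        refine ⟨?_, by simp [notOp]⟩
        exact (memA _ _).2 ⟨by simpa using ht, hlt j t (by simpa using ht)⟩)
    obtain ⟨Q, q1, q2, q3⟩ := C.exists_circuit e hC
    refine ⟨Q, q1.trans (by simp; omega), q2.trans (by nlinarith), ?_⟩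
    intro b h
    rw [q3]
    congr 1
    have hext : ∀ y : ℕ × ℕ → Bool, C.act (dyadicParity b.1) = y →
      (∀ w ∈ A, y w = dyadicParity (bitFlip j b.1) w) →
        restrictBits e (C.act (dyadicParity b.1)) = restrictBits e (dyadicParity (bitFlip j b.1)) := by
      rintro y rfl hy
      funext i
      exact hy _ (e.symm i).2
    refine hext (fun w => if w ∈ A then dyadicParity (bitFlip j b.1) w else dyadicParity b.1 w)
      (hact _ _ ?_ ?_) (by intro w hw; simp [hw])
    · intro w hw
      by_cases hwA : w ∈ A
      · simp only [hwA, if_true]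
        rw [dyadicParity_bitFlip]
        have : j.1 / 2 ^ w.1 ≠ w.2 := by
          intro h
          refine hw w.1 (Finset.mem_range.2 ((memA w.1 w.2).1 hwA).1) ?_
          exact Prod.ext rfl h.symm
        simp [this]
      · simp [hwA]
    · intro t ht
      have : (t, j.1 / 2 ^ t) ∈ A := (memA _ _).2 ⟨by simpa using ht, hlt j t (by simpa using ht)⟩
      simp only [notOp, this, if_true]
      rw [dyadicParity_bitFlip]
      simp
  · intro j
    set m := j.1 + 1 with hm
    set S : Finset (ℕ × ℕ) := ((Finset.range (H + 1)).filter fun t => m / 2 ^ t % 2 = 1).image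
      fun t => (t, m / 2 ^ t - 1) with hS
    have hSA : S ⊆ A := by
      intro w hw
      rw [hS, Finset.mem_image] at hw
      obtain ⟨t, ht, rfl⟩ := hw
      rw [Finset.mem_filter, Finset.mem_range] at ht
      rw [memA]
      refine ⟨ht.1, ?_⟩
      have h1 : m / 2 ^ t ≤ 2 ^ (H - t) := by
        refine Nat.div_le_of_le_mul ?_
        rw [← pow_add]
        have : t + (H - t) = H := by omega
        rw [this]
        omega
      have : 0 < 2 ^ (H - t) := by positivity
      omega
    have hScard : S.card ≤ H + 1 :=
      Finset.card_image_le.trans ((Finset.card_filter_le _ _).trans (by simp))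
    obtain ⟨Q, q1, q2, q3⟩ := exists_circuit_phase e (RevCircuit.idle _) (RevCircuit.idle _)
      (RevCircuit.bounded_idle (A : Set (ℕ × ℕ))) (RevCircuit.bounded_idle _) S hSA
      (fun _ => bitSign) (fun _ => abs_bitSign)
    refine ⟨Q, q1.trans (by simp; omega), q2.trans (by simp; omega), ?_⟩
    intro b
    rw [q3]
    congr 2
    simp only [RevCircuit.act_idle]
    rw [hS, Finset.prod_image (by intro s _ t _ h; exact congrArg Prod.fst h), prod_dyadicParity,
      sgnRank_eq, ← bitSign_parityBefore]
    have : m / 2 ^ (H + 1) = 0 := by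
      refine Nat.div_eq_of_lt ?_
      have : 0 < 2 ^ H := by positivity
      have := j.2
      rw [pow_succ]
      omega
    rw [this, zero_mul]
    simp [parityBefore, numOnes_zero, bitSign, hm]

end FermionEncoding
-- The positions of the ones
namespace FermionEncoding

/-- The position of the one number `s` of a string, or `0` if there are not as many ones. -/
noncomputable def slot {M : ℕ} (b : Fin M → Bool) (s : ℕ) : ℕ := Nat.nth (fun i => occ b i = true) s

theorem slot_spec {M : ℕ} (b : Fin M → Bool) {s n : ℕ} (h : s < numOnes b n) :
    occ b (slot b s) = true ∧ numOnes b (slot b s) = s ∧ slot b s < n := by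
  have hc : ∀ hf : (Set.ofPred fun i => occ b i = true).Finite, s < hf.toFinset.card :=
    fun hf => h.trans_le (Nat.count_le_card hf n)
  exact ⟨Nat.nth_mem _ hc, Nat.count_nth hc, Nat.nth_lt_of_lt_count h⟩

theorem slot_numOnes {M : ℕ} (b : Fin M → Bool) {e : ℕ} (h : occ b e = true) :
    slot b (numOnes b e) = e :=
  Nat.nth_count (p := fun i => occ b i = true) h

theorem occ_lt {M : ℕ} {b : Fin M → Bool} {e : ℕ} (h : occ b e = true) : e < M := by
  by_contra hc
  simp [occ, hc] at h

theorem slot_eq_zero {M : ℕ} (b : Fin M → Bool) {s : ℕ} (h : hammingWeight b ≤ s) :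
    slot b s = 0 := by
  have hf : (Set.ofPred fun i => occ b i = true).Finite :=
    (Set.finite_lt_nat M).subset fun i hi => occ_lt hi
  refine Nat.nth_of_card_le hf (le_trans ?_ h)
  rw [← numOnes_length, numOnes, Nat.count_eq_card_filter_range]
  refine Finset.card_le_card fun i hi => ?_
  have hi : occ b i = true := by simpa using hi
  simp [hi, occ_lt hi]

theorem numOnes_le_iff {M : ℕ} (b : Fin M → Bool) {s : ℕ} (hs : s < hammingWeight b) (n : ℕ) :
    numOnes b n ≤ s ↔ n ≤ slot b s := by
  rw [← numOnes_length] at hs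
  obtain ⟨h1, h2, -⟩ := slot_spec b hs
  constructor
  · intro h
    by_contra hc
    have := numOnes_mono b (show slot b s + 1 ≤ n by omega)
    rw [numOnes_succ, h1, h2] at this
    simp at this
    omega
  · intro h
    have := numOnes_mono b h
    omega

theorem slot_bitFlip {M : ℕ} (j : Fin M) (b : Fin M → Bool) (hb : b j = false) (s : ℕ) :
    slot (bitFlip j b) s = if s < numOnes b j then slot b s else
      if s = numOnes b j then j.1 else slot b (s - 1) := by
  have hocc : ∀ {e}, occ b e = true → e ≠ j.1 := by
    rintro e he rfl
    rw [occ_fin, hb] at he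
    simp at he
  have key : ∀ {e}, occ b e = true →
      slot (bitFlip j b) (numOnes b e + if j.1 < e then 1 else 0) = e := by
    intro e he
    rw [← numOnes_bitFlip j b hb]
    apply slot_numOnes
    rw [occ_bitFlip, if_neg (hocc he), he]
  split_ifs with h1 h2
  · obtain ⟨a1, a2, a3⟩ := slot_spec b h1
    have := key a1
    rwa [a2, if_neg (by omega), Nat.add_zero] at this
  · have := slot_numOnes (bitFlip j b) (e := j.1) (by rw [occ_bitFlip]; simp [hb])
    rw [numOnes_bitFlip j b hb, if_neg (lt_irrefl _), Nat.add_zero] at this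
    rw [h2, this]
  · by_cases hs : s - 1 < numOnes b M
    · obtain ⟨a1, a2, a3⟩ := slot_spec b hs
      have hne := hocc a1
      have hgt : j.1 < slot b (s - 1) := by
        have := (numOnes_le_iff b (by rwa [← numOnes_length]) j.1).1 (show numOnes b j ≤ s - 1 by omega)
        omega
      have := key a1
      rw [a2, if_pos hgt] at this
      rwa [show s - 1 + 1 = s by omega] at this
    -- Past the last one both sides are the default position `0`, so the shift formula holds there
    -- too.
    · rw [slot_eq_zero b (by rw [← numOnes_length]; omega), slot_eq_zero]
      rw [← numOnes_length, numOnes_bitFlip j b hb, if_pos j.2]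
      omega

theorem slot_bitFlip' {M : ℕ} (j : Fin M) (b : Fin M → Bool) (hb : b j = true) (s : ℕ) :
    slot (bitFlip j b) s = if s < numOnes b j then slot b s else slot b (s + 1) := by
  have hb' : bitFlip j b j = false := by rw [bitFlip_self, hb]; rfl
  have h := slot_bitFlip j (bitFlip j b) hb'
  have hr : numOnes (bitFlip j b) j = numOnes b j := by
    rw [numOnes_bitFlip' j b hb j.1]
    simp
  rw [bitFlip_bitFlip, hr] at h
  rw [h, h]
  split_ifs
  · rfl
  · omega
  · omega
  · rw [Nat.add_sub_cancel]

/-! ### Splitting positions into blocks and offsets; the unary code of the blocks -/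

section blocks

variable {M : ℕ} (b : Fin M → Bool) (F L : ℕ)

/-- The one number `s` is not before `j` if it lies after the block of `j`, or in that block at an
offset that is not smaller. The two counts at the ends of the block locate the one, so only the `L`
low bits of its position enter. If there is no one number `s`, the first alternative holds. -/
theorem numOnes_le_iff_block (j : Fin M) (s : ℕ) :
    numOnes b j ≤ s ↔ numOnes b ((j.1 / 2 ^ L + 1) * 2 ^ L) ≤ s ∨
      (numOnes b (j.1 / 2 ^ L * 2 ^ L) ≤ s ∧ ¬ slot b s % 2 ^ L < j.1 % 2 ^ L) := by
  have hd := Nat.div_add_mod j.1 (2 ^ L)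
  have hm := Nat.mod_lt j.1 (show 0 < 2 ^ L by positivity)
  have e1 : (j.1 / 2 ^ L + 1) * 2 ^ L = 2 ^ L * (j.1 / 2 ^ L) + 2 ^ L := by ring
  have e0 : j.1 / 2 ^ L * 2 ^ L = 2 ^ L * (j.1 / 2 ^ L) := by ring
  have m1 := numOnes_mono b (show j.1 ≤ (j.1 / 2 ^ L + 1) * 2 ^ L by omega)
  have m0 := numOnes_mono b (show j.1 / 2 ^ L * 2 ^ L ≤ j.1 by omega)
  by_cases h1 : numOnes b ((j.1 / 2 ^ L + 1) * 2 ^ L) ≤ s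
  · simp only [h1, true_or, iff_true]
    omega
  by_cases h0 : numOnes b (j.1 / 2 ^ L * 2 ^ L) ≤ s
  · have hs : s < hammingWeight b := (not_le.1 h1).trans_le (numOnes_le b _)
    have i1 := (numOnes_le_iff b hs _).not.1 h1
    have i0 := (numOnes_le_iff b hs _).1 h0
    have hmod : slot b s % 2 ^ L = slot b s - 2 ^ L * (j.1 / 2 ^ L) := by
      have : slot b s = (slot b s - 2 ^ L * (j.1 / 2 ^ L)) + 2 ^ L * (j.1 / 2 ^ L) := by omega
      conv_lhs => rw [this]
      rw [Nat.add_mul_mod_self_left, Nat.mod_eq_of_lt (by omega)]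
    simp only [h1, h0, false_or, true_and, hmod, numOnes_le_iff b hs]
    omega
  · simp only [h1, h0, false_or, false_and, iff_false]
    omega

theorem eq_slot_iff_block (j : Fin M) (s : ℕ) :
    (s = numOnes b j ∧ b j = true) ↔ (numOnes b (j.1 / 2 ^ L * 2 ^ L) ≤ s ∧
      ¬ numOnes b ((j.1 / 2 ^ L + 1) * 2 ^ L) ≤ s ∧ slot b s % 2 ^ L = j.1 % 2 ^ L) := by
  have hd := Nat.div_add_mod j.1 (2 ^ L)
  have hm := Nat.mod_lt j.1 (show 0 < 2 ^ L by positivity)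
  have e1 : (j.1 / 2 ^ L + 1) * 2 ^ L = 2 ^ L * (j.1 / 2 ^ L) + 2 ^ L := by ring
  have e0 : j.1 / 2 ^ L * 2 ^ L = 2 ^ L * (j.1 / 2 ^ L) := by ring
  constructor
  · rintro ⟨rfl, hj⟩
    have hsl : slot b (numOnes b j) = j := slot_numOnes b (by rw [occ_fin, hj])
    have m1 := numOnes_mono b (show j.1 + 1 ≤ (j.1 / 2 ^ L + 1) * 2 ^ L by omega)
    have m0 := numOnes_mono b (show j.1 / 2 ^ L * 2 ^ L ≤ j.1 by omega)
    rw [numOnes_succ, occ_fin, hj] at m1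
    simp only [Bool.toNat_true] at m1
    exact ⟨m0, by omega, by rw [hsl]⟩
  · rintro ⟨h0, h1, h2⟩
    have hs : s < hammingWeight b := (not_le.1 h1).trans_le (numOnes_le b _)
    obtain ⟨a1, a2, -⟩ := slot_spec b (n := M) (by rwa [numOnes_length])
    have i1 := (numOnes_le_iff b hs _).not.1 h1
    have i0 := (numOnes_le_iff b hs _).1 h0
    have hmod : slot b s % 2 ^ L = slot b s - 2 ^ L * (j.1 / 2 ^ L) := by
      have : slot b s = (slot b s - 2 ^ L * (j.1 / 2 ^ L)) + 2 ^ L * (j.1 / 2 ^ L) := by omega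
      conv_lhs => rw [this]
      rw [Nat.add_mul_mod_self_left, Nat.mod_eq_of_lt (by omega)]
    have : slot b s = j := by omega
    rw [this] at a1 a2
    rw [occ_fin] at a1
    exact ⟨a2.symm, a1⟩

/-- In the unary code of the numbers of ones in the first `F` blocks of length `2 ^ L` (each block
contributes its ones, followed by a delimiter), the number of delimiters before a position. -/
def delims (p : ℕ) : ℕ :=
  ((Finset.range F).filter fun q => q + numOnes b ((q + 1) * 2 ^ L) < p).card

theorem delim_strictMono : StrictMono fun q => q + numOnes b ((q + 1) * 2 ^ L) := by
  refine strictMono_nat_of_lt_succ fun q => ?_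
  have := numOnes_mono b (show (q + 1) * 2 ^ L ≤ (q + 1 + 1) * 2 ^ L by gcongr; omega)
  omega

/-- For `K ≥ 1`, the delimiter number `K - 1` is preceded by `K - 1` delimiters and by the ones of
the first `K` blocks. Its position is therefore below `s + K` exactly if these blocks contain at
most `s` ones. Different slots `s` thus look at different positions of the code. -/
theorem le_delims_iff {K s : ℕ} (hK : K ≤ F) :
    K ≤ delims b F L (s + K) ↔ numOnes b (K * 2 ^ L) ≤ s := by
  constructor
  · intro h
    by_contra hc
    rcases Nat.eq_zero_or_pos K with rfl | hpos
    · rw [zero_mul, numOnes_zero] at hc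
      omega
    · have hsub : (Finset.range F).filter (fun q => q + numOnes b ((q + 1) * 2 ^ L) < s + K) ⊆
          Finset.range (K - 1) := by
        intro q hq
        rw [Finset.mem_filter] at hq
        rw [Finset.mem_range]
        by_contra hq'
        have := (delim_strictMono b L).monotone (show K - 1 ≤ q by omega)
        simp only [Nat.sub_add_cancel hpos] at this
        omega
      have := Finset.card_le_card hsub
      rw [Finset.card_range] at this
      unfold delims at h
      omega
  · intro h
    have hsub : Finset.range K ⊆
        (Finset.range F).filter (fun q => q + numOnes b ((q + 1) * 2 ^ L) < s + K) := by
      intro q hq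
      rw [Finset.mem_range] at hq
      rw [Finset.mem_filter, Finset.mem_range]
      have := numOnes_mono b (show (q + 1) * 2 ^ L ≤ K * 2 ^ L by gcongr; omega)
      omega
    have := Finset.card_le_card hsub
    rwa [Finset.card_range] at this

theorem delims_mono : Monotone (delims b F L) := by
  intro p q h
  refine Finset.card_le_card fun i hi => ?_
  rw [Finset.mem_filter] at hi ⊢
  exact ⟨hi.1, by omega⟩

theorem delims_succ_le (p : ℕ) : delims b F L (p + 1) ≤ delims b F L p + 1 := by
  have hsub : (Finset.range F).filter (fun q => q + numOnes b ((q + 1) * 2 ^ L) < p + 1) ⊆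
      (Finset.range F).filter (fun q => q + numOnes b ((q + 1) * 2 ^ L) < p) ∪
      (Finset.range F).filter (fun q => q + numOnes b ((q + 1) * 2 ^ L) = p) := by
    intro q hq
    simp only [Finset.mem_union, Finset.mem_filter] at hq ⊢
    rw [← and_or_left]
    exact ⟨hq.1, by omega⟩
  have h1 : ((Finset.range F).filter
      (fun q => q + numOnes b ((q + 1) * 2 ^ L) = p)).card ≤ 1 := by
    refine Finset.card_le_one.2 fun q hq q' hq' => ?_
    rw [Finset.mem_filter] at hq hq'
    exact (delim_strictMono b L).injective (hq.2.trans hq'.2.symm)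
  exact (Finset.card_le_card hsub).trans ((Finset.card_union_le _ _).trans
    (Nat.add_le_add_left h1 _))

theorem delims_add_le (p n : ℕ) : delims b F L (p + n) ≤ delims b F L p + n := by
  induction n with
  | zero => exact le_rfl
  | succ n ih => exact (delims_succ_le b F L (p + n)).trans (by omega)

theorem delims_zero : delims b F L 0 = 0 := by simp [delims]

theorem delims_of_le (hb : hammingWeight b ≤ F) {p : ℕ} (hp : 2 * F ≤ p) : delims b F L p = F := by
  rw [delims, Finset.filter_true_of_mem, Finset.card_range]
  intro q hq
  rw [Finset.mem_range] at hq
  have := numOnes_le b ((q + 1) * 2 ^ L)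
  omega

/-- A new one is a new symbol in the unary code at position `j / 2 ^ L + numOnes b j`, and
everything after it moves by one place. -/
theorem delims_bitFlip (j : Fin M) (hb : b j = false) (p : ℕ) :
    delims (bitFlip j b) F L p =
      if p ≤ j.1 / 2 ^ L + numOnes b j then delims b F L p else delims b F L (p - 1) := by
  have hd := Nat.div_add_mod j.1 (2 ^ L)
  have hm := Nat.mod_lt j.1 (show 0 < 2 ^ L by positivity)
  have hlt : ∀ q, j.1 < (q + 1) * 2 ^ L ↔ j.1 / 2 ^ L ≤ q := by
    intro q
    rw [← Nat.div_lt_iff_lt_mul (by positivity)]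
    omega
  have hge : ∀ q, j.1 / 2 ^ L ≤ q → numOnes b j ≤ numOnes b ((q + 1) * 2 ^ L) := by
    intro q hq
    exact numOnes_mono b ((hlt q).2 hq).le
  have hle : ∀ q, ¬ j.1 / 2 ^ L ≤ q → numOnes b ((q + 1) * 2 ^ L) ≤ numOnes b j := by
    intro q hq
    exact numOnes_mono b (not_lt.1 ((hlt q).not.2 hq))
  clear hd hm
  generalize j.1 / 2 ^ L = k at *
  split_ifs with h <;> unfold delims <;> congr 1 <;> refine Finset.filter_congr fun q _ => ?_
  all_goals
    rw [numOnes_bitFlip j b hb]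
    simp only [hlt]
    have h1 := hge q
    have h2 := hle q
    split_ifs with hq
    · have := h1 hq
      omega
    · have := h2 hq
      omega

theorem delims_bitFlip' (j : Fin M) (hb : b j = true) (p : ℕ) :
    delims (bitFlip j b) F L p =
      if p ≤ j.1 / 2 ^ L + numOnes b j then delims b F L p else delims b F L (p + 1) := by
  have hb' : bitFlip j b j = false := by rw [bitFlip_self, hb]; rfl
  have h := delims_bitFlip (bitFlip j b) F L j hb'
  have hr : numOnes (bitFlip j b) j = numOnes b j := by
    rw [numOnes_bitFlip' j b hb j.1]
    simp
  rw [bitFlip_bitFlip, hr] at h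
  split_ifs with hp
  · rw [h, if_pos hp]
  · rw [h, if_neg (by omega), Nat.add_sub_cancel]

end blocks

end FermionEncoding
-- Networks given by components, and affine chains on borrowed bits
namespace FermionEncoding

namespace RevCircuit

variable {W : Type*}

/-- `exists_network` for operations given by their components. -/
theorem exists_network_of {ι : Type*} (A : Set W) (I : Finset ι) (tgt : ι → W) (ins : ι → List W)
    (fn : ι → (W → Bool) → Bool) (τ : ι → ℕ) (T : ℕ) (hT : ∀ i ∈ I, τ i < T)
    (hlen : ∀ i ∈ I, (ins i).length ≤ 6)
    (hcongr : ∀ i ∈ I, ∀ x y : W → Bool, (∀ w ∈ ins i, x w = y w) → fn i x = fn i y)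
    (hinj : ∀ i ∈ I, ∀ j ∈ I, tgt i = tgt j → i = j)
    (hread : ∀ i ∈ I, ∀ j ∈ I, tgt j ∈ ins i → τ j < τ i)
    (hdisj : ∀ i ∈ I, ∀ j ∈ I, τ i = τ j → ∀ w ∈ ins i, w ∈ ins j → i = j)
    (hA : ∀ i ∈ I, tgt i ∈ A ∧ ∀ w ∈ ins i, w ∈ A) :
    ∃ C : RevCircuit W, C.Bounded A I.card T ∧ ∀ x y : W → Bool,
      (∀ w, (∀ i ∈ I, w ≠ tgt i) → y w = x w) →
      (∀ i ∈ I, y (tgt i) = (x (tgt i) ^^ fn i y)) → C.act x = y := by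
  obtain ⟨C, hC, h⟩ := exists_network (ι := I) A Finset.univ
    (fun i => ⟨tgt i, ins i, fn i, fun h => lt_irrefl _ (hread i i.2 i i.2 h), hlen i i.2,
      hcongr i i.2⟩) (fun i => τ i) T (fun i _ => hT i i.2)
    (fun i _ j _ h => Subtype.ext (hinj i i.2 j j.2 h))
    (fun i _ j _ h => hread i i.2 j j.2 h)
    (fun i _ j _ h w hw hw' => Subtype.ext (hdisj i i.2 j j.2 h w hw hw'))
    (fun i _ => hA i i.2)
  refine ⟨C, by simpa using hC, fun x y h1 h2 => h x y ?_ ?_⟩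
  · exact fun w hw => h1 w fun i hi => hw ⟨i, hi⟩ (Finset.mem_univ _)
  · exact fun i _ => h2 i i.2

/-- Simultaneous operations whose targets are not read, with a colouring `c` such that operations
of the same colour read different wires. -/
theorem exists_layer {ι : Type*} (A : Set W) (I : Finset ι) (tgt : ι → W) (ins : ι → List W)
    (fn : ι → (W → Bool) → Bool) (c : ι → ℕ) (T : ℕ) (hT : ∀ i ∈ I, c i < T)
    (hlen : ∀ i ∈ I, (ins i).length ≤ 6)
    (hcongr : ∀ i ∈ I, ∀ x y : W → Bool, (∀ w ∈ ins i, x w = y w) → fn i x = fn i y)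
    (hinj : ∀ i ∈ I, ∀ j ∈ I, tgt i = tgt j → i = j)
    (hread : ∀ i ∈ I, ∀ j ∈ I, tgt j ∉ ins i)
    (hdisj : ∀ i ∈ I, ∀ j ∈ I, c i = c j → ∀ w ∈ ins i, w ∈ ins j → i = j)
    (hA : ∀ i ∈ I, tgt i ∈ A ∧ ∀ w ∈ ins i, w ∈ A) :
    ∃ C : RevCircuit W, C.Bounded A I.card T ∧ ∀ x : W → Bool,
      (∀ w, (∀ i ∈ I, w ≠ tgt i) → C.act x w = x w) ∧
      (∀ i ∈ I, C.act x (tgt i) = (x (tgt i) ^^ fn i x)) := by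
  classical
  obtain ⟨C, hC, h⟩ := exists_network_of A I tgt ins fn c T hT hlen hcongr hinj
    (fun i hi j hj hm => absurd hm (hread i hi j hj)) hdisj hA
  refine ⟨C, hC, fun x => ?_⟩
  let y : W → Bool := fun w => x w ^^ decide (∃ i ∈ I, w = tgt i ∧ fn i x = true)
  have hy : ∀ i ∈ I, y (tgt i) = (x (tgt i) ^^ fn i x) := by
    intro i hi
    have : (∃ k ∈ I, tgt i = tgt k ∧ fn k x = true) ↔ fn i x = true := by
      constructor
      · rintro ⟨k, hk, e, hf⟩
        rwa [hinj i hi k hk e]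
      · exact fun hf => ⟨i, hi, rfl, hf⟩
    simp [y, this]
  have hy' : ∀ w, (∀ i ∈ I, w ≠ tgt i) → y w = x w := by
    intro w hw
    have : ¬ ∃ i ∈ I, w = tgt i ∧ fn i x = true := fun ⟨i, hi, e, _⟩ => hw i hi e
    simp [y, this]
  have hact : C.act x = y := by
    refine h x y hy' fun i hi => ?_
    rw [hy i hi, hcongr i hi y x fun w hw => hy' w fun k hk e => hread i hi k hk (e ▸ hw)]
  rw [hact]
  exact ⟨hy', hy⟩

end RevCircuit

/-- The result of a chain of affine maps that depend on the bits of `x` on the wires `X`. -/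
def ladderVal {W : Type*} (u v : ℕ → Bool → Bool) (X : ℕ → ℕ → W) (a : ℕ → W) (x : W → Bool)
    (s : ℕ) : ℕ → Bool
  | 0 => x (a s)
  | i + 1 => (u i (x (X i s)) && ladderVal u v X a x s i) ^^ v i (x (X i s))

theorem ladderVal_congr {W : Type*} (u v : ℕ → Bool → Bool) (X : ℕ → ℕ → W) (a : ℕ → W)
    (x y : W → Bool) (s m : ℕ) (h0 : x (a s) = y (a s)) (h : ∀ i < m, x (X i s) = y (X i s)) :
    ladderVal u v X a x s m = ladderVal u v X a y s m := by
  induction m with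
  | zero => exact h0
  | succ m ih => rw [ladderVal, ladderVal, ih fun i hi => h i (by omega), h m (by omega)]

section ladder

variable {W : Type*} (A : Set W) (F N : ℕ) (u v : ℕ → Bool → Bool) (X G : ℕ → ℕ → W)

/-- The chain of affine maps is computed with the help of wires whose contents are arbitrary: the
intermediate results are added to these. -/
theorem exists_ladder_all
    (hG : ∀ i ≤ N, ∀ i' ≤ N, ∀ s < F, ∀ s' < F, G i s = G i' s' → i = i' ∧ s = s')
    (hXG : ∀ i < N, ∀ i' ≤ N, ∀ s < F, ∀ s' < F, X i s ≠ G i' s')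
    (hX : ∀ i < N, ∀ s < F, ∀ s' < F, X i s = X i s' → s = s')
    (hGA : ∀ i ≤ N, ∀ s < F, G i s ∈ A) (hXA : ∀ i < N, ∀ s < F, X i s ∈ A)
    (m : ℕ) (hm : m ≤ N) :
    ∃ C : RevCircuit W, C.Bounded A (2 * m * F) (2 * m) ∧ ∀ x : W → Bool,
      (∀ w, (∀ i s, 1 ≤ i → i ≤ m → s < F → w ≠ G i s) → C.act x w = x w) ∧
      (∀ i s, 1 ≤ i → i ≤ m → s < F →
        C.act x (G i s) = (x (G i s) ^^ ladderVal u v X (G 0) x s i)) := by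
  induction m with
  | zero =>
    refine ⟨RevCircuit.idle W, by simpa using RevCircuit.bounded_idle A, fun x => ⟨?_, ?_⟩⟩
    · exact fun w _ => rfl
    · intro i s h1 h2
      omega
  | succ m ih =>
    obtain ⟨C, hC, hact⟩ := ih (by omega)
    have layer : ∀ f : Bool → Bool → Bool, ∃ E : RevCircuit W, E.Bounded A F 1 ∧ ∀ x : W → Bool,
        (∀ w, (∀ s < F, w ≠ G (m + 1) s) → E.act x w = x w) ∧
        (∀ s < F, E.act x (G (m + 1) s) = (x (G (m + 1) s) ^^ f (x (X m s)) (x (G m s)))) := by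
      intro f
      obtain ⟨E, hE, h⟩ := RevCircuit.exists_layer A (Finset.range F) (G (m + 1))
        (fun s => [X m s, G m s]) (fun s x => f (x (X m s)) (x (G m s))) (fun _ => 0) 1
        (by simp) (by simp)
        (by
          intro s _ x y h
          rw [h (X m s) (by simp), h (G m s) (by simp)])
        (by
          intro s hs s' hs' e
          exact (hG _ hm _ hm s (by simpa using hs) s' (by simpa using hs') e).2)
        (by
          intro s hs s' hs' e
          rw [Finset.mem_range] at hs hs'
          simp only [List.mem_cons, List.not_mem_nil, or_false] at e
          rcases e with e | e
          · exact hXG m (by omega) (m + 1) hm s hs s' hs' e.symm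
          · have := (hG _ hm m (by omega) s' hs' s hs e).1
            omega)
        (by
          intro s hs s' hs' _ w hw hw'
          rw [Finset.mem_range] at hs hs'
          simp only [List.mem_cons, List.not_mem_nil, or_false] at hw hw'
          rcases hw with rfl | rfl <;> rcases hw' with e | e
          · exact hX m (by omega) s hs s' hs' e
          · exact absurd e (hXG m (by omega) m (by omega) s hs s' hs')
          · exact absurd e.symm (hXG m (by omega) m (by omega) s' hs' s hs)
          · exact (hG m (by omega) m (by omega) s hs s' hs' e).2)
        (by
          intro s hs
          rw [Finset.mem_range] at hs
          refine ⟨hGA _ hm s hs, ?_⟩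
          simp only [List.mem_cons, List.not_mem_nil, or_false]
          rintro w (rfl | rfl)
          · exact hXA m (by omega) s hs
          · exact hGA m (by omega) s hs)
      refine ⟨E, by simpa using hE, fun x => ⟨fun w hw => (h x).1 w ?_, fun s hs => (h x).2 s ?_⟩⟩
      · simpa using hw
      · simpa using hs
    -- The unknown content `g` of `G m` cancels over GF(2): `u && g` is added before the recursive
    -- call and `(u && (g ^^ value)) ^^ v` after it, which leaves `(u && value) ^^ v`. For `m = 0`
    -- the wire `G 0` holds the start value itself and stays unchanged, so nothing must be added
    -- beforehand.
    obtain ⟨E, hE, e⟩ := layer fun c a => decide (m ≠ 0) && (u m c && a)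
    obtain ⟨E', hE', e'⟩ := layer fun c a => (u m c && a) ^^ v m c
    refine ⟨(E.seq C).seq E', ((hE.seq hC).seq hE').mono ?_ ?_, fun x => ?_⟩
    · nlinarith
    · omega
    rw [RevCircuit.act_seq, RevCircuit.act_seq]
    have eX : ∀ i < N, ∀ s < F, E.act x (X i s) = x (X i s) := fun i hi s hs =>
      (e x).1 _ fun s' hs' => hXG i hi _ hm s hs s' hs'
    have eG : ∀ i ≤ m, ∀ s < F, E.act x (G i s) = x (G i s) := fun i hi s hs =>
      (e x).1 _ fun s' hs' h => by
        have := (hG i (by omega) _ hm s hs s' hs' h).1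
        omega
    have cX : ∀ i < N, ∀ s < F, C.act (E.act x) (X i s) = x (X i s) := fun i hi s hs => by
      rw [(hact _).1 _ fun i' s' _ hi' hs' => hXG i hi i' (by omega) s hs s' hs', eX i hi s hs]
    have cT : ∀ s < F, C.act (E.act x) (G (m + 1) s) = E.act x (G (m + 1) s) := fun s hs =>
      (hact _).1 _ fun i' s' _ hi' hs' h => by
        have := (hG _ hm i' (by omega) s hs s' hs' h).1
        omega
    have lv : ∀ i ≤ m, ∀ s < F, ladderVal u v X (G 0) (E.act x) s i =
        ladderVal u v X (G 0) x s i := fun i hi s hs =>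
      ladderVal_congr u v X _ _ _ s i (eG 0 (by omega) s hs) fun i' hi' => eX i' (by omega) s hs
    have cG : ∀ i s, 1 ≤ i → i ≤ m → s < F →
        C.act (E.act x) (G i s) = (x (G i s) ^^ ladderVal u v X (G 0) x s i) := by
      intro i s h1 h2 hs
      rw [(hact _).2 i s h1 h2 hs, eG i h2 s hs, lv i h2 s hs]
    refine ⟨?_, ?_⟩
    · intro w hw
      rw [(e' _).1 w fun s hs => hw (m + 1) s (by omega) le_rfl hs,
        (hact _).1 w fun i s h1 h2 hs => hw i s h1 (by omega) hs,
        (e x).1 w fun s hs => hw (m + 1) s (by omega) le_rfl hs]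
    · intro i s h1 h2 hs
      rcases Nat.lt_or_ge m i with him | him
      · obtain rfl : i = m + 1 := by omega
        rw [(e' _).2 s hs, cT s hs, (e x).2 s hs, cX m (by omega) s hs, ladderVal]
        rcases Nat.eq_zero_or_pos m with rfl | hpos
        · have : C.act (E.act x) (G 0 s) = x (G 0 s) := by
            rw [(hact _).1 _ fun i' s' _ _ _ => by omega, eG 0 le_rfl s hs]
          rw [this, ladderVal]
          cases x (G (0 + 1) s) <;> cases u 0 (x (X 0 s)) <;> cases x (G 0 s) <;> simp
        · rw [cG m s hpos le_rfl hs, decide_eq_true hpos.ne']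
          cases x (G (m + 1) s) <;> cases u m (x (X m s)) <;> cases x (G m s) <;> simp
      · rw [(e' _).1 _ fun s' hs' h => by
          have := (hG i (by omega) _ hm s hs s' hs' h).1
          omega, cG i s h1 him hs]

/-- The result of the chain of affine maps is added to the last wire, and the other wires that
help are restored. -/
theorem exists_ladder (hN : 1 ≤ N)
    (hG : ∀ i ≤ N, ∀ i' ≤ N, ∀ s < F, ∀ s' < F, G i s = G i' s' → i = i' ∧ s = s')
    (hXG : ∀ i < N, ∀ i' ≤ N, ∀ s < F, ∀ s' < F, X i s ≠ G i' s')
    (hX : ∀ i < N, ∀ s < F, ∀ s' < F, X i s = X i s' → s = s')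
    (hGA : ∀ i ≤ N, ∀ s < F, G i s ∈ A) (hXA : ∀ i < N, ∀ s < F, X i s ∈ A) :
    ∃ C : RevCircuit W, C.Bounded A (4 * N * F) (4 * N) ∧ ∀ x : W → Bool,
      (∀ w, (∀ s < F, w ≠ G N s) → C.act x w = x w) ∧
      (∀ s < F, C.act x (G N s) = (x (G N s) ^^ ladderVal u v X (G 0) x s N)) := by
  obtain ⟨C, hC, c⟩ := exists_ladder_all A F N u v X G hG hXG hX hGA hXA N le_rfl
  -- Running the chain again up to `N - 1` adds the intermediate values a second time, which
  -- restores the borrowed wires.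
  obtain ⟨D, hD, d⟩ := exists_ladder_all A F N u v X G hG hXG hX hGA hXA (N - 1) (by omega)
  refine ⟨C.seq D, (hC.seq hD).mono ?_ ?_, fun x => ?_⟩
  · have : 2 * (N - 1) * F ≤ 2 * N * F := by gcongr; omega
    nlinarith
  · omega
  rw [RevCircuit.act_seq]
  have lv : ∀ i ≤ N, ∀ s < F, ladderVal u v X (G 0) (C.act x) s i =
      ladderVal u v X (G 0) x s i := by
    intro i hi s hs
    refine ladderVal_congr u v X _ _ _ s i ?_ fun i' hi' => ?_
    · refine (c x).1 _ fun k s' h1 h2 hs' h => ?_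
      have := (hG 0 (by omega) k (by omega) s hs s' hs' h).1
      omega
    · exact (c x).1 _ fun k s' h1 h2 hs' => hXG i' (by omega) k h2 s hs s' hs'
  refine ⟨?_, ?_⟩
  · intro w hw
    by_cases h : ∃ i s, 1 ≤ i ∧ i ≤ N - 1 ∧ s < F ∧ w = G i s
    · obtain ⟨i, s, h1, h2, hs, rfl⟩ := h
      rw [(d _).2 i s h1 h2 hs, (c x).2 i s h1 (by omega) hs, lv i (by omega) s hs]
      simp
    · rw [(d _).1 w fun i s h1 h2 hs e => h ⟨i, s, h1, h2, hs, e⟩, (c x).1 w]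
      intro i s h1 h2 hs e
      by_cases hi : i = N
      · subst hi
        exact hw s hs e
      · exact h ⟨i, s, h1, by omega, hs, e⟩
  · intro s hs
    rw [(d _).1 _ fun i s' h1 h2 hs' h => by
      have := (hG N le_rfl i (by omega) s hs s' hs' h).1
      omega, (c x).2 N s hN le_rfl hs]

end ladder

end FermionEncoding
-- The wires and operations on registers
namespace FermionEncoding

/-- The registers of one bit per node of a binary tree, or per slot. -/
inductive Reg
  | beta | zero | ltMid | lt | neMid | ne | qa | qb | qc | fa | fb | ee | tree | bc | geq | pres
  | carry | delta
  deriving DecidableEq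

/-- The wires: the bits `i` of the offset in the slots `s`, and the bits of the registers. -/
inductive Wire
  | low (s i : ℕ)
  | reg (r : Reg) (i : ℕ)
  deriving DecidableEq

/-- The wires of a data structure with `F` slots of `2 * h` bits and registers for a binary tree
of height `H`. -/
def wires (F h H : ℕ) : Set Wire :=
  fun w => match w with
    | .low s i => s < F ∧ i < 2 * h
    | .reg _ i => i < 2 ^ (H + 1)

theorem low_mem_wires {F h H s i : ℕ} : Wire.low s i ∈ wires F h H ↔ s < F ∧ i < 2 * h := Iff.rfl

theorem reg_mem_wires {F h H i : ℕ} {r : Reg} : Wire.reg r i ∈ wires F h H ↔ i < 2 ^ (H + 1) :=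
  Iff.rfl

/-- The state with `f` added to the register `r`. -/
def addReg (r : Reg) (f : ℕ → Bool) (x : Wire → Bool) : Wire → Bool
  | .low s i => x (.low s i)
  | .reg r' i => if r' = r then x (.reg r' i) ^^ f i else x (.reg r' i)

@[simp]
theorem addReg_low (r : Reg) (f : ℕ → Bool) (x : Wire → Bool) (s i : ℕ) :
    addReg r f x (.low s i) = x (.low s i) := rfl

@[simp]
theorem addReg_same (r : Reg) (f : ℕ → Bool) (x : Wire → Bool) (i : ℕ) :
    addReg r f x (.reg r i) = (x (.reg r i) ^^ f i) := if_pos rfl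

@[simp]
theorem addReg_of_ne {r r' : Reg} (h : r' ≠ r) (f : ℕ → Bool) (x : Wire → Bool) (i : ℕ) :
    addReg r f x (.reg r' i) = x (.reg r' i) := if_neg h

theorem addReg_comm {r r' : Reg} (h : r' ≠ r) (f f' : ℕ → Bool) (x : Wire → Bool) :
    addReg r f (addReg r' f' x) = addReg r' f' (addReg r f x) := by
  funext w
  cases w with
  | low s i => rfl
  | reg q i =>
    by_cases h1 : q = r
    · subst h1
      simp [h.symm]
    · by_cases h2 : q = r'
      · subst h2
        simp [h]
      · simp [h1, h2]

theorem addReg_addReg_self (r : Reg) (f : ℕ → Bool) (x : Wire → Bool) :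
    addReg r f (addReg r f x) = x := by
  funext w
  cases w with
  | low s i => rfl
  | reg q i =>
    by_cases h1 : q = r
    · subst h1
      simp
    · simp [h1]

theorem exists_reg_network (A : Set Wire) (r : Reg) (I : Finset ℕ) (ins : ℕ → List Wire)
    (fn : ℕ → (Wire → Bool) → Bool) (τ : ℕ → ℕ) (T : ℕ) (hT : ∀ i ∈ I, τ i < T)
    (hlen : ∀ i ∈ I, (ins i).length ≤ 6)
    (hcongr : ∀ i ∈ I, ∀ x y : Wire → Bool, (∀ w ∈ ins i, x w = y w) → fn i x = fn i y)
    (hread : ∀ i ∈ I, ∀ j ∈ I, .reg r j ∈ ins i → τ j < τ i)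
    (hdisj : ∀ i ∈ I, ∀ j ∈ I, τ i = τ j → ∀ w ∈ ins i, w ∈ ins j → i = j)
    (hA : ∀ i ∈ I, .reg r i ∈ A ∧ ∀ w ∈ ins i, w ∈ A) :
    ∃ C : RevCircuit Wire, C.Bounded A I.card T ∧ ∀ (x : Wire → Bool) (v : ℕ → Bool),
      (∀ i, i ∉ I → v i = false) → (∀ i ∈ I, v i = fn i (addReg r v x)) →
      C.act x = addReg r v x := by
  obtain ⟨C, hC, h⟩ := RevCircuit.exists_network_of A I (Wire.reg r) ins fn τ T hT hlen hcongr
    (fun i _ j _ e => (Wire.reg.inj e).2) hread hdisj hA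
  refine ⟨C, hC, fun x v h0 h1 => h x _ ?_ ?_⟩
  · intro w hw
    cases w with
    | low s i => rfl
    | reg q i =>
      by_cases hq : q = r
      · subst hq
        have : i ∉ I := fun hi => hw i hi rfl
        simp [h0 i this]
      · simp [hq]
  · intro i hi
    rw [addReg_same, ← h1 i hi]

theorem exists_reg_layer (A : Set Wire) (r : Reg) (I : Finset ℕ) (ins : ℕ → List Wire)
    (fn : ℕ → (Wire → Bool) → Bool) (c : ℕ → ℕ) (T : ℕ) (hT : ∀ i ∈ I, c i < T)
    (hlen : ∀ i ∈ I, (ins i).length ≤ 6)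
    (hcongr : ∀ i ∈ I, ∀ x y : Wire → Bool, (∀ w ∈ ins i, x w = y w) → fn i x = fn i y)
    (hread : ∀ i ∈ I, ∀ j ∈ I, .reg r j ∉ ins i)
    (hdisj : ∀ i ∈ I, ∀ j ∈ I, c i = c j → ∀ w ∈ ins i, w ∈ ins j → i = j)
    (hA : ∀ i ∈ I, .reg r i ∈ A ∧ ∀ w ∈ ins i, w ∈ A) :
    ∃ C : RevCircuit Wire, C.Bounded A I.card T ∧ ∀ x : Wire → Bool,
      C.act x = addReg r (fun i => decide (i ∈ I) && fn i x) x := by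
  obtain ⟨C, hC, h⟩ := RevCircuit.exists_layer A I (Wire.reg r) ins fn c T hT hlen hcongr
    (fun i _ j _ e => (Wire.reg.inj e).2) hread hdisj hA
  refine ⟨C, hC, fun x => ?_⟩
  funext w
  by_cases hw : ∃ i ∈ I, w = .reg r i
  · obtain ⟨i, hi, rfl⟩ := hw
    rw [(h x).2 i hi]
    simp [hi]
  · rw [(h x).1 w fun i hi e => hw ⟨i, hi, e⟩]
    cases w with
    | low s i => rfl
    | reg q i =>
      by_cases hq : q = r
      · subst hq
        have : i ∉ I := fun hi => hw ⟨i, hi, rfl⟩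
        simp [this]
      · simp [hq]

/-! ### Counting functions stored as one bit per node of a binary tree -/

section heap

theorem log_half {i : ℕ} (h : 2 ≤ i) : Nat.log 2 i = Nat.log 2 (i / 2) + 1 :=
  Nat.log_of_one_lt_of_le one_lt_two h

theorem log_le {H i : ℕ} (h : i < 2 ^ (H + 1)) : Nat.log 2 i ≤ H := by
  have := Nat.log_lt_of_lt_pow' (by omega) h
  omega

theorem log_leaf {H p : ℕ} (h : p < 2 ^ H) : Nat.log 2 (2 ^ H + p) = H := by
  rw [Nat.log_eq_iff (Or.inr ⟨one_lt_two, by positivity⟩), pow_succ]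
  omega

/-- The first position below the node `i` of a binary tree of height `H` (in heap order, the root
being `1`). -/
def nodePos (H i : ℕ) : ℕ := (i - 2 ^ Nat.log 2 i) * 2 ^ (H - Nat.log 2 i)

/-- The value of `f` at the first position below a node, up to lower bits. -/
def nodeCnt (H : ℕ) (f : ℕ → ℕ) (i : ℕ) : ℕ := f (nodePos H i) / 2 ^ (H - Nat.log 2 i)

variable {H i : ℕ} (f : ℕ → ℕ)

theorem nodePos_eq (h : 2 ≤ i) (hi : i < 2 ^ (H + 1)) :
    nodePos H i = nodePos H (i / 2) + i % 2 * 2 ^ (H - Nat.log 2 i) := by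
  have hl := log_le hi
  have hp := Nat.pow_log_le_self 2 (show i / 2 ≠ 0 by omega)
  rw [nodePos, nodePos, log_half h] at *
  have e : H - Nat.log 2 (i / 2) = H - (Nat.log 2 (i / 2) + 1) + 1 := by omega
  rw [e, pow_succ, pow_succ]
  obtain ⟨d, hd⟩ := Nat.exists_eq_add_of_le hp
  have e1 : i - 2 ^ Nat.log 2 (i / 2) * 2 = 2 * d + i % 2 := by omega
  have e2 : i / 2 - 2 ^ Nat.log 2 (i / 2) = d := by omega
  rw [e1, e2]
  ring

theorem log_two_mul_half (h : 2 ≤ i) : Nat.log 2 (2 * (i / 2)) = Nat.log 2 i := by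
  rw [log_half h, log_half (by omega)]
  congr 2
  omega

/-- A node and its left child have the same first position; the child, of half the width, shows one
more binary digit of the count. -/
theorem nodeCnt_half (h : 2 ≤ i) (hi : i < 2 ^ (H + 1)) :
    nodeCnt H f (i / 2) = nodeCnt H f (2 * (i / 2)) / 2 := by
  have hl := log_le hi
  rw [nodeCnt, nodeCnt, nodePos_eq (i := 2 * (i / 2)) (by omega) (by omega), log_two_mul_half h]
  have e1 : 2 * (i / 2) / 2 = i / 2 := by omega
  have e2 : 2 * (i / 2) % 2 = 0 := by omega
  rw [e1, e2, zero_mul, add_zero, Nat.div_div_eq_div_mul, ← pow_succ]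
  congr 2
  rw [log_half h] at *
  omega

theorem nodeCnt_two_mul (h0 : 1 ≤ i) (hi : 2 * i < 2 ^ (H + 1)) :
    nodeCnt H f i = nodeCnt H f (2 * i) / 2 := by
  have := nodeCnt_half f (i := 2 * i) (by omega) hi
  rwa [show 2 * i / 2 = i by omega] at this

/-- As `f` grows by at most one per position, it grows over a node by at most the width of the node.
So the quotients of two siblings differ by at most one, and their parities tell whether they differ.
-/
theorem nodeCnt_bounds (hm : Monotone f) (hf : ∀ p n, f (p + n) ≤ f p + n) (h : 2 ≤ i)
    (hi : i < 2 ^ (H + 1)) : nodeCnt H f (2 * (i / 2)) ≤ nodeCnt H f i ∧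
      nodeCnt H f i ≤ nodeCnt H f (2 * (i / 2)) + i % 2 := by
  rw [nodeCnt, nodeCnt, nodePos_eq (i := 2 * (i / 2)) (by omega) (by omega), log_two_mul_half h,
    nodePos_eq h hi]
  have e1 : 2 * (i / 2) / 2 = i / 2 := by omega
  have e2 : 2 * (i / 2) % 2 = 0 := by omega
  rw [e1, e2, zero_mul, add_zero]
  refine ⟨Nat.div_le_div_right (hm (by omega)), ?_⟩
  rw [← Nat.add_mul_div_right _ _ (by positivity)]
  exact Nat.div_le_div_right (hf _ _)

theorem nodeCnt_one (h0 : f 0 = 0) : nodeCnt H f 1 = 0 := by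
  simp [nodeCnt, nodePos, h0]

theorem nodeCnt_leaf {p : ℕ} (h : p < 2 ^ H) : nodeCnt H f (2 ^ H + p) = f p := by
  rw [nodeCnt, nodePos, log_leaf h]
  simp

end heap

/-- The comparison of a count with a threshold at a node, from those at its parent. -/
def compareStep (c : ℕ) (a b d : Bool) (e k : ℕ) : Bool :=
  d || (b && decide (k + c ≤ e + 1)) || (a && decide (k + c + 1 ≤ e))

/-- From a node to its child the count becomes `2 * n + e` and the threshold `2 * κ + k`. For
offsets `c ≤ 2` the child's comparison depends only on whether `κ - n` is at most `1`, `0` or `-1`,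
and these are the comparisons of the parent with offsets `0`, `1`, `2`. So three bits per node pass
all the information down. -/
theorem compareStep_eq (c n κ e k : ℕ) (hc : c ≤ 2) (hk : k ≤ 1) (he : e ≤ 2) :
    decide (2 * κ + k + c ≤ 2 * n + e + 1) =
      compareStep c (decide (κ ≤ n + 1)) (decide (κ + 1 ≤ n + 1)) (decide (κ + 2 ≤ n + 1)) e k := by
  unfold compareStep
  rw [Bool.eq_iff_iff]
  simp only [Bool.or_eq_true, Bool.and_eq_true, decide_eq_true_eq]
  omega

/-- The registers of the comparisons. -/
def cmpReg : ℕ → Reg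
  | 0 => .qa
  | 1 => .qb
  | _ => .qc

/-- The bit that is stored at a node of the tree for the counting function `f`. -/
def nodeBit (H : ℕ) (f : ℕ → ℕ) (i : ℕ) : Bool := decide (nodeCnt H f i % 2 = 1)

/-- The comparison with offset `c` of the count at a node with the threshold `K`. -/
def cmpVal (H K : ℕ) (f : ℕ → ℕ) (c i : ℕ) : Bool :=
  decide (1 ≤ i ∧ i < 2 ^ (H + 1)) &&
    decide (K / 2 ^ (H - Nat.log 2 i) + c ≤ nodeCnt H f i + 1)

/-- The comparisons run from the root to the leaves. The threshold is fixed in advance, so its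
digits are constants of the circuit. At a leaf the comparison with offset `1` says that `K ≤ f p`.
-/
theorem exists_compare_network (F h H K : ℕ) (hK : K < 2 ^ H) :
    ∃ C : RevCircuit Wire, C.Bounded (wires F h H) (3 * 2 ^ (H + 1)) (6 * (H + 1)) ∧
      ∀ (f : ℕ → ℕ) (x : Wire → Bool), Monotone f → (∀ p n, f (p + n) ≤ f p + n) → f 0 = 0 →
        (∀ i < 2 ^ (H + 1), x (.reg .beta i) = nodeBit H f i) →
        (∀ i, x (.reg .qa i) = false) → (∀ i, x (.reg .qb i) = false) →
        (∀ i, x (.reg .qc i) = false) →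
        C.act x = addReg .qa (cmpVal H K f 0) (addReg .qb (cmpVal H K f 1)
          (addReg .qc (cmpVal H K f 2) x)) := by
  refine (RevCircuit.exists_network_of (wires F h H)
    (Finset.Ico 1 (2 ^ (H + 1)) ×ˢ Finset.range 3) (fun t => Wire.reg (cmpReg t.2) t.1)
    (fun t => if t.1 = 1 then [] else [.reg .qa (t.1 / 2), .reg .qb (t.1 / 2), .reg .qc (t.1 / 2),
      .reg .beta (2 * (t.1 / 2)), .reg .beta t.1])
    (fun t x => if t.1 = 1 then decide (t.2 ≤ 1) else
      compareStep t.2 (x (.reg .qa (t.1 / 2))) (x (.reg .qb (t.1 / 2))) (x (.reg .qc (t.1 / 2)))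
        ((x (.reg .beta (2 * (t.1 / 2)))).toNat +
          if t.1 % 2 = 1 then (x (.reg .beta (2 * (t.1 / 2))) ^^ x (.reg .beta t.1)).toNat else 0)
        (K / 2 ^ (H - Nat.log 2 t.1) % 2))
    -- Six steps per level: two siblings with three offsets each read the same bits of the parent
    -- and of the left child, and must take turns.
    (fun t => 6 * Nat.log 2 t.1 + 3 * (t.1 % 2) + t.2) (6 * (H + 1)) ?_ ?_ ?_ ?_ ?_ ?_ ?_).elim ?_
  pick_goal 8
  · rintro C ⟨hC, hact⟩
    refine ⟨C, hC.mono (by simp; omega) le_rfl, fun f x hm hf h0 hβ ha hb hc => ?_⟩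
    refine hact x _ ?_ ?_
    · intro w hw
      cases w with
      | low s i => rfl
      | reg r i =>
        by_cases hi : 1 ≤ i ∧ i < 2 ^ (H + 1)
        · have hw' : ∀ c < 3, r ≠ cmpReg c := by
            rintro c hc rfl
            exact hw (i, c) (by simp [hi, hc]) rfl
          have h1 := hw' 0 (by norm_num)
          have h2 := hw' 1 (by norm_num)
          have h3 := hw' 2 (by norm_num)
          simp only [cmpReg] at h1 h2 h3
          simp [h1, h2, h3]
        · have hv : ∀ c, cmpVal H K f c i = false := by
            intro c
            simp [cmpVal, decide_eq_false hi]
          simp [addReg, hv]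
    · rintro ⟨i, c⟩ hic
      simp only [Finset.mem_product, Finset.mem_Ico, Finset.mem_range] at hic
      obtain ⟨⟨hi1, hi⟩, hc3⟩ := hic
      have hl := log_le hi
      set y := addReg .qa (cmpVal H K f 0) (addReg .qb (cmpVal H K f 1)
          (addReg .qc (cmpVal H K f 2) x)) with hy
      have ya : ∀ i, y (.reg .qa i) = cmpVal H K f 0 i := by simp [hy, ha]
      have yb : ∀ i, y (.reg .qb i) = cmpVal H K f 1 i := by simp [hy, hb]
      have yc : ∀ i, y (.reg .qc i) = cmpVal H K f 2 i := by simp [hy, hc]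
      have yβ : ∀ i < 2 ^ (H + 1), y (.reg .beta i) = nodeBit H f i := by
        intro i hi
        simp [hy, hβ i hi]
      have lhs : y (.reg (cmpReg c) i) = cmpVal H K f c i := by
        interval_cases c
        · exact ya i
        · exact yb i
        · exact yc i
      have xz : x (.reg (cmpReg c) i) = false := by
        interval_cases c
        · exact ha i
        · exact hb i
        · exact hc i
      simp only [lhs, xz, Bool.false_xor]
      by_cases hi0 : i = 1
      · subst hi0
        simp only [cmpVal, if_true, nodeCnt_one f h0, Nat.log_one_right, Nat.sub_zero,
          Nat.div_eq_of_lt hK, hi, le_refl, and_self, decide_true, Bool.true_and]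
        congr 1
        rw [eq_iff_iff]
        omega
      · have hi2 : 2 ≤ i := by omega
        have hpar : 1 ≤ i / 2 ∧ i / 2 < 2 ^ (H + 1) := by omega
        rw [if_neg hi0, ya, yb, yc, yβ i hi, yβ _ (by omega)]
        simp only [cmpVal, decide_eq_true hpar, decide_eq_true (show 1 ≤ i ∧ i < 2 ^ (H + 1) from ⟨hi1, hi⟩),
          Bool.true_and, Nat.add_zero]
        have hb := nodeCnt_bounds f hm hf hi2 hi
        have hh := nodeCnt_half f hi2 hi
        have hκ : K / 2 ^ (H - Nat.log 2 (i / 2)) = K / 2 ^ (H - Nat.log 2 i) / 2 := by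
          rw [Nat.div_div_eq_div_mul, ← pow_succ]
          congr 2
          rw [log_half hi2] at *
          omega
        rw [hκ]
        rw [← compareStep_eq c _ _ _ _ (by omega) (by omega)]
        · congr 1
          rw [eq_iff_iff]
          have hκ2 := Nat.div_add_mod (K / 2 ^ (H - Nat.log 2 i)) 2
          rw [hκ2]
          have key : nodeCnt H f i = 2 * nodeCnt H f (i / 2) + ((nodeBit H f (2 * (i / 2))).toNat +
              if i % 2 = 1 then (nodeBit H f (2 * (i / 2)) ^^ nodeBit H f i).toNat else 0) := by
            rw [hh]
            unfold nodeBit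
            obtain ⟨hb1, hb2⟩ := hb
            generalize nodeCnt H f (2 * (i / 2)) = u at *
            generalize nodeCnt H f i = w at *
            rcases Nat.mod_two_eq_zero_or_one i with h2 | h2 <;>
            rcases Nat.mod_two_eq_zero_or_one u with hu | hu <;>
            rcases Nat.mod_two_eq_zero_or_one w with hw | hw <;>
              simp [h2, hu, hw] <;> omega
          rw [key]
        · cases nodeBit H f (2 * (i / 2)) <;> cases nodeBit H f i <;> split_ifs <;> simp
  · rintro ⟨i, c⟩ hic
    simp only [Finset.mem_product, Finset.mem_Ico, Finset.mem_range] at hic ⊢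
    have := log_le hic.1.2
    omega
  · rintro ⟨i, c⟩ _
    dsimp only
    split_ifs <;> simp
  · rintro ⟨i, c⟩ _ x y hxy
    dsimp only at hxy ⊢
    split_ifs at hxy ⊢ with hi
    · rfl
    · simp only [List.forall_mem_cons] at hxy
      obtain ⟨h1, h2, h3, h4, h5, -⟩ := hxy
      simp only [h1, h2, h3, h4, h5]
    · simp only [List.forall_mem_cons] at hxy
      obtain ⟨h1, h2, h3, h4, h5, -⟩ := hxy
      simp only [h1, h2, h3, h4]
  · rintro ⟨i, c⟩ hic ⟨i', c'⟩ hic' e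
    simp only [Finset.mem_product, Finset.mem_Ico, Finset.mem_range] at hic hic'
    obtain ⟨e1, rfl⟩ := Wire.reg.inj e
    obtain ⟨-, hc⟩ := hic
    obtain ⟨-, hc'⟩ := hic'
    congr 1
    dsimp only at *
    interval_cases c <;> interval_cases c' <;> simp [cmpReg] at e1 ⊢
  · rintro ⟨i, c⟩ hic ⟨i', c'⟩ hic' e
    simp only [Finset.mem_product, Finset.mem_Ico, Finset.mem_range] at hic hic'
    dsimp only at e ⊢
    split_ifs at e with hi
    · simp at e
    · have : i' = i / 2 := by
        obtain ⟨-, hc'⟩ := hic'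
        simp only [List.mem_cons, Wire.reg.injEq, List.not_mem_nil, or_false] at e
        interval_cases c' <;> simp [cmpReg] at e <;> exact e
      rw [log_half (show 2 ≤ i by omega), this]
      omega
  · rintro ⟨i, c⟩ hic ⟨i', c'⟩ hic' hτ w hw hw'
    simp only [Finset.mem_product, Finset.mem_Ico, Finset.mem_range] at hic hic'
    dsimp only at hτ hw hw'
    split_ifs at hw hw' with hi hi'
    · simp at hw
    · simp at hw
    · simp at hw'
    · have : i / 2 = i' / 2 := by
        simp only [List.mem_cons, List.not_mem_nil, or_false] at hw hw'
        rcases hw with rfl | rfl | rfl | rfl | rfl <;> simp at hw' <;> omega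
      have h1 : i % 2 = i' % 2 ∧ c = c' := by omega
      rw [Prod.mk.injEq]
      omega
  · rintro ⟨i, c⟩ hic
    simp only [Finset.mem_product, Finset.mem_Ico, Finset.mem_range] at hic
    refine ⟨hic.1.2, ?_⟩
    dsimp only
    split_ifs
    · simp
    · simp only [List.forall_mem_cons, reg_mem_wires]
      refine ⟨by omega, by omega, by omega, by omega, by omega, by simp⟩

end FermionEncoding
-- Counts, offset comparisons and sums over the tree
namespace FermionEncoding

/-- Compute, act, uncompute: the inverse of `C` reaches the desired state `w` as soon as `C` leads
from `w` to the state after `D`. -/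
theorem RevCircuit.act_conj {W : Type*} (C D : RevCircuit W) {x y z w : W → Bool}
    (h1 : C.act x = y) (h2 : D.act y = z) (h3 : C.act w = z) :
    ((C.seq D).seq C.inv).act x = w := by
  rw [RevCircuit.act_seq, RevCircuit.act_seq, h1, h2, ← h3, RevCircuit.act_inv_act]

/-- By `le_delims_iff` the answer for slot `s` is the comparison with threshold `K` at the leaf `s +
K`. The slots read different leaves, so all answers are copied in one layer before the comparisons
are undone. -/
theorem exists_count_query (F h H K : ℕ) (hK : K ≤ F) (hF : 1 ≤ F) (hH : 4 * F ≤ 2 ^ H) (out : Reg)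
    (ha : out ≠ .qa) (hb : out ≠ .qb) (hc : out ≠ .qc) (hβ : out ≠ .beta) :
    ∃ C : RevCircuit Wire, C.Bounded (wires F h H) (6 * 2 ^ (H + 1) + F) (12 * (H + 1) + 1) ∧
      ∀ (M : ℕ) (b : Fin M → Bool) (x : Wire → Bool),
        (∀ i < 2 ^ (H + 1), x (.reg .beta i) = nodeBit H (delims b F (2 * h)) i) →
        (∀ i, x (.reg .qa i) = false) → (∀ i, x (.reg .qb i) = false) →
        (∀ i, x (.reg .qc i) = false) →
        C.act x = addReg out
          (fun s => decide (s < F) && decide (numOnes b (K * 2 ^ (2 * h)) ≤ s)) x := by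
  obtain ⟨C, hC, cact⟩ := exists_compare_network F h H K (by omega)
  obtain ⟨D, hD, dact⟩ := exists_reg_layer (wires F h H) out (Finset.range F)
    (fun s => [.reg .qb (2 ^ H + (s + K))]) (fun s x => x (.reg .qb (2 ^ H + (s + K))))
    (fun _ => 0) 1 (by simp) (by simp)
    (by
      intro s _ x y hxy
      exact hxy _ (by simp))
    (by simp [hb])
    (by simp)
    (by
      intro s hs
      rw [Finset.mem_range] at hs
      simp only [List.mem_singleton, forall_eq, reg_mem_wires, pow_succ]
      omega)
  refine ⟨(C.seq D).seq C.inv, ((hC.seq hD).seq hC.inv).mono (by simp; omega) (by omega), ?_⟩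
  intro M b x xβ xa xb xc
  have spec := fun x => cact (delims b F (2 * h)) x (delims_mono b F _) (delims_add_le b F _)
    (delims_zero b F _)
  refine RevCircuit.act_conj C D (spec x xβ xa xb xc) (dact _) ?_
  rw [spec _ (by simpa [hβ.symm] using xβ) (by simpa [ha.symm] using xa)
    (by simpa [hb.symm] using xb) (by simpa [hc.symm] using xc),
    addReg_comm ha.symm, addReg_comm hb.symm, addReg_comm hc.symm]
  congr 4
  funext s
  by_cases hs : s < F
  · have h1 : s + K < 2 ^ H := by omega
    have h2 : 1 ≤ 2 ^ H + (s + K) ∧ 2 ^ H + (s + K) < 2 ^ (H + 1) := by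
      rw [pow_succ]
      omega
    simp only [hs, decide_true, Bool.true_and, Finset.mem_range, addReg_same,
      addReg_of_ne (show Reg.qb ≠ Reg.qa by decide), addReg_of_ne (show Reg.qb ≠ Reg.qc by decide),
      xb, Bool.false_xor, cmpVal, decide_eq_true h2, nodeCnt_leaf _ h1, log_leaf h1, Nat.sub_self,
      pow_zero, Nat.div_one]
    simp only [← le_delims_iff b F (2 * h) hK, Nat.add_le_add_iff_right]
  · simp [hs]

/-- The result of a chain of affine maps that depend on the bits `z`. -/
def chainVal (u v : ℕ → Bool → Bool) (z : ℕ → Bool) : ℕ → Bool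
  | 0 => false
  | i + 1 => (u i (z i) && chainVal u v z i) ^^ v i (z i)

theorem ladderVal_eq_chainVal {W : Type*} (u v : ℕ → Bool → Bool) (X : ℕ → ℕ → W) (a : ℕ → W)
    (x : W → Bool) (s : ℕ) (z : ℕ → Bool) (k m : ℕ) (h0 : x (a s) = chainVal u v z k)
    (h : ∀ i < m, x (X i s) = z (k + i)) :
    ladderVal (fun i => u (k + i)) (fun i => v (k + i)) X a x s m = chainVal u v z (k + m) := by
  induction m with
  | zero => exact h0
  | succ m ih =>
    rw [ladderVal, ih fun i hi => h i (by omega), h m (by omega), ← Nat.add_assoc, chainVal]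

/-- A chain of affine maps on the bits of the slots is evaluated for all slots, each half of the
bits of a slot serving as borrowed wires for the other half. -/
theorem exists_slot_chain (F h H : ℕ) (hh : 1 ≤ h) (hF : F ≤ 2 ^ H) (u v : ℕ → Bool → Bool)
    (mid out : Reg) (hm : mid ≠ .zero) (ho : out ≠ mid) (hz : out ≠ .zero) :
    ∃ C : RevCircuit Wire, C.Bounded (wires F h H) (8 * h * F) (8 * h) ∧
      ∀ (z : ℕ → ℕ → Bool) (x : Wire → Bool), (∀ s < F, ∀ i < 2 * h, x (.low s i) = z s i) →
        (∀ i, x (.reg .zero i) = false) → (∀ i, x (.reg mid i) = false) →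
        C.act x = addReg out (fun s => decide (s < F) && chainVal u v (z s) (2 * h))
          (addReg mid (fun s => decide (s < F) && chainVal u v (z s) h) x) := by
  have hFN : ∀ s < F, s < 2 ^ (H + 1) := by
    intro s hs
    rw [pow_succ]
    omega
  -- The chain over the lower half borrows the bits of the upper half for its intermediate values,
  -- and vice versa below. Only the start, the value after `h` steps and the result have clean
  -- wires, which is a constant number per slot.
  obtain ⟨C, hC, cact⟩ := exists_ladder (wires F h H) F h (fun i => u (0 + i)) (fun i => v (0 + i))
    (fun i s => .low s i)
    (fun i s => if i = 0 then .reg .zero s else if i < h then .low s (h + i) else .reg mid s) hh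
    (by
      intro i hi i' hi' s hs s' hs' e
      split_ifs at e <;> simp [hm, hm.symm] at e <;> omega)
    (by
      intro i hi i' hi' s hs s' hs' e
      split_ifs at e
      simp at e
      omega)
    (by simp)
    (by
      intro i hi s hs
      split_ifs
      · exact hFN s hs
      · rw [low_mem_wires]
        omega
      · exact hFN s hs)
    (by
      intro i hi s hs
      rw [low_mem_wires]
      omega)
  obtain ⟨D, hD, dact⟩ := exists_ladder (wires F h H) F h (fun i => u (h + i)) (fun i => v (h + i))
    (fun i s => .low s (h + i))
    (fun i s => if i = 0 then .reg mid s else if i < h then .low s i else .reg out s) hh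
    (by
      intro i hi i' hi' s hs s' hs' e
      split_ifs at e <;> simp [ho, ho.symm] at e <;> omega)
    (by
      intro i hi i' hi' s hs s' hs' e
      split_ifs at e
      simp at e
      omega)
    (by simp)
    (by
      intro i hi s hs
      split_ifs
      · exact hFN s hs
      · rw [low_mem_wires]
        omega
      · exact hFN s hs)
    (by
      intro i hi s hs
      rw [low_mem_wires]
      omega)
  refine ⟨C.seq D, (hC.seq hD).mono (by nlinarith) (by omega), fun z x xl xz xm => ?_⟩
  have h0 : h ≠ 0 := by omega
  simp only [h0, lt_irrefl, if_false] at cact dact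
  have e1 : C.act x = addReg mid (fun s => decide (s < F) && chainVal u v (z s) h) x := by
    funext w
    by_cases hw : ∃ s < F, w = .reg mid s
    · obtain ⟨s, hs, rfl⟩ := hw
      rw [(cact x).2 s hs, ladderVal_eq_chainVal u v _ _ x s (z s) 0 h]
      · simp [hs]
      · simp [xz, chainVal]
      · intro i hi
        simpa using xl s hs i (by omega)
    · rw [(cact x).1 w fun s hs e => hw ⟨s, hs, e⟩]
      cases w with
      | low s i => rfl
      | reg q i =>
        by_cases hq : q = mid
        · subst hq
          have : ¬ i < F := fun hi => hw ⟨i, hi, rfl⟩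
          simp [this]
        · simp [hq]
  rw [RevCircuit.act_seq, e1]
  set y := addReg mid (fun s => decide (s < F) && chainVal u v (z s) h) x with hy
  funext w
  by_cases hw : ∃ s < F, w = .reg out s
  · obtain ⟨s, hs, rfl⟩ := hw
    rw [(dact y).2 s hs, ladderVal_eq_chainVal u v _ _ y s (z s) h h]
    · simp [hs, two_mul]
    · simp [hy, xm, hs]
    · intro i hi
      simpa [hy] using xl s hs (h + i) (by omega)
  · rw [(dact y).1 w fun s hs e => hw ⟨s, hs, e⟩]
    cases w with
    | low s i => rfl
    | reg q i =>
      by_cases hq : q = out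
      · subst hq
        have : ¬ i < F := fun hi => hw ⟨i, hi, rfl⟩
        simp [this]
      · simp [hq]

theorem mod_two_pow_succ' (z i : ℕ) :
    z % 2 ^ (i + 1) = z % 2 ^ i + 2 ^ i * (z.testBit i).toNat := by
  rw [Nat.mod_pow_succ, Nat.testBit_eq_decide_div_mod_eq]
  rcases Nat.mod_two_eq_zero_or_one (z / 2 ^ i) with h | h <;> simp [h]

/-- Digits are scanned from the lowest: equal digits keep the result so far, and different digits
replace it by whether the digit of `j` is the larger one. Each step is affine in the previous
result. -/
theorem chainVal_lt (z j m : ℕ) :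
    chainVal (fun i c => !(c ^^ j.testBit i)) (fun i c => j.testBit i && !c) z.testBit m =
      decide (z % 2 ^ m < j % 2 ^ m) := by
  induction m with
  | zero => simp [chainVal, Nat.mod_one]
  | succ m ih =>
    have h1 := Nat.mod_lt z (show 0 < 2 ^ m by positivity)
    have h2 := Nat.mod_lt j (show 0 < 2 ^ m by positivity)
    rw [chainVal, ih, mod_two_pow_succ', mod_two_pow_succ']
    cases z.testBit m <;> cases j.testBit m <;> simp <;> omega

theorem chainVal_ne (z j m : ℕ) :
    chainVal (fun i c => !(c ^^ j.testBit i)) (fun i c => c ^^ j.testBit i) z.testBit m =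
      decide (z % 2 ^ m ≠ j % 2 ^ m) := by
  induction m with
  | zero => simp [chainVal, Nat.mod_one]
  | succ m ih =>
    have h1 := Nat.mod_lt z (show 0 < 2 ^ m by positivity)
    have h2 := Nat.mod_lt j (show 0 < 2 ^ m by positivity)
    rw [chainVal, ih, mod_two_pow_succ', mod_two_pow_succ']
    cases z.testBit m <;> cases j.testBit m <;> simp <;> omega

/-- The network that adds up a register over a binary tree, for a register with at most one
nonzero bit. -/
theorem exists_tree_network (F h H : ℕ) (hF : F ≤ 2 ^ H) :
    ∃ C : RevCircuit Wire, C.Bounded (wires F h H) (2 ^ (H + 1)) (H + 1) ∧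
      ∀ (r : ℕ) (p : Bool) (x : Wire → Bool), (p = true → r < F) →
        (∀ s < F, x (.reg .ee s) = (decide (s = r) && p)) → (∀ i, x (.reg .tree i) = false) →
        C.act x = addReg .tree (fun i => decide (1 ≤ i ∧ i < 2 ^ (H + 1)) &&
          (p && decide ((2 ^ H + r) / 2 ^ (H - Nat.log 2 i) = i))) x := by
  refine (exists_reg_network (wires F h H) .tree (Finset.Ico 1 (2 ^ (H + 1)))
    (fun i => if i < 2 ^ H then [.reg .tree (2 * i), .reg .tree (2 * i + 1)] else
      if i - 2 ^ H < F then [.reg .ee (i - 2 ^ H)] else [])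
    (fun i x => if i < 2 ^ H then x (.reg .tree (2 * i)) ^^ x (.reg .tree (2 * i + 1)) else
      if i - 2 ^ H < F then x (.reg .ee (i - 2 ^ H)) else false)
    (fun i => H - Nat.log 2 i) (H + 1) ?_ ?_ ?_ ?_ ?_ ?_).elim ?_
  pick_goal 7
  · rintro C ⟨hC, hact⟩
    refine ⟨C, hC.mono (by simp) le_rfl, fun r p x hr xe xt => hact x _ ?_ ?_⟩
    · intro i hi
      rw [Finset.mem_Ico] at hi
      rw [decide_eq_false hi, Bool.false_and]
    · intro i hi
      rw [Finset.mem_Ico] at hi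
      simp only [addReg_same, xt, Bool.false_xor, addReg_of_ne (show Reg.ee ≠ Reg.tree by decide)]
      rw [decide_eq_true hi, Bool.true_and]
      split_ifs with h1 h2
      · have i2 : 1 ≤ 2 * i ∧ 2 * i < 2 ^ (H + 1) := by rw [pow_succ]; omega
        have i3 : 1 ≤ 2 * i + 1 ∧ 2 * i + 1 < 2 ^ (H + 1) := by rw [pow_succ]; omega
        rw [decide_eq_true i2, decide_eq_true i3, Bool.true_and, Bool.true_and]
        have l2 : Nat.log 2 (2 * i) = Nat.log 2 i + 1 := by
          rw [log_half (by omega)]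
          congr 2
          omega
        have l3 : Nat.log 2 (2 * i + 1) = Nat.log 2 i + 1 := by
          rw [log_half (by omega)]
          congr 2
          omega
        have ll := log_le i2.2
        rw [l2] at ll
        rw [l2, l3]
        have e : H - Nat.log 2 i = H - (Nat.log 2 i + 1) + 1 := by omega
        rw [e, pow_succ, ← Nat.div_div_eq_div_mul]
        generalize (2 ^ H + r) / 2 ^ (H - (Nat.log 2 i + 1)) = q
        cases p
        · simp
        · simp only [Bool.true_and]
          rcases eq_or_ne q (2 * i) with rfl | hq
          · simp
          · rcases eq_or_ne q (2 * i + 1) with rfl | hq'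
            · simp
              omega
            · simp [hq, hq']
              omega
      · have hl : Nat.log 2 i = H := by
          have := log_leaf (H := H) (p := i - 2 ^ H) (by rw [pow_succ] at hi; omega)
          rwa [Nat.add_sub_cancel' (by omega)] at this
        rw [hl, xe _ h2, Nat.sub_self, pow_zero, Nat.div_one, Bool.and_comm]
        congr 1
        rw [decide_eq_decide]
        omega
      · have hl : Nat.log 2 i = H := by
          have := log_leaf (H := H) (p := i - 2 ^ H) (by rw [pow_succ] at hi; omega)
          rwa [Nat.add_sub_cancel' (by omega)] at this
        rw [hl, Nat.sub_self, pow_zero, Nat.div_one]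
        cases p
        · simp
        · have := hr rfl
          simp
          omega
  · intro i _
    omega
  · intro i _
    split_ifs <;> simp
  · intro i _ x y hxy
    split_ifs at hxy ⊢ with h1 h2
    · rw [hxy (.reg .tree (2 * i)) (by simp), hxy (.reg .tree (2 * i + 1)) (by simp)]
    · exact hxy _ (by simp)
    · rfl
  · intro i hi k hk e
    rw [Finset.mem_Ico] at hi hk
    split_ifs at e with h1 h2
    · have hk2 : k / 2 = i := by
        simp only [List.mem_cons, Wire.reg.injEq, true_and, List.not_mem_nil, or_false] at e
        omega
      have l := log_half (i := k) (by omega)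
      have := log_le hk.2
      rw [hk2] at l
      omega
    · simp at e
    · simp at e
  · intro i hi k hk _ w hw hw'
    split_ifs at hw hw' <;>
      simp only [List.mem_cons, List.not_mem_nil, or_false] at hw hw'
    · rcases hw with rfl | rfl <;> simp at hw' <;> omega
    · rcases hw with rfl | rfl <;> simp at hw'
    · subst hw
      simp at hw'
    · subst hw
      simp at hw'
      omega
  · intro i hi
    rw [Finset.mem_Ico] at hi
    refine ⟨hi.2, ?_⟩
    split_ifs with h1 h2
    · simp only [List.forall_mem_cons, reg_mem_wires, pow_succ]
      exact ⟨by omega, by omega, by simp⟩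
    · simp only [List.forall_mem_cons, reg_mem_wires]
      exact ⟨by omega, by simp⟩
    · simp

end FermionEncoding
-- The rank query
namespace FermionEncoding

/-- The state `x` holds the string `b`: the offsets of its ones are in the slots and the tree of
delimiter counts is in the register `beta`. -/
structure Holds (F h H : ℕ) {M : ℕ} (b : Fin M → Bool) (x : Wire → Bool) : Prop where
  low : ∀ s < F, ∀ i < 2 * h, x (.low s i) = (slot b s).testBit i
  beta : ∀ i < 2 ^ (H + 1), x (.reg .beta i) = nodeBit H (delims b F (2 * h)) i

theorem Holds.addReg {F h H M : ℕ} {b : Fin M → Bool} {x : Wire → Bool} (hx : Holds F h H b x)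
    {r : Reg} (hr : r ≠ .beta) (f : ℕ → Bool) : Holds F h H b (addReg r f x) :=
  ⟨fun s hs i hi => hx.low s hs i hi, fun i hi => by
    rw [addReg_of_ne hr.symm, hx.beta i hi]⟩

/-- The state after the computation of all the comparisons of a string with the index `j`. -/
noncomputable def compared (F h H : ℕ) {M : ℕ} (j : Fin M) (b : Fin M → Bool) (x : Wire → Bool) : Wire → Bool :=
  addReg .tree (fun i => decide (1 ≤ i ∧ i < 2 ^ (H + 1)) &&
      (b j && decide ((2 ^ H + numOnes b j) / 2 ^ (H - Nat.log 2 i) = i))) <|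
  addReg .ee (fun s => decide (s < F) && (decide (s = numOnes b j) && b j)) <|
  addReg .fb (fun s => decide (s < F) &&
      decide (numOnes b ((j.1 / 2 ^ (2 * h) + 1) * 2 ^ (2 * h)) ≤ s)) <|
  addReg .fa (fun s => decide (s < F) && decide (numOnes b (j.1 / 2 ^ (2 * h) * 2 ^ (2 * h)) ≤ s)) <|
  addReg .ne (fun s => decide (s < F) &&
      decide (slot b s % 2 ^ (2 * h) ≠ j.1 % 2 ^ (2 * h))) <|
  addReg .neMid (fun s => decide (s < F) && decide (slot b s % 2 ^ h ≠ j.1 % 2 ^ h)) <|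
  addReg .lt (fun s => decide (s < F) &&
      decide (slot b s % 2 ^ (2 * h) < j.1 % 2 ^ (2 * h))) <|
  addReg .ltMid (fun s => decide (s < F) && decide (slot b s % 2 ^ h < j.1 % 2 ^ h)) x

section query

variable (F h H : ℕ) {M : ℕ} (j : Fin M)

/-- The flag `fa` without `fb` marks the slots of the block of `j`. Among them, equality of the
offsets marks in `ee` the slot of the one at `j`, if there is one (`eq_slot_iff_block`). Summing
`ee` over the tree therefore gives `b j` at the root. The intermediate registers stay filled and are
cleared by the inverse circuit once the answers are copied. -/
theorem exists_compared (hh : 1 ≤ h) (hF : 1 ≤ F) (hH : 4 * F ≤ 2 ^ H)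
    (hj : j.1 / 2 ^ (2 * h) < F) :
    ∃ C : RevCircuit Wire, C.Bounded (wires F h H) (16 * h * F + 13 * 2 ^ (H + 1) + 3 * F)
      (16 * h + 25 * (H + 1) + 3) ∧
      ∀ (b : Fin M → Bool) (x : Wire → Bool), hammingWeight b ≤ F → Holds F h H b x →
        (∀ r : Reg, r ≠ .beta → r ≠ .geq → r ≠ .pres → ∀ i, x (.reg r i) = false) →
        C.act x = compared F h H j b x := by
  have hFH : F ≤ 2 ^ H := by omega
  obtain ⟨C1, h1, a1⟩ := exists_slot_chain F h H hh hFH (fun i c => !(c ^^ j.1.testBit i))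
    (fun i c => j.1.testBit i && !c) .ltMid .lt (by decide) (by decide) (by decide)
  obtain ⟨C2, h2, a2⟩ := exists_slot_chain F h H hh hFH (fun i c => !(c ^^ j.1.testBit i))
    (fun i c => c ^^ j.1.testBit i) .neMid .ne (by decide) (by decide) (by decide)
  obtain ⟨C3, h3, a3⟩ := exists_count_query F h H (j.1 / 2 ^ (2 * h)) hj.le hF hH .fa
    (by decide) (by decide) (by decide) (by decide)
  obtain ⟨C4, h4, a4⟩ := exists_count_query F h H (j.1 / 2 ^ (2 * h) + 1) hj hF hH .fb
    (by decide) (by decide) (by decide) (by decide)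
  obtain ⟨C5, h5, a5⟩ := exists_reg_layer (wires F h H) .ee (Finset.range F)
    (fun s => [.reg .fa s, .reg .fb s, .reg .ne s])
    (fun s x => x (.reg .fa s) && !x (.reg .fb s) && !x (.reg .ne s))
    (fun _ => 0) 1 (by simp) (by simp)
    (by
      intro s _ x y hxy
      rw [hxy (.reg .fa s) (by simp), hxy (.reg .fb s) (by simp), hxy (.reg .ne s) (by simp)])
    (by simp) (by
      intro s _ s' _ _ w hw hw'
      simp only [List.mem_cons, List.not_mem_nil, or_false] at hw hw'
      rcases hw with rfl | rfl | rfl <;> simpa using hw')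
    (by
      intro s hs
      simp only [Finset.mem_range] at hs
      simp only [List.forall_mem_cons, reg_mem_wires, pow_succ, List.not_mem_nil, false_imp_iff,
        implies_true, and_true]
      omega)
  obtain ⟨C6, h6, a6⟩ := exists_tree_network F h H hFH
  refine ⟨((((C1.seq C2).seq C3).seq C4).seq C5).seq C6,
    (((((h1.seq h2).seq h3).seq h4).seq h5).seq h6).mono ?_ ?_, ?_⟩
  · rw [Finset.card_range]
    nlinarith
  · omega
  intro b x hb hx hc
  have low : ∀ s < F, ∀ i < 2 * h, x (.low s i) = (slot b s).testBit i := hx.low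
  simp only [RevCircuit.act_seq]
  rw [a1 (fun s => (slot b s).testBit) x low (hc .zero (by decide) (by decide) (by decide))
    (hc .ltMid (by decide) (by decide) (by decide))]
  rw [a2 (fun s => (slot b s).testBit) _ (by simpa using low)
    (by simpa using hc .zero (by decide) (by decide) (by decide))
    (by simpa using hc .neMid (by decide) (by decide) (by decide))]
  simp only [chainVal_lt, chainVal_ne]
  rw [a3 M b _ (by simpa using hx.beta) (by simpa using hc .qa (by decide) (by decide) (by decide))
    (by simpa using hc .qb (by decide) (by decide) (by decide))
    (by simpa using hc .qc (by decide) (by decide) (by decide))]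
  rw [a4 M b _ (by simpa using hx.beta) (by simpa using hc .qa (by decide) (by decide) (by decide))
    (by simpa using hc .qb (by decide) (by decide) (by decide))
    (by simpa using hc .qc (by decide) (by decide) (by decide)), a5]
  have he : ∀ s, (decide (s ∈ Finset.range F) && (decide (s < F) &&
      decide (numOnes b (j.1 / 2 ^ (2 * h) * 2 ^ (2 * h)) ≤ s) && !(decide (s < F) &&
      decide (numOnes b ((j.1 / 2 ^ (2 * h) + 1) * 2 ^ (2 * h)) ≤ s)) && !(decide (s < F) &&
      decide (slot b s % 2 ^ (2 * h) ≠ j.1 % 2 ^ (2 * h))))) =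
      (decide (s < F) && (decide (s = numOnes b j) && b j)) := by
    intro s
    by_cases hs : s < F
    · have := eq_slot_iff_block b (2 * h) j s
      rw [Bool.eq_iff_iff]
      simp only [Finset.mem_range, hs, decide_true, Bool.true_and, Bool.and_eq_true,
        decide_eq_true_eq, this]
      simp [and_assoc]
    · simp [hs]
  have e5 : ∀ y : Wire → Bool, (∀ s, y (.reg .fa s) = (decide (s < F) &&
      decide (numOnes b (j.1 / 2 ^ (2 * h) * 2 ^ (2 * h)) ≤ s))) →
      (∀ s, y (.reg .fb s) = (decide (s < F) &&
      decide (numOnes b ((j.1 / 2 ^ (2 * h) + 1) * 2 ^ (2 * h)) ≤ s))) →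
      (∀ s, y (.reg .ne s) = (decide (s < F) &&
      decide (slot b s % 2 ^ (2 * h) ≠ j.1 % 2 ^ (2 * h)))) →
      addReg .ee (fun s => decide (s ∈ Finset.range F) &&
        (y (.reg .fa s) && !y (.reg .fb s) && !y (.reg .ne s))) y =
      addReg .ee (fun s => decide (s < F) && (decide (s = numOnes b j) && b j)) y := by
    intro y ya yb yn
    simp only [ya, yb, yn, he]
  rw [e5 _ (by simp [hc .fa]) (by simp [hc .fb]) (by simp [hc .ne])]
  rw [a6 (numOnes b j) (b j)]
  · rfl
  · intro hbj
    have := numOnes_le b (j.1 + 1)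
    rw [numOnes_succ, occ_fin, hbj] at this
    simp at this
    omega
  · intro s hs
    simp [hc .ee, hs]
  · simp [hc .tree]

/-- The circuit that adds to the register `geq` the flags of the slots that are not before the
index `j`, and to `pres` the bit at `j`. -/
theorem exists_rank_query (hh : 1 ≤ h) (hF : 1 ≤ F) (hH : 4 * F ≤ 2 ^ H)
    (hj : j.1 / 2 ^ (2 * h) < F) :
    ∃ C : RevCircuit Wire, C.Bounded (wires F h H) (32 * h * F + 27 * 2 ^ (H + 1) + 6 * F + 1)
      (32 * h + 50 * (H + 1) + 8) ∧
      ∀ (b : Fin M → Bool) (x : Wire → Bool), hammingWeight b ≤ F → Holds F h H b x →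
        (∀ r : Reg, r ≠ .beta → r ≠ .geq → r ≠ .pres → ∀ i, x (.reg r i) = false) →
        C.act x = addReg .geq (fun i => decide (i < 2 ^ H) && decide (numOnes b j ≤ i))
          (addReg .pres (fun i => decide (i = 0) && b j) x) := by
  obtain ⟨C, hC, cact⟩ := exists_compared F h H j hh hF hH hj
  obtain ⟨D, hD, dact⟩ := exists_reg_layer (wires F h H) .geq (Finset.range (2 ^ H))
    (fun s => if s < F then [.reg .fa s, .reg .fb s, .reg .lt s] else [])
    -- From `F` on the flag is constantly true, as there are at most `F` ones. It is needed up to `2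
    -- ^ H` because the leaves of the tree read it during an update.
    (fun s x => if s < F then x (.reg .fb s) || (x (.reg .fa s) && !x (.reg .lt s)) else true)
    (fun _ => 0) 1 (by simp) (by intro s _; split_ifs <;> simp)
    (by
      intro s _ x y hxy
      split_ifs at hxy ⊢
      · rw [hxy (.reg .fa s) (by simp), hxy (.reg .fb s) (by simp), hxy (.reg .lt s) (by simp)]
      · rfl)
    (by intro s _ s' _; split_ifs <;> simp) (by
      intro s _ s' _ _ w hw hw'
      split_ifs at hw hw' <;> simp only [List.mem_cons, List.not_mem_nil, or_false] at hw hw'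
      rcases hw with rfl | rfl | rfl <;> simpa using hw')
    (by
      intro s hs
      simp only [Finset.mem_range] at hs
      refine ⟨by rw [reg_mem_wires, pow_succ]; omega, ?_⟩
      split_ifs
      · simp only [List.forall_mem_cons, reg_mem_wires, pow_succ, List.not_mem_nil, false_imp_iff,
          implies_true, and_true]
        omega
      · simp)
  obtain ⟨E, hE, eact⟩ := exists_reg_layer (wires F h H) .pres {0}
    (fun _ => [.reg .tree 1]) (fun _ x => x (.reg .tree 1))
    (fun _ => 0) 1 (by simp) (by simp)
    (by
      intro s _ x y hxy
      rw [hxy (.reg .tree 1) (by simp)])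
    (by simp) (by simp)
    (by
      intro s hs
      simp only [Finset.mem_singleton] at hs
      simp only [List.forall_mem_cons, reg_mem_wires, pow_succ, List.not_mem_nil, false_imp_iff,
        implies_true, and_true]
      omega)
  refine ⟨(C.seq (D.seq E)).seq C.inv, ((hC.seq (hD.seq hE)).seq hC.inv).mono ?_ ?_, ?_⟩
  · rw [Finset.card_range, Finset.card_singleton, pow_succ]
    nlinarith
  · omega
  intro b x hb hx hc
  refine RevCircuit.act_conj C (D.seq E) (cact b x hb hx hc) rfl ?_
  rw [cact b _ hb]
  · rw [RevCircuit.act_seq, dact, eact]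
    have e1 : ∀ i, (decide (i ∈ Finset.range (2 ^ H)) && if i < F then
        compared F h H j b x (.reg .fb i) || (compared F h H j b x (.reg .fa i) &&
          !compared F h H j b x (.reg .lt i)) else true) =
        (decide (i < 2 ^ H) && decide (numOnes b j ≤ i)) := by
      intro i
      simp only [Finset.mem_range]
      congr 1
      split_ifs with hi
      · have := numOnes_le_iff_block b (2 * h) j i
        rw [Bool.eq_iff_iff]
        simp [compared, hc, hi, this]
      · have := numOnes_le b j
        exact (decide_eq_true (by omega)).symm
    have e2 : ∀ g i, (decide (i ∈ ({0} : Finset ℕ)) &&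
        addReg .geq g (compared F h H j b x) (.reg .tree 1)) = (decide (i = 0) && b j) := by
      intro g i
      simp only [Finset.mem_singleton]
      congr 1
      have h1 : 1 < 2 ^ (H + 1) := Nat.one_lt_two_pow (by omega)
      cases hbj : b j
      · simp [compared, hc, hbj]
      · have hr := numOnes_le b (j.1 + 1)
        rw [numOnes_succ, occ_fin, hbj] at hr
        simp only [Bool.toNat_true] at hr
        have : (2 ^ H + numOnes b j) / 2 ^ H = 1 := by
          rw [Nat.div_eq_iff (by positivity)]
          omega
        simp [compared, hc, hbj, this, h1]
    simp only [e1, e2]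
    funext w
    cases w with
    | low s i => rfl
    | reg r i => cases r <;> simp [compared]
  · exact (hx.addReg (by decide) _).addReg (by decide) _
  · intro r h1 h2 h3 i
    rw [addReg_of_ne h2, addReg_of_ne h3, hc r h1 h2 h3]

end query

end FermionEncoding
-- Updating the offsets
namespace FermionEncoding

theorem numOnes_bitFlip_self {M : ℕ} (j : Fin M) (b : Fin M → Bool) :
    numOnes (bitFlip j b) j = numOnes b j := by
  cases hb : b j
  · simp [numOnes_bitFlip j b hb]
  · simp [numOnes_bitFlip' j b hb]

/-- The bit at `j` controls `O(F)` operations of an update, and operations at the same time may not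
share a wire. Copying it along a binary tree takes logarithmic depth, with the two children of a
node taking turns. -/
theorem exists_broadcast (F h H : ℕ) :
    ∃ C : RevCircuit Wire, C.Bounded (wires F h H) (2 ^ (H + 1)) (2 * (H + 1)) ∧
      ∀ x : Wire → Bool, (∀ i, x (.reg .bc i) = false) →
        C.act x = addReg .bc (fun i => decide (1 ≤ i ∧ i < 2 ^ (H + 1)) && x (.reg .pres 0)) x := by
  refine (exists_reg_network (wires F h H) .bc (Finset.Ico 1 (2 ^ (H + 1)))
    (fun i => if i = 1 then [.reg .pres 0] else [.reg .bc (i / 2)])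
    (fun i x => if i = 1 then x (.reg .pres 0) else x (.reg .bc (i / 2)))
    (fun i => 2 * Nat.log 2 i + i % 2) (2 * (H + 1)) ?_ ?_ ?_ ?_ ?_ ?_).elim ?_
  pick_goal 7
  · rintro C ⟨hC, hact⟩
    refine ⟨C, hC.mono (by simp) le_rfl, fun x hx => hact x _ ?_ ?_⟩
    · intro i hi
      rw [Finset.mem_Ico] at hi
      rw [decide_eq_false hi, Bool.false_and]
    · intro i hi
      rw [Finset.mem_Ico] at hi
      rw [decide_eq_true hi, Bool.true_and]
      split_ifs with h1
      · simp
      · have : 1 ≤ i / 2 ∧ i / 2 < 2 ^ (H + 1) := by omega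
        rw [addReg_same, hx, decide_eq_true this]
        simp
  · intro i hi
    rw [Finset.mem_Ico] at hi
    have := log_le hi.2
    omega
  · intro i _
    split_ifs <;> simp
  · intro i _ x y hxy
    split_ifs at hxy ⊢ <;> exact hxy _ (by simp)
  · intro i hi k hk e
    rw [Finset.mem_Ico] at hi hk
    split_ifs at e with h1
    · simp at e
    · simp only [List.mem_singleton, Wire.reg.injEq, true_and] at e
      rw [log_half (show 2 ≤ i by omega), e]
      omega
  · intro i hi k hk hτ w hw hw'
    rw [Finset.mem_Ico] at hi hk
    split_ifs at hw hw' with h1 h2 <;> simp only [List.mem_singleton] at hw hw'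
    · omega
    · simp [hw] at hw'
    · simp [hw] at hw'
    · rw [hw, Wire.reg.injEq] at hw'
      omega
  · intro i hi
    rw [Finset.mem_Ico] at hi
    refine ⟨hi.2, ?_⟩
    split_ifs
    · simp [reg_mem_wires]
    · simp only [List.mem_singleton, forall_eq, reg_mem_wires]
      omega

section offsets

variable (F h H : ℕ) {M : ℕ} (j : Fin M)

/-- The circuit that adds to the register `delta` the changes of the bits `i` of the offsets. -/
theorem exists_offset_change (hFH : F ≤ 2 ^ H) {i : ℕ} (hi : i < 2 * h) (neg : Bool) :
    ∃ C : RevCircuit Wire, C.Bounded (wires F h H) F 3 ∧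
      ∀ (b : Fin M → Bool) (x : Wire → Bool), hammingWeight b ≤ F →
        (∀ s < F, x (.low s i) = (slot b s).testBit i) →
        (∀ s < 2 ^ H, x (.reg .geq s) = decide (numOnes b j ≤ s)) →
        (∀ s < 2 ^ H, (x (.reg .bc (2 ^ H + s)) ^^ neg) = b j) →
        C.act x = addReg .delta (fun s => decide (s < F) &&
          ((slot b s).testBit i ^^ (slot (bitFlip j b) s).testBit i)) x := by
  refine (exists_reg_layer (wires F h H) .delta (Finset.range F)
    -- The minimum keeps the index in range. After a deletion the last slot has no successor and
    -- receives the default offset `0`, in accordance with `slot_eq_zero`.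
    (fun s => [.reg .geq s, .reg .geq (s - 1), .reg .bc (2 ^ H + s), .low s i, .low (s - 1) i,
      .low (min (s + 1) (F - 1)) i])
    (fun s x => x (.low s i) ^^ if x (.reg .geq s) = false then x (.low s i) else
      if (x (.reg .bc (2 ^ H + s)) ^^ neg) = true then
        decide (s + 1 < F) && x (.low (min (s + 1) (F - 1)) i) else
      if 1 ≤ s ∧ x (.reg .geq (s - 1)) = true then x (.low (s - 1) i) else j.1.testBit i)
    -- An operation reads wires of the neighbouring slots, hence three rounds.
    (fun s => s % 3) 3 ?_ ?_ ?_ ?_ ?_ ?_).elim ?_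
  pick_goal 7
  · rintro C ⟨hC, hact⟩
    refine ⟨C, hC.mono (by simp) le_rfl, fun b x hb hl hg hp => ?_⟩
    rw [hact]
    congr 1
    funext s
    by_cases hs : s < F
    swap
    · simp [hs]
    simp only [Finset.mem_range, hs, decide_true, Bool.true_and]
    rw [hl s hs, hg s (by omega), hp s (by omega), hg (s - 1) (by omega), hl (s - 1) (by omega),
      hl _ (by omega)]
    congr 1
    cases hbj : b j
    · rw [slot_bitFlip j b hbj]
      by_cases h1 : s < numOnes b j
      · rw [if_pos h1, if_pos (by simpa using h1)]
      · rw [if_neg h1, if_neg (by simpa using h1), if_neg (by simp)]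
        by_cases h2 : s = numOnes b j
        · rw [if_pos h2, if_neg (by simp; omega)]
        · rw [if_neg h2, if_pos (by simp; omega)]
    · rw [slot_bitFlip' j b hbj]
      by_cases h1 : s < numOnes b j
      · rw [if_pos h1, if_pos (by simpa using h1)]
      · rw [if_neg h1, if_neg (by simpa using h1), if_pos rfl]
        by_cases h2 : s + 1 < F
        · rw [min_eq_left (by omega)]
          simp [h2]
        · rw [slot_eq_zero b (show hammingWeight b ≤ s + 1 by omega)]
          simp [h2]
  · intro s _
    exact Nat.mod_lt _ (by norm_num)
  · simp
  · intro s _ x y hxy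
    simp only [List.forall_mem_cons] at hxy
    obtain ⟨h1, h2, h3, h4, h5, h6, -⟩ := hxy
    simp only [h1, h2, h3, h4, h5, h6]
  · simp
  · intro s hs t ht e w hw hw'
    simp only [Finset.mem_range] at hs ht
    simp only [List.mem_cons, List.not_mem_nil, or_false] at hw hw'
    rcases hw with rfl | rfl | rfl | rfl | rfl | rfl <;> simp at hw' <;> omega
  · intro s hs
    simp only [Finset.mem_range] at hs
    simp only [List.forall_mem_cons, reg_mem_wires, low_mem_wires, pow_succ, List.not_mem_nil,
      false_imp_iff, implies_true, and_true]
    omega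

/-- The change `delta` is the same for a string and for its flip. So it is computed from the old
bits, added to them, and erased by the circuit for the new string. The parameter `neg` is set in
that last step because `bc` still holds the old bit at `j`. -/
theorem exists_offset_plane (hFH : F ≤ 2 ^ H) {i : ℕ} (hi : i < 2 * h) :
    ∃ C : RevCircuit Wire, C.Bounded (wires F h H) (3 * F) 7 ∧
      ∀ (b : Fin M → Bool) (x : Wire → Bool), hammingWeight b ≤ F →
        hammingWeight (bitFlip j b) ≤ F →
        (∀ s < F, x (.low s i) = (slot b s).testBit i) →
        (∀ s < 2 ^ H, x (.reg .geq s) = decide (numOnes b j ≤ s)) →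
        (∀ s < 2 ^ H, x (.reg .bc (2 ^ H + s)) = b j) →
        (∀ s, x (.reg .delta s) = false) →
        (∀ s < F, C.act x (.low s i) = (slot (bitFlip j b) s).testBit i) ∧
        ∀ w, (∀ s < F, w ≠ .low s i) → C.act x w = x w := by
  obtain ⟨C1, h1, a1⟩ := exists_offset_change F h H j hFH hi false
  obtain ⟨C3, h3, a3⟩ := exists_offset_change F h H j hFH hi true
  obtain ⟨C2, h2, a2⟩ := RevCircuit.exists_layer (wires F h H) (Finset.range F)
    (fun s => Wire.low s i) (fun s => [.reg .delta s]) (fun s x => x (.reg .delta s)) (fun _ => 0) 1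
    (by simp) (by simp) (by intro s _ x y hxy; exact hxy _ (by simp))
    (fun s _ t _ e => (Wire.low.inj e).1) (by simp) (by simp) (by
      intro s hs
      simp only [Finset.mem_range] at hs
      simp only [List.mem_singleton, forall_eq, reg_mem_wires, low_mem_wires, pow_succ]
      omega)
  refine ⟨(C1.seq C2).seq C3, ((h1.seq h2).seq h3).mono ?_ le_rfl, ?_⟩
  · rw [Finset.card_range]
    omega
  intro b x hb hb' hl hg hp hd
  set v : ℕ → Bool := fun s => decide (s < F) &&
    ((slot b s).testBit i ^^ (slot (bitFlip j b) s).testBit i) with hv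
  have e1 := a1 b x hb hl hg (by simpa using hp)
  rw [← hv] at e1
  set y := C2.act (addReg .delta v x) with hy
  have y1 : ∀ w, (∀ s < F, w ≠ .low s i) → y w = addReg .delta v x w := by
    intro w hw
    exact (a2 _).1 w (by simpa using hw)
  have y2 : ∀ s < F, y (.low s i) = (slot (bitFlip j b) s).testBit i := by
    intro s hs
    rw [hy, (a2 _).2 s (by simpa using hs)]
    simp [hl s hs, hd, hv, hs]
  have e3 := a3 (bitFlip j b) y hb' y2
    (by
      intro s hs
      rw [y1 _ (by simp), numOnes_bitFlip_self]
      simpa using hg s hs)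
    (by
      intro s hs
      rw [y1 _ (by simp), bitFlip_self]
      simpa using hp s hs)
  have hv' : (fun s => decide (s < F) && ((slot (bitFlip j b) s).testBit i ^^
      (slot (bitFlip j (bitFlip j b)) s).testBit i)) = v := by
    rw [bitFlip_bitFlip, hv]
    funext s
    rw [Bool.xor_comm]
  rw [hv'] at e3
  have hz : ((C1.seq C2).seq C3).act x = addReg .delta v y := by
    rw [RevCircuit.act_seq, RevCircuit.act_seq, e1, ← hy, e3]
  rw [hz]
  refine ⟨y2, fun w hw => ?_⟩
  rw [← addReg_addReg_self .delta v x]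
  cases w with
  | low s k => exact y1 _ hw
  | reg r k =>
    by_cases hr : r = .delta
    · subst hr
      simp [y1 _ hw]
    · simp [hr, y1 _ hw]

theorem exists_offset_update (hFH : F ≤ 2 ^ H) {m : ℕ} (hm : m ≤ 2 * h) :
    ∃ C : RevCircuit Wire, C.Bounded (wires F h H) (3 * F * m) (7 * m) ∧
      ∀ (b : Fin M → Bool) (x : Wire → Bool), hammingWeight b ≤ F →
        hammingWeight (bitFlip j b) ≤ F →
        (∀ s < F, ∀ i < 2 * h, x (.low s i) = (slot b s).testBit i) →
        (∀ s < 2 ^ H, x (.reg .geq s) = decide (numOnes b j ≤ s)) →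
        (∀ s < 2 ^ H, x (.reg .bc (2 ^ H + s)) = b j) →
        (∀ s, x (.reg .delta s) = false) →
        (∀ s < F, ∀ i < m, C.act x (.low s i) = (slot (bitFlip j b) s).testBit i) ∧
        ∀ w, (∀ s < F, ∀ i < m, w ≠ .low s i) → C.act x w = x w := by
  induction m with
  | zero => exact ⟨.idle _, RevCircuit.bounded_idle _, by simp [RevCircuit.act_idle]⟩
  | succ m ih =>
    obtain ⟨C, hC, a⟩ := ih (by omega)
    obtain ⟨D, hD, d⟩ := exists_offset_plane F h H j hFH (show m < 2 * h by omega)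
    refine ⟨C.seq D, (hC.seq hD).mono (by rw [mul_add, mul_one]) (by omega), ?_⟩
    intro b x hb hb' hl hg hp hd
    obtain ⟨a1, a2⟩ := a b x hb hb' hl hg hp hd
    obtain ⟨d1, d2⟩ := d b (C.act x) hb hb'
      (by
        intro s hs
        rw [a2 _ (by intro t _ k hk e; have := (Wire.low.inj e).2; omega), hl s hs m (by omega)])
      (by intro s hs; rw [a2 _ (by simp), hg s hs])
      (by intro s hs; rw [a2 _ (by simp), hp s hs]) (by intro s; rw [a2 _ (by simp), hd s])
    rw [RevCircuit.act_seq]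
    refine ⟨fun s hs i hi => ?_, fun w hw => ?_⟩
    · rcases Nat.lt_succ_iff_lt_or_eq.1 hi with hi | rfl
      · rw [d2 _ (by intro t _ e; have := (Wire.low.inj e).2; omega), a1 s hs i hi]
      · exact d1 s hs
    · rw [d2 w fun s hs => hw s hs m (by omega), a2 w fun s hs i hi => hw s hs i (by omega)]

end offsets

/-! ### Updating the delimiter tree -/

section carries

variable (F h H : ℕ) {M : ℕ} (j : Fin M)

/-- The change at a node of the bit of the delimiter counts. -/
def nodeChange (b : Fin M → Bool) (i : ℕ) : Bool :=
  decide (1 ≤ i ∧ i < 2 ^ (H + 1)) && (nodeBit H (delims b F (2 * h)) i ^^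
    nodeBit H (delims (bitFlip j b) F (2 * h)) i)

theorem nodeChange_bitFlip (b : Fin M → Bool) :
    nodeChange F h H j (bitFlip j b) = nodeChange F h H j b := by
  funext i
  rw [nodeChange, nodeChange, bitFlip_bitFlip, Bool.xor_comm]

theorem nodeCnt_bitFlip (b : Fin M → Bool) (hbj : b j = false) (i : ℕ) :
    nodeCnt H (delims (bitFlip j b) F (2 * h)) i ≤ nodeCnt H (delims b F (2 * h)) i ∧
    nodeCnt H (delims b F (2 * h)) i ≤ nodeCnt H (delims (bitFlip j b) F (2 * h)) i + 1 := by
  have key : ∀ p, delims (bitFlip j b) F (2 * h) p ≤ delims b F (2 * h) p ∧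
      delims b F (2 * h) p ≤ delims (bitFlip j b) F (2 * h) p + 1 := by
    intro p
    have h1 := delims_mono b F (2 * h) (Nat.sub_le p 1)
    have h2 := (delims_mono b F (2 * h) (show p ≤ p - 1 + 1 by omega)).trans
      (delims_add_le b F (2 * h) (p - 1) 1)
    rw [delims_bitFlip b F (2 * h) j hbj]
    split_ifs <;> omega
  rw [nodeCnt, nodeCnt]
  refine ⟨Nat.div_le_div_right (key _).1, ?_⟩
  have := Nat.one_le_two_pow (n := H - Nat.log 2 i)
  calc delims b F (2 * h) (nodePos H i) / 2 ^ (H - Nat.log 2 i)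
      ≤ (delims (bitFlip j b) F (2 * h) (nodePos H i) + 2 ^ (H - Nat.log 2 i)) /
          2 ^ (H - Nat.log 2 i) := Nat.div_le_div_right ((key _).2.trans (by omega))
    _ = _ := Nat.add_div_right _ (by positivity)

/-- The quotient at a node is half of that at its left child. A deletion can only raise the
quotients, by at most one, and there is a carry to the parent if the child was odd. An insertion can
only lower them, with a borrow if the child was even. -/
theorem nodeChange_internal (b : Fin M → Bool) {i : ℕ} (hi : 1 ≤ i) (hi' : 2 * i < 2 ^ (H + 1)) :
    nodeChange F h H j b i = (nodeChange F h H j b (2 * i) &&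
      (nodeBit H (delims b F (2 * h)) (2 * i) ^^ !b j)) := by
  rw [nodeChange, nodeChange, decide_eq_true (show 1 ≤ i ∧ i < 2 ^ (H + 1) by omega),
    decide_eq_true (show 1 ≤ 2 * i ∧ 2 * i < 2 ^ (H + 1) by omega), Bool.true_and, Bool.true_and]
  unfold nodeBit
  rw [nodeCnt_two_mul _ hi hi', nodeCnt_two_mul _ hi hi']
  cases hbj : b j
  · obtain ⟨h1, h2⟩ := nodeCnt_bitFlip F h H j b hbj (2 * i)
    generalize nodeCnt H (delims (bitFlip j b) F (2 * h)) (2 * i) = n' at *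
    generalize nodeCnt H (delims b F (2 * h)) (2 * i) = n at *
    rcases Nat.mod_two_eq_zero_or_one n with e | e
    · obtain rfl | rfl : n = n' ∨ n = n' + 1 := by omega
      · simp
      · have e' : n' % 2 = 1 := by omega
        rcases Nat.mod_two_eq_zero_or_one (n' / 2) with q | q
        · simp [e, e', q, show (n' + 1) / 2 % 2 = 1 by omega]
        · simp [e, e', q, show (n' + 1) / 2 % 2 = 0 by omega]
    · have : n / 2 = n' / 2 := by omega
      simp [this, e]
  · obtain ⟨h1, h2⟩ := nodeCnt_bitFlip F h H j (bitFlip j b)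
      (by rw [bitFlip_self, hbj]; rfl) (2 * i)
    rw [bitFlip_bitFlip] at h1 h2
    generalize nodeCnt H (delims (bitFlip j b) F (2 * h)) (2 * i) = n' at *
    generalize nodeCnt H (delims b F (2 * h)) (2 * i) = n at *
    rcases Nat.mod_two_eq_zero_or_one n with e | e
    · have : n / 2 = n' / 2 := by omega
      simp [this, e]
    · obtain rfl | rfl : n' = n ∨ n' = n + 1 := by omega
      · simp
      · have e' : (n + 1) % 2 = 0 := by omega
        rcases Nat.mod_two_eq_zero_or_one (n / 2) with q | q
        · simp [e, e', q, show (n + 1) / 2 % 2 = 1 by omega]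
        · simp [e, e', q, show (n + 1) / 2 % 2 = 0 by omega]

/-- Beyond the place of the flipped one the code is shifted by one symbol, so a leaf takes over the
old bit of a neighbour. The last leaf has no right neighbour, but there the count has already
reached `F` and does not change. -/
theorem nodeChange_leaf (hH : 4 * F ≤ 2 ^ H) (b : Fin M → Bool) (hb : hammingWeight b ≤ F)
    {i : ℕ} (hi : 2 ^ H ≤ i) (hi' : i < 2 ^ (H + 1)) (hF : 1 ≤ F) :
    nodeChange F h H j b i = (decide (j.1 / 2 ^ (2 * h) + numOnes b j < i - 2 ^ H) &&
      (nodeBit H (delims b F (2 * h)) i ^^ nodeBit H (delims b F (2 * h))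
        (if b j = true then min (i + 1) (2 ^ (H + 1) - 1) else i - 1))) := by
  obtain ⟨p, rfl⟩ := Nat.exists_eq_add_of_le hi
  have hp : p < 2 ^ H := by rw [pow_succ] at hi'; omega
  have h1 := Nat.one_le_two_pow (n := H)
  rw [nodeChange, decide_eq_true (show 1 ≤ 2 ^ H + p ∧ _ from ⟨by omega, hi'⟩), Bool.true_and,
    Nat.add_sub_cancel_left]
  unfold nodeBit
  rw [nodeCnt_leaf _ hp, nodeCnt_leaf _ hp]
  cases hbj : b j
  · rw [delims_bitFlip b F (2 * h) j hbj]
    by_cases hK : p ≤ j.1 / 2 ^ (2 * h) + numOnes b j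
    · rw [if_pos hK, decide_eq_false (not_lt.2 hK)]
      simp
    · rw [if_neg hK, decide_eq_true (not_le.1 hK), if_neg (by simp), Bool.true_and,
        show 2 ^ H + p - 1 = 2 ^ H + (p - 1) from Nat.add_sub_assoc (by
          generalize j.1 / 2 ^ (2 * h) = K at hK
          omega) _, nodeCnt_leaf _ (by omega)]
  · rw [delims_bitFlip' b F (2 * h) j hbj]
    by_cases hK : p ≤ j.1 / 2 ^ (2 * h) + numOnes b j
    · rw [if_pos hK, decide_eq_false (not_lt.2 hK)]
      simp
    · rw [if_neg hK, decide_eq_true (not_le.1 hK), if_pos rfl, Bool.true_and]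
      by_cases hl : p + 1 < 2 ^ H
      · rw [min_eq_left (by rw [pow_succ]; omega), Nat.add_assoc, nodeCnt_leaf _ hl]
      · rw [min_eq_right (by rw [pow_succ]; omega),
          show 2 ^ (H + 1) - 1 = 2 ^ H + p by rw [pow_succ]; omega, nodeCnt_leaf _ hp,
          delims_of_le b F (2 * h) hb (by omega), delims_of_le b F (2 * h) hb (by omega)]

/-- The circuit that adds to the register `carry` the changes of the delimiter tree. -/
theorem exists_carry_network (hF : 1 ≤ F) (hH : 4 * F ≤ 2 ^ H) (neg : Bool) :
    ∃ C : RevCircuit Wire, C.Bounded (wires F h H) (2 ^ (H + 1)) (3 * (H + 1)) ∧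
      ∀ (b : Fin M → Bool) (x : Wire → Bool), hammingWeight b ≤ F →
        (∀ i < 2 ^ (H + 1), x (.reg .beta i) = nodeBit H (delims b F (2 * h)) i) →
        (∀ s < 2 ^ H, x (.reg .geq s) = decide (numOnes b j ≤ s)) →
        (∀ i, 1 ≤ i → i < 2 ^ (H + 1) → (x (.reg .bc i) ^^ neg) = b j) →
        (∀ i, x (.reg .carry i) = false) →
        C.act x = addReg .carry (nodeChange F h H j b) x := by
  refine (exists_reg_network (wires F h H) .carry (Finset.Ico 1 (2 ^ (H + 1)))
    (fun i => if i < 2 ^ H then [.reg .carry (2 * i), .reg .beta (2 * i), .reg .bc i] else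
      if i - 2 ^ H ≤ j.1 / 2 ^ (2 * h) then [] else
        [.reg .geq (i - 2 ^ H - 1 - j.1 / 2 ^ (2 * h)), .reg .bc i, .reg .beta i,
          .reg .beta (i - 1), .reg .beta (min (i + 1) (2 ^ (H + 1) - 1))])
    (fun i x => if i < 2 ^ H then x (.reg .carry (2 * i)) &&
        (x (.reg .beta (2 * i)) ^^ !(x (.reg .bc i) ^^ neg)) else
      if i - 2 ^ H ≤ j.1 / 2 ^ (2 * h) then false else
        x (.reg .geq (i - 2 ^ H - 1 - j.1 / 2 ^ (2 * h))) && (x (.reg .beta i) ^^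
          if (x (.reg .bc i) ^^ neg) = true then x (.reg .beta (min (i + 1) (2 ^ (H + 1) - 1)))
          else x (.reg .beta (i - 1))))
    -- The levels are processed from the leaves upwards. Adjacent leaves read each other's bits,
    -- hence three steps per level.
    (fun i => 3 * (H - Nat.log 2 i) + i % 3) (3 * (H + 1)) ?_ ?_ ?_ ?_ ?_ ?_).elim ?_
  pick_goal 7
  · rintro C ⟨hC, hact⟩
    refine ⟨C, hC.mono (by simp) le_rfl, fun b x hb hβ hg hp hc => hact x _ ?_ ?_⟩
    · intro i hi
      rw [Finset.mem_Ico] at hi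
      rw [nodeChange, decide_eq_false hi, Bool.false_and]
    · intro i hi
      rw [Finset.mem_Ico] at hi
      have h2 := pow_succ 2 H
      simp only [addReg_same, hc, Bool.false_xor, addReg_of_ne (show Reg.beta ≠ .carry by decide),
        addReg_of_ne (show Reg.bc ≠ .carry by decide),
        addReg_of_ne (show Reg.geq ≠ .carry by decide)]
      have hleaf := fun hle => nodeChange_leaf F h H j hH b hb (i := i) hle hi.2 hF
      generalize j.1 / 2 ^ (2 * h) = K at hleaf ⊢
      split_ifs with h1 h3
      · rw [hp i hi.1 hi.2, hβ _ (by omega), nodeChange_internal F h H j b hi.1 (by omega)]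
      · rw [hleaf (by omega), decide_eq_false (by omega),
          Bool.false_and]
      · rename_i hpb
        rw [hp i hi.1 hi.2] at hpb
        rw [hβ i hi.2, hβ _ (by omega), hg _ (by omega),
          hleaf (by omega), if_pos hpb]
        congr 1
        rw [decide_eq_decide]
        omega
      · rename_i hpb
        rw [hp i hi.1 hi.2] at hpb
        rw [hβ i hi.2, hβ _ (by omega), hg _ (by omega),
          hleaf (by omega), if_neg hpb]
        congr 1
        rw [decide_eq_decide]
        omega
  · intro i hi
    have := log_le (Finset.mem_Ico.1 hi).2
    omega
  · intro i _
    split_ifs <;> simp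
  · intro i _ x y hxy
    split_ifs at hxy with h1 h2
    · simp only [List.forall_mem_cons] at hxy
      obtain ⟨e1, e2, e3, -⟩ := hxy
      simp only [h1, if_true, e1, e2, e3]
    · simp only [h1, h2, if_true, if_false]
    · simp only [List.forall_mem_cons] at hxy
      obtain ⟨e1, e2, e3, e4, e5, -⟩ := hxy
      simp only [h1, h2, if_false, e1, e2, e3, e4, e5]
  · intro i hi k hk e
    rw [Finset.mem_Ico] at hi hk
    split_ifs at e with h1 h2
    · simp at e
      have h3 := log_le hk.2
      have h4 : Nat.log 2 k = Nat.log 2 i + 1 := by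
        rw [e, log_half (by omega), Nat.mul_div_cancel_left _ (by norm_num)]
      omega
    · simp at e
    · simp at e
  · intro i hi k hk hτ w hw hw'
    rw [Finset.mem_Ico] at hi hk
    have hlog : Nat.log 2 i = Nat.log 2 k := by
      have := log_le hi.2
      have := log_le hk.2
      omega
    have hmod : i % 3 = k % 3 := by
      omega
    have hleaf : ∀ n, 1 ≤ n → n < 2 ^ (H + 1) → (n < 2 ^ H ↔ Nat.log 2 n < H) := by
      intro n hn _
      exact (Nat.log_lt_iff_lt_pow one_lt_two (by omega)).symm
    have hik := (hleaf i hi.1 hi.2).trans (hlog ▸ (hleaf k hk.1 hk.2).symm)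
    clear hleaf hτ hlog
    generalize j.1 / 2 ^ (2 * h) = K at *
    split_ifs at hw hw' with h1 h2 h3 h4 h5 h6
    all_goals first
      | exact absurd hw List.not_mem_nil
      | exact absurd hw' List.not_mem_nil
      | omega
      | skip
    all_goals
      simp only [List.mem_cons, List.not_mem_nil, or_false] at hw
      rcases hw with rfl | rfl | rfl | rfl | rfl <;> simp at hw' <;> omega
  · intro i hi
    rw [Finset.mem_Ico] at hi
    have h2 := pow_succ 2 H
    refine ⟨hi.2, ?_⟩
    generalize j.1 / 2 ^ (2 * h) = K
    split_ifs <;> simp only [List.forall_mem_cons, reg_mem_wires, List.not_mem_nil,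
      false_imp_iff, implies_true, and_true]
    all_goals omega

/-- The circuit that updates the delimiter tree. -/
theorem exists_tree_update (hF : 1 ≤ F) (hH : 4 * F ≤ 2 ^ H) :
    ∃ C : RevCircuit Wire, C.Bounded (wires F h H) (3 * 2 ^ (H + 1)) (6 * (H + 1) + 1) ∧
      ∀ (b : Fin M → Bool) (x : Wire → Bool), hammingWeight b ≤ F →
        hammingWeight (bitFlip j b) ≤ F →
        (∀ i < 2 ^ (H + 1), x (.reg .beta i) = nodeBit H (delims b F (2 * h)) i) →
        (∀ s < 2 ^ H, x (.reg .geq s) = decide (numOnes b j ≤ s)) →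
        (∀ i, 1 ≤ i → i < 2 ^ (H + 1) → x (.reg .bc i) = b j) →
        (∀ i, x (.reg .carry i) = false) →
        C.act x = addReg .beta (nodeChange F h H j b) x := by
  obtain ⟨C1, h1, a1⟩ := exists_carry_network F h H j hF hH false
  obtain ⟨C3, h3, a3⟩ := exists_carry_network F h H j hF hH true
  obtain ⟨C2, h2, a2⟩ := exists_reg_layer (wires F h H) .beta (Finset.range (2 ^ (H + 1)))
    (fun i => [.reg .carry i]) (fun i x => x (.reg .carry i)) (fun _ => 0) 1
    (by simp) (by simp) (by intro s _ x y hxy; exact hxy _ (by simp)) (by simp) (by simp)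
    (by simp [reg_mem_wires])
  -- `nodeChange` is symmetric in the two strings, so the network of the new string, run backwards,
  -- erases `carry`. Again `bc` holds the old bit, hence `neg = true` in `C3`.
  refine ⟨(C1.seq C2).seq C3.inv, ((h1.seq h2).seq h3.inv).mono ?_ ?_, ?_⟩
  · rw [Finset.card_range]
    omega
  · omega
  intro b x hb hb' hβ hg hp hc
  rw [RevCircuit.act_seq, RevCircuit.act_seq, a1 b x hb hβ hg (by simpa using hp) hc, a2]
  refine RevCircuit.act_inv_of_eq _ ?_
  have hβ' : ∀ i < 2 ^ (H + 1), addReg .beta (nodeChange F h H j b) x (.reg .beta i) =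
      nodeBit H (delims (bitFlip j b) F (2 * h)) i := by
    intro i hi
    rw [addReg_same, hβ i hi, nodeChange]
    by_cases h0 : 1 ≤ i
    · rw [decide_eq_true ⟨h0, hi⟩]
      simp
    -- The index `0` is not a node of the tree; truncated subtraction assigns it the position `0`,
    -- where both counts vanish.
    · obtain rfl : i = 0 := by omega
      have : nodePos H 0 = 0 := by simp [nodePos]
      simp [nodeBit, nodeCnt, this, delims_zero]
  rw [a3 (bitFlip j b) _ hb' hβ' (by simpa [numOnes_bitFlip_self] using hg)
    (by simpa [bitFlip_self] using hp) (by simpa using hc), nodeChange_bitFlip,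
    addReg_comm (by decide)]
  congr 1
  funext i
  rw [addReg_same, hc, Bool.false_xor, nodeChange]
  by_cases hi : i < 2 ^ (H + 1)
  · simp [hi]
  · simp [hi]

end carries

/-- The circuit that replaces the string by the one with the bit at `j` negated. -/
theorem exists_update (F h H : ℕ) {M : ℕ} (j : Fin M) (hF : 1 ≤ F) (hH : 4 * F ≤ 2 ^ H) :
    ∃ C : RevCircuit Wire, C.Bounded (wires F h H) (6 * h * F + 5 * 2 ^ (H + 1))
      (14 * h + 10 * (H + 1) + 1) ∧
      ∀ (b : Fin M → Bool) (x : Wire → Bool), hammingWeight b ≤ F →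
        hammingWeight (bitFlip j b) ≤ F → Holds F h H b x →
        (∀ s < 2 ^ H, x (.reg .geq s) = decide (numOnes b j ≤ s)) → x (.reg .pres 0) = b j →
        (∀ i, x (.reg .bc i) = false) → (∀ i, x (.reg .carry i) = false) →
        (∀ i, x (.reg .delta i) = false) →
        Holds F h H (bitFlip j b) (C.act x) ∧
          ∀ r ≠ Reg.beta, ∀ i, C.act x (.reg r i) = x (.reg r i) := by
  obtain ⟨C1, h1, a1⟩ := exists_broadcast F h H
  obtain ⟨C2, h2, a2⟩ := exists_offset_update F h H j (show F ≤ 2 ^ H by omega) le_rfl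
  obtain ⟨C3, h3, a3⟩ := exists_tree_update F h H j hF hH
  refine ⟨((C1.seq C2).seq C3).seq C1.inv, (((h1.seq h2).seq h3).seq h1.inv).mono ?_ ?_, ?_⟩
  · nlinarith
  · omega
  intro b x hb hb' hx hg hp hbc hc hd
  set v : ℕ → Bool := fun i => decide (1 ≤ i ∧ i < 2 ^ (H + 1)) && b j with hv
  have e1 : C1.act x = addReg .bc v x := by rw [a1 x hbc, hp]
  obtain ⟨l1, l2⟩ := a2 b (addReg .bc v x) hb hb' (by simpa using hx.low) (by simpa using hg)
    (by
      intro s hs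
      have h0 := Nat.one_le_two_pow (n := H)
      have : 1 ≤ 2 ^ H + s ∧ 2 ^ H + s < 2 ^ (H + 1) := by rw [pow_succ]; omega
      simp [hbc, hv, this]) (by simpa using hd)
  set y := C2.act (addReg .bc v x) with hy
  have yr : ∀ r i, y (.reg r i) = addReg .bc v x (.reg r i) := fun r i => l2 _ (by simp)
  have e3 := a3 b y hb hb' (by simpa [yr] using hx.beta) (by simpa [yr] using hg)
    (by
      intro i hi hi'
      simp [yr, hbc, hv, hi, hi']) (by simpa [yr] using hc)
  set z := addReg .beta (nodeChange F h H j b) y with hz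
  have e4 : C1.act (addReg .bc v z) = z := by
    have : ∀ i, addReg .bc v z (.reg .bc i) = false := by simp [hz, yr, hbc]
    rw [a1 _ this]
    have hp' : addReg .bc v z (.reg .pres 0) = b j := by simp [hz, yr, hp]
    rw [hp', ← hv, addReg_addReg_self]
  rw [RevCircuit.act_seq, RevCircuit.act_seq, RevCircuit.act_seq, e1, ← hy, e3,
    RevCircuit.act_inv_of_eq _ e4]
  refine ⟨⟨fun s hs i hi => l1 s hs i hi, fun i hi => ?_⟩, fun r hr i => ?_⟩
  · rw [addReg_of_ne (by decide), hz, addReg_same, yr, addReg_of_ne (by decide), hx.beta i hi,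
      nodeChange]
    by_cases h0 : 1 ≤ i
    · simp [h0, hi]
    · obtain rfl : i = 0 := by omega
      have : nodePos H 0 = 0 := by simp [nodePos]
      simp [nodeBit, nodeCnt, this, delims_zero]
  · by_cases hr' : r = .bc
    · subst hr'
      simp [hz, yr]
    · simp [hz, yr, hr, hr']

end FermionEncoding
-- Flip and rank circuits of the slot structure
namespace FermionEncoding

/-- The state that holds the string `b`, all other registers being zero. -/
noncomputable def heldState (F h H : ℕ) {M : ℕ} (b : Fin M → Bool) : Wire → Bool
  | .low s i => (slot b s).testBit i
  | .reg .beta i => nodeBit H (delims b F (2 * h)) i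
  | .reg _ _ => false

theorem holds_heldState (F h H : ℕ) {M : ℕ} (b : Fin M → Bool) :
    Holds F h H b (heldState F h H b) :=
  ⟨fun _ _ _ _ => rfl, fun _ _ => rfl⟩

theorem heldState_of_ne (F h H : ℕ) {M : ℕ} (b : Fin M → Bool) {r : Reg} (hr : r ≠ .beta) (i : ℕ) :
    heldState F h H b (.reg r i) = false := by
  cases r <;> first | rfl | exact absurd rfl hr

theorem Holds.eq_heldState {F h H M : ℕ} {b : Fin M → Bool} {x : Wire → Bool}
    (hx : Holds F h H b x) (hc : ∀ r ≠ Reg.beta, ∀ i, x (.reg r i) = false) :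
    ∀ w ∈ wires F h H, x w = heldState F h H b w := by
  rintro (⟨s, i⟩ | ⟨r, i⟩) hw
  · exact hx.low s hw.1 i hw.2
  · by_cases hr : r = .beta
    · subst hr
      exact hx.beta i hw
    · rw [hc r hr, heldState_of_ne F h H b hr]

theorem exists_finset_wires (F h H : ℕ) :
    ∃ A : Finset Wire, (∀ w, w ∈ A ↔ w ∈ wires F h H) ∧
      A.card ≤ 2 * h * F + 18 * 2 ^ (H + 1) := by
  let R : Finset Reg := {.beta, .zero, .ltMid, .lt, .neMid, .ne, .qa, .qb, .qc, .fa, .fb, .ee,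
    .tree, .bc, .geq, .pres, .carry, .delta}
  refine ⟨((Finset.range F ×ˢ Finset.range (2 * h)).image fun p => Wire.low p.1 p.2) ∪
    (R ×ˢ Finset.range (2 ^ (H + 1))).image fun p => Wire.reg p.1 p.2, ?_, ?_⟩
  · rintro (⟨s, i⟩ | ⟨r, i⟩)
    · simp [low_mem_wires]
    · have : r ∈ R := by cases r <;> decide
      simp [reg_mem_wires, this]
  · refine (Finset.card_union_le _ _).trans (add_le_add ?_ ?_)
    · refine Finset.card_image_le.trans ?_
      rw [Finset.card_product, Finset.card_range, Finset.card_range, mul_comm]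
    · refine Finset.card_image_le.trans ?_
      rw [Finset.card_product, Finset.card_range]
      exact le_of_eq rfl

theorem restrictBits_congr {W : Type*} {A : Finset W} {n : ℕ} (e : A ≃ Fin n) {x y : W → Bool}
    (h : ∀ w ∈ A, x w = y w) : restrictBits e x = restrictBits e y := by
  funext i
  exact h _ (e.symm i).2

section queries

variable (F h H : ℕ) {M : ℕ} (j : Fin M)

/-- The query is run again after the update. The flip does not change the number of ones before `j`,
so the second run clears `geq`. In `pres` the old and the new bit at `j` add up to one, which a
final negation removes. -/
theorem exists_flip (hh : 1 ≤ h) (hF : 1 ≤ F) (hH : 4 * F ≤ 2 ^ H)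
    (hj : j.1 / 2 ^ (2 * h) < F) :
    ∃ C : RevCircuit Wire, C.Bounded (wires F h H) (100 * (h * F + 2 ^ (H + 1)))
      (150 * (h + H + 1)) ∧
      ∀ b : Fin M → Bool, hammingWeight b ≤ F → hammingWeight (bitFlip j b) ≤ F →
        ∀ w ∈ wires F h H, C.act (heldState F h H b) w = heldState F h H (bitFlip j b) w := by
  obtain ⟨Q, hQ, q⟩ := exists_rank_query F h H j hh hF hH hj
  obtain ⟨U, hU, u⟩ := exists_update F h H j hF hH
  obtain ⟨X, hX, a⟩ := exists_reg_layer (wires F h H) .pres {0} (fun _ => []) (fun _ _ => true)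
    (fun _ => 0) 1 (by simp) (by simp) (by simp) (by simp) (by simp)
    (by simp [reg_mem_wires])
  refine ⟨((Q.seq U).seq Q).seq X, (((hQ.seq hU).seq hQ).seq hX).mono ?_ ?_, ?_⟩
  · rw [Finset.card_singleton]
    have : 1 ≤ 2 ^ (H + 1) := Nat.one_le_two_pow
    nlinarith [Nat.mul_le_mul_right F hh]
  · omega
  intro b hb hb'
  set g : ℕ → Bool := fun i => decide (i < 2 ^ H) && decide (numOnes b j ≤ i) with hg
  set y := Q.act (heldState F h H b) with hy
  have hcl := fun r (hr : r ≠ Reg.beta) => heldState_of_ne F h H b hr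
  have y0 : y = addReg .geq g (addReg .pres (fun i => decide (i = 0) && b j)
      (heldState F h H b)) :=
    q b _ hb (holds_heldState F h H b) fun r hr _ _ => hcl r hr
  obtain ⟨z1, z2⟩ := u b y hb hb'
    (by rw [y0]; exact ((holds_heldState F h H b).addReg (by decide) _).addReg (by decide) _)
    (by
      intro s hs
      simp [y0, hcl, hg, hs])
    (by simp [y0, hcl]) (by simp [y0, hcl]) (by simp [y0, hcl]) (by simp [y0, hcl])
  set z := U.act y with hz
  have t0 : Q.act z = _ := q (bitFlip j b) z hb' z1 (by
    intro r hr h1 h2 i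
    rw [z2 r hr, y0, addReg_of_ne h1, addReg_of_ne h2, hcl r hr])
  rw [numOnes_bitFlip_self, bitFlip_self, ← hg] at t0
  rw [RevCircuit.act_seq, RevCircuit.act_seq, RevCircuit.act_seq, ← hy, ← hz, a, t0]
  refine Holds.eq_heldState (((z1.addReg (by decide) _).addReg (by decide) _).addReg
    (by decide) _) fun r hr i => ?_
  by_cases h1 : r = .pres
  · subst h1
    simp only [addReg_same, addReg_of_ne (show Reg.pres ≠ .geq by decide), z2 _ hr, y0, hcl _ hr,
      Finset.mem_singleton]
    by_cases hi : i = 0 <;> cases b j <;> simp [hi]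
  · rw [addReg_of_ne h1]
    by_cases h2 : r = .geq
    · subst h2
      simp [z2 _ hr, y0, hcl]
    · simp [h1, h2, z2 _ hr, y0, hcl _ hr]

/-- The sign of a wire in the computation of the sign rank. -/
def rankSign : Wire → Bool → ℤ
  | .low _ _, _ => 1
  | .reg .geq _, c => bitSign !c
  | .reg _ _, c => bitSign c

theorem abs_rankSign (w : Wire) (c : Bool) : |rankSign w c| = 1 := by
  rcases w with ⟨s, i⟩ | ⟨r, i⟩
  · rfl
  · cases r <;> exact abs_bitSign _

theorem prod_bitSign_lt {n F : ℕ} (h : n ≤ F) :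
    ∏ s ∈ Finset.range F, bitSign (decide (s < n)) = (-1) ^ n := by
  induction F, h using Nat.le_induction with
  | base =>
    rw [Finset.prod_congr rfl (g := fun _ => (-1 : ℤ)), Finset.prod_const, Finset.card_range]
    intro s hs
    rw [Finset.mem_range] at hs
    simp [bitSign, hs]
  | succ F hF ih =>
    rw [Finset.prod_range_succ, ih]
    simp [bitSign, hF]

/-- Every slot below `F` with vanishing flag `geq` is a one before `j` and contributes a factor
`-1`; the bit in `pres` supplies the factor of `j` itself. The query only adds its answers to
registers, so running it a second time after the layer of signs undoes it. -/
theorem exists_rank {A : Finset Wire} {n : ℕ} (e : A ≃ Fin n)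
    (hA : ∀ w, w ∈ A ↔ w ∈ wires F h H) (hh : 1 ≤ h) (hF : 1 ≤ F) (hH : 4 * F ≤ 2 ^ H)
    (hj : j.1 / 2 ^ (2 * h) < F) :
    ∃ Q : Circuit n, Q.gateCount ≤ opCost * (100 * (h * F + 2 ^ (H + 1))) + (F + 1) ∧
      Q.depth ≤ opCost * (150 * (h + H + 1)) + 1 ∧
      ∀ b : Fin M → Bool, hammingWeight b ≤ F →
        Q.run (basisState (restrictBits e (heldState F h H b))) =
          (sgnRank j b : ℂ) • basisState (restrictBits e (heldState F h H b)) := by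
  obtain ⟨Q, hQ, q⟩ := exists_rank_query F h H j hh hF hH hj
  have hAw : (A : Set Wire) = wires F h H := Set.ext hA
  rw [← hAw] at hQ
  have hn : Wire.reg .pres 0 ∉ (Finset.range F).image (Wire.reg .geq) := by simp
  obtain ⟨P, p1, p2, p3⟩ := exists_circuit_phase e Q Q hQ hQ
    (insert (.reg .pres 0) ((Finset.range F).image (Wire.reg .geq)))
    (by
      intro w hw
      rw [hA]
      simp only [Finset.mem_insert, Finset.mem_image, Finset.mem_range] at hw
      rcases hw with rfl | ⟨s, hs, rfl⟩
      · simp [reg_mem_wires]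
      · rw [reg_mem_wires, pow_succ]
        omega) rankSign abs_rankSign
  refine ⟨P, p1.trans (add_le_add (Nat.mul_le_mul_left _ ?_) ?_),
    p2.trans (add_le_add (Nat.mul_le_mul_left _ ?_) le_rfl), fun b hb => ?_⟩
  · have : 1 ≤ 2 ^ (H + 1) := Nat.one_le_two_pow
    nlinarith [Nat.mul_le_mul_right F hh]
  · refine (Finset.card_insert_le _ _).trans (add_le_add ?_ le_rfl)
    exact Finset.card_image_le.trans (by rw [Finset.card_range])
  · omega
  have hcl := fun r (hr : r ≠ Reg.beta) => heldState_of_ne F h H b hr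
  have hx := holds_heldState F h H b
  have h1 := q b _ hb hx fun r hr _ _ => hcl r hr
  have h2 : Q.act (Q.act (heldState F h H b)) = heldState F h H b := by
    rw [h1, q b _ hb ((hx.addReg (by decide) _).addReg (by decide) _),
      addReg_comm (r := .pres) (by decide), addReg_addReg_self, addReg_addReg_self]
    intro r hr hg hp i
    rw [addReg_of_ne hg, addReg_of_ne hp, hcl r hr]
  rw [p3, h2]
  congr 2
  rw [Finset.prod_insert hn, Finset.prod_image (by intro s _ t _ h; exact (Wire.reg.inj h).2),
    sgnRank_eq, numOnes_succ, occ_fin, pow_add, mul_comm]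
  congr 1
  · rw [← prod_bitSign_lt ((numOnes_le b j).trans hb)]
    refine Finset.prod_congr rfl fun s hs => ?_
    rw [Finset.mem_range] at hs
    rw [rankSign, h1]
    congr 1
    simp [hcl, show s < 2 ^ H by omega, ← decide_not]
  · rw [h1]
    cases hb : b j <;> simp [rankSign, hcl, bitSign]

end queries

theorem exists_slot_structure (M F h H : ℕ) (hh : 1 ≤ h) (hF : 1 ≤ F) (hH : 4 * F ≤ 2 ^ H)
    (hM : M ≤ F * 2 ^ (2 * h)) :
    ∃ n ≤ 2 * h * F + 18 * 2 ^ (H + 1), ∃ D : FermionDataStructure M 0 F n,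
      D.gateComplexity ≤ opCost * (100 * (h * F + 2 ^ (H + 1))) + (F + 1) ∧
      D.depthComplexity ≤ opCost * (150 * (h + H + 1)) + 1 := by
  obtain ⟨A, hA, hcard⟩ := exists_finset_wires F h H
  have hj : ∀ j : Fin M, j.1 / 2 ^ (2 * h) < F := fun j =>
    Nat.div_lt_of_lt_mul (by rw [mul_comm]; exact j.2.trans_le hM)
  refine ⟨A.card, hcard, exists_fermionDataStructure
    (fun b => restrictBits A.equivFin (heldState F h H b.1)) (fun j => ?_) fun j => ?_⟩
  · obtain ⟨C, hC, c⟩ := exists_flip F h H j hh hF hH (hj j)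
    rw [← show (A : Set Wire) = wires F h H from Set.ext hA] at hC
    obtain ⟨Q, q1, q2, q3⟩ := RevCircuit.exists_circuit C A.equivFin hC
    refine ⟨Q, q1.trans (by omega), q2.trans (by omega), fun b hb => ?_⟩
    rw [q3]
    congr 1
    exact restrictBits_congr _ fun w hw => c b.1 b.2.2 hb.2 w ((hA w).1 hw)
  · obtain ⟨Q, q1, q2, q3⟩ := exists_rank F h H j A.equivFin hA hh hF hH (hj j)
    exact ⟨Q, q1, q2, fun b => q3 b.1 b.2.2⟩

theorem exists_vacuum_structure (M : ℕ) :
    ∃ D : FermionDataStructure M 0 0 0, D.gateComplexity ≤ 0 ∧ D.depthComplexity ≤ 0 := by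
  have hz : ∀ b : Occupation M 0 0, ∀ j, b.1 j = false := by
    intro b j
    have h : hammingWeight b.1 = 0 := by have := b.2.2; omega
    rw [hammingWeight, Finset.card_eq_zero, Finset.filter_eq_empty_iff] at h
    simpa using h (Finset.mem_univ j)
  refine exists_fermionDataStructure (fun _ => Fin.elim0) (fun j => ?_) fun j => ?_
  · refine ⟨⟨[], by simp⟩, by simp [Circuit.gateCount], by simp [Circuit.depth], fun b hb => ?_⟩
    have : bitFlip j b.1 j = false := hz ⟨_, hb⟩ j
    rw [bitFlip_self, hz b j] at this
    simp at this
  · refine ⟨⟨[], by simp⟩, by simp [Circuit.gateCount], by simp [Circuit.depth], fun b => ?_⟩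
    have : sgnRank j b.1 = 1 := by simp [sgnRank, hz b]
    simp [this, Circuit.run, runGates]

/-! ### Binomial estimates and the choice of parameters -/

section numerics

/-- Induction through `(k + 1) * (m + 1).choose (k + 1) = (m + 1) * m.choose k`, where the
hypothesis bounds `m + 1` below by `(k + 1) * c`. -/
theorem pow_le_choose_of_mul_le {c : ℕ} (hc : 1 ≤ c) {k n : ℕ} (h : k * c ≤ n) :
    c ^ k ≤ n.choose k := by
  induction k generalizing n with
  | zero => simp
  | succ k ih =>
    obtain ⟨m, rfl⟩ : ∃ m, n = m + 1 := ⟨n - 1, by have := Nat.mul_le_mul_left (k + 1) hc; omega⟩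
    have h1 := ih (n := m) (by nlinarith)
    refine Nat.le_of_mul_le_mul_right (c := k + 1) ?_ (by omega)
    rw [← Nat.add_one_mul_choose_eq, pow_succ]
    calc c ^ k * c * (k + 1) = (k + 1) * c * c ^ k := by ring
      _ ≤ (m + 1) * m.choose k := Nat.mul_le_mul h h1

theorem le_choose {n k : ℕ} (h1 : 1 ≤ k) (h2 : k < n) : n ≤ n.choose k := by
  obtain ⟨k, rfl⟩ : ∃ m, k = m + 1 := ⟨k - 1, by omega⟩
  induction n generalizing k with
  | zero => omega
  | succ n ih =>
    rcases Nat.eq_zero_or_pos k with rfl | hk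
    · simp
    · obtain ⟨k, rfl⟩ : ∃ m, k = m + 1 := ⟨k - 1, by omega⟩
      rw [Nat.choose_succ_succ']
      have := ih k (by omega) (by omega)
      have := Nat.choose_pos (show k + 1 + 1 ≤ n by omega)
      omega

theorem choose_le_two_pow_infoQubits (M F : ℕ) : M.choose F ≤ 2 ^ infoQubits M F := by
  rcases Nat.eq_zero_or_pos (M.choose F) with h | h
  · exact h ▸ Nat.zero_le _
  have h1 : Real.logb 2 (M.choose F : ℝ) ≤ infoQubits M F := Nat.le_ceil _
  rw [Real.logb_le_iff_le_rpow (by norm_num) (by exact_mod_cast h), Real.rpow_natCast] at h1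
  exact_mod_cast h1

theorem le_logb_of_pow_le {k M : ℕ} (hM : 1 ≤ M) (h : 2 ^ k ≤ M) : (k : ℝ) ≤ Real.logb 2 M := by
  rw [Real.le_logb_iff_rpow_le (by norm_num) (by exact_mod_cast hM), Real.rpow_natCast]
  exact_mod_cast h

theorem exists_two_pow_between {m : ℕ} (hm : 1 ≤ m) : ∃ H, m ≤ 2 ^ H ∧ 2 ^ H ≤ 2 * m := by
  refine ⟨Nat.log 2 m + 1, (Nat.lt_pow_succ_log_self one_lt_two m).le, ?_⟩
  rw [pow_succ, mul_comm]
  exact Nat.mul_le_mul_left _ (Nat.pow_log_le_self 2 (by omega))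

/-- Powers of four appear because the offsets have an even number of bits, for the two halves that
borrow from each other. -/
theorem exists_four_pow_between {F M : ℕ} (hF : 1 ≤ F) (h : F < M) :
    ∃ k, F * 2 ^ (2 * k) < M ∧ M ≤ F * 2 ^ (2 * (k + 1)) := by
  have hex : ∃ k, M ≤ F * 2 ^ (2 * k) :=
    ⟨M, (Nat.lt_two_pow_self (n := M)).le.trans ((Nat.pow_le_pow_right (by norm_num)
      (by omega)).trans (Nat.le_mul_of_pos_left _ hF))⟩
  classical
  obtain ⟨k, hk⟩ : ∃ k, Nat.find hex = k + 1 := by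
    refine Nat.exists_eq_succ_of_ne_zero fun h0 => ?_
    have := Nat.find_spec hex
    rw [h0] at this
    omega
  refine ⟨k, not_le.1 (Nat.find_min hex (by omega)), ?_⟩
  rw [← hk]
  exact Nat.find_spec hex

/-- The data structure, with its depth bounded in terms of `log₂ M`. -/
theorem exists_structure_logb : ∃ A : ℕ, 1 ≤ A ∧ ∀ M F : ℕ, 3 ≤ M → F < M →
    ∃ (n : ℕ) (D : FermionDataStructure M 0 F n), n ≤ infoQubits M F + A * F ∧
      D.gateComplexity ≤ A * infoQubits M F ∧
      (D.depthComplexity : ℝ) ≤ A * Real.logb 2 M := by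
  refine ⟨3000 * (opCost + 1), by omega, fun M F hM hFM => ?_⟩
  have hL : (1 : ℝ) ≤ Real.logb 2 M := by
    have := le_logb_of_pow_le (k := 1) (M := M) (by omega) (by omega)
    simpa using this
  have hI := choose_le_two_pow_infoQubits M F
  generalize infoQubits M F = I at *
  have tree_structure := exists_tree_structure M F
  have slot_structure := exists_slot_structure M F
  generalize opCost = c at *
  rcases Nat.eq_zero_or_pos F with rfl | hF
  · obtain ⟨D, h1, h2⟩ := exists_vacuum_structure M
    refine ⟨0, D, by omega, h1.trans (Nat.zero_le _), ?_⟩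
    rw [Nat.le_zero.1 h2, Nat.cast_zero]
    positivity
  rcases Nat.lt_or_ge (2 * F) M with hlt | hge
  · obtain ⟨k, k1, k2⟩ := exists_four_pow_between hF hFM
    obtain ⟨H, H1, H2⟩ := exists_two_pow_between hF
    -- With `H + 2` the tree has between `4 * F` and `8 * F` leaves.
    obtain ⟨n, hn, D, h1, h2⟩ := slot_structure (k + 1) (H + 2) (by omega) hF
      (by rw [pow_add]; omega) k2
    have e8 : 2 ^ (H + 2 + 1) = 8 * 2 ^ H := by ring
    have hFI : F ≤ I := (Nat.pow_le_pow_iff_right one_lt_two).1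
      ((pow_le_choose_of_mul_le one_le_two (by omega)).trans hI)
    -- The information bound pays for `2 * k` of the `2 * (k + 1)` bits of each offset; the other
    -- two per slot go into the `O(F)` term.
    have hkI : 2 * k * F ≤ I := by
      have := (pow_le_choose_of_mul_le Nat.one_le_two_pow k1.le).trans hI
      rwa [← pow_mul, Nat.pow_le_pow_iff_right one_lt_two] at this
    have hkL := le_logb_of_pow_le (k := 2 * k) (M := M) (by omega)
      ((Nat.le_mul_of_pos_left _ hF).trans k1.le)
    have hHL := le_logb_of_pow_le (k := H) (M := M) (by omega) (by omega)
    refine ⟨n, D, hn.trans ?_, h1.trans ?_, ?_⟩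
    · rw [e8]
      nlinarith [Nat.zero_le (c * F)]
    · rw [e8]
      have : (k + 1) * F + 8 * 2 ^ H ≤ 18 * I := by nlinarith
      nlinarith [Nat.mul_le_mul_left c this, Nat.zero_le (c * I)]
    · have h2' : (D.depthComplexity : ℝ) ≤ c * (150 * (k + 1 + (H + 2) + 1)) + 1 := by
        exact_mod_cast h2
      push_cast at hkL ⊢
      have : (k : ℝ) + 1 + (H + 2) + 1 ≤ 6 * Real.logb 2 M := by linarith
      have hc : (0 : ℝ) ≤ c := c.cast_nonneg
      nlinarith [mul_le_mul_of_nonneg_left this hc]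
  -- Here `le_choose` gives `M ≤ 2 ^ I`, hence `H ≤ I + 1`, which pays for the gates of the parity
  -- tree; its `O(M)` qubits are `O(F)` as `M ≤ 2 * F`.
  · obtain ⟨H, H1, H2⟩ := exists_two_pow_between (show 1 ≤ M by omega)
    obtain ⟨n, hn, D, h1, h2⟩ := tree_structure H H1
    have hMI := (le_choose hF hFM).trans hI
    have hI1 : 1 ≤ I := by
      rcases Nat.eq_zero_or_pos I with rfl | h
      · omega
      · exact h
    have hHI : H ≤ I + 1 := by
      rw [← Nat.pow_le_pow_iff_right one_lt_two, pow_succ]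
      omega
    obtain ⟨H, rfl⟩ : ∃ H', H = H' + 1 := by
      refine ⟨H - 1, ?_⟩
      rcases Nat.eq_zero_or_pos H with rfl | h
      · omega
      · omega
    have hHL := le_logb_of_pow_le (k := H) (M := M) (by omega) (by rw [pow_succ] at H2; omega)
    refine ⟨n, D, hn.trans ?_, h1.trans ?_, ?_⟩
    · rw [pow_succ]
      nlinarith [Nat.zero_le (c * F)]
    · nlinarith [Nat.mul_le_mul_left c hHI, Nat.mul_le_mul_left c hI1]
    · have h2' : (D.depthComplexity : ℝ) ≤ c * (H + 1 + 1) + 1 + (H + 1) := by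
        exact_mod_cast h2
      push_cast
      have : (H : ℝ) + 1 + 1 ≤ 3 * Real.logb 2 M := by linarith
      have hc : (0 : ℝ) ≤ c := c.cast_nonneg
      nlinarith [mul_le_mul_of_nonneg_left this hc, mul_nonneg hc (zero_le_one.trans hL)]

end numerics

end FermionEncoding

theorem theorem5 :
    ∃ C : ℝ, 0 < C ∧ ∀ M F : ℕ, 3 ≤ M → F < M →
      ∃ (n : ℕ) (D : FermionEncoding.FermionDataStructure M 0 F n),
        (n : ℝ) ≤ (FermionEncoding.infoQubits M F : ℝ) + C * (F : ℝ) ∧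
        (D.gateComplexity : ℝ) ≤ C * (FermionEncoding.infoQubits M F : ℝ) ∧
        (D.depthComplexity : ℝ) ≤
          C * (Real.logb 2 (M : ℝ) * Real.logb 2 (Real.logb 2 (M : ℝ))) := by
  obtain ⟨A, hA, key⟩ := FermionEncoding.exists_structure_logb
  have h3 : 1 < Real.logb 2 3 := by
    rw [Real.lt_logb_iff_rpow_lt (by norm_num) (by norm_num)]
    norm_num
  -- This is the least value of the iterated logarithm over `M ≥ 3`, and it is positive. Dividing by
  -- it inserts the factor `log₂ log₂ M` into the depth bound.
  set c := Real.logb 2 (Real.logb 2 3) with hc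
  have hc0 : 0 < c := Real.logb_pos (by norm_num) h3
  have hA0 : (0 : ℝ) < A := by exact_mod_cast hA
  have hAC : (A : ℝ) ≤ A + A / c := le_add_of_nonneg_right (by positivity)
  refine ⟨A + A / c, by positivity, fun M F hM hF => ?_⟩
  obtain ⟨n, D, h1, h2, h4⟩ := key M F hM hF
  refine ⟨n, D, ?_, ?_, ?_⟩
  · calc (n : ℝ) ≤ FermionEncoding.infoQubits M F + A * F := by exact_mod_cast h1
      _ ≤ _ := by gcongr
  · calc (D.gateComplexity : ℝ) ≤ A * FermionEncoding.infoQubits M F := by exact_mod_cast h2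
      _ ≤ _ := by gcongr
  · have hM' : (3 : ℝ) ≤ M := by exact_mod_cast hM
    have hL : Real.logb 2 3 ≤ Real.logb 2 M :=
      Real.logb_le_logb_of_le (by norm_num) (by norm_num) hM'
    have hLL : c ≤ Real.logb 2 (Real.logb 2 M) :=
      Real.logb_le_logb_of_le (by norm_num) (by linarith) hL
    have hL0 : 0 ≤ Real.logb 2 (M : ℝ) := by linarith
    calc (D.depthComplexity : ℝ) ≤ A * Real.logb 2 M := h4
      _ = A / c * (Real.logb 2 M * c) := by field_simp
      _ ≤ (A + A / c) * (Real.logb 2 M * Real.logb 2 (Real.logb 2 M)) := by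
        gcongr
        exact le_add_of_nonneg_left hA0.le
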